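/- **Diagrams.** A (Clifford) ZX diagram is a finite graph $G=(V,E)$ with vertex types $t:V\to\{Z,X,H,B\}$ and phases $\alpha:V\to\{0,\frac\pi2,\pi,\frac{3\pi}2\}$, where $H$-vertices (Hadamards) have degree $2$ and $B$-vertices (boundaries) have degree $1$. Its interpretation $[\![D]\!]$ is the linear map (tensor indexed by the boundaries) obtained by contracting $|0\cdots0\rangle+e^{i\alpha}|1\cdots1\rangle$ at $Z$-spiders, $|+\cdots+\rangle+e^{i\alpha}|-\cdots-\rangle$ at $X$-spiders and the Hadamard matrix at $H$-vertices. Interpretations are compared up to a nonzero scalar. **Distance.** An error $\mathcal E$ in $D$ is a set of edge flips $(e,\tau)$ with $e\in E$, $\tau\in\{X,Z\}$; $D+\mathcal E$ is $D$ with the Pauli matrices $\tau$ inserted on the edges $e$, and the weight of $\mathcal E$ is the number of edges it affects. The distance of $D$ is the least weight of an error with $[\![D+\mathcal E]\!]\ne[\![D]\!]$ and $[\![D+\mathcal E]\!]\neq 0$ ($\infty$ if there is none). A rewrite $D_1\to D_2$ (with matched boundaries) is distance-preserving if $[\![D_1]\!]=[\![D_2]\!]$ and, for every diagram (parallel edges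 and loops allowed) in which $D_1$ or $D_2$ occurs, replacing one by the other does not change the distance. **Flow.** An MC flow on $D$ is a partial order $\le$ on $V$ together with directed paths $\mathcal P_1,\dots,\mathcal P_k$ in $G$, each with distinct vertices, such that: (O1) $x\to y\in\mathcal P_i$ implies $x\le y$; (O2) if $x\to y\in\mathcal P_i$ and $z$ is a neighbour of $y$, then $z\to y\in\mathcal P_j$ for some $j$, or $x\le z$; (P1) for each boundary and each Hadamard vertex some path contains it and covers all its edges; (P2) each $Z$- and $X$-spider has at most one edge not covered by any path; (P3) no edge is covered by more than one path. It is well-covered if (P4) no path starts or finishes at a $Z$- or $X$-spider of degree greater than $1$. **Circuits.** A circuit is in low-weight Clifford and measurement form if it is generated by preparations of $|0\rangle$ and $|+\rangle$, destructive measurements $\langle 0|$ and $\langle +|$, single-qubit Clifford gates, CNOTs, and Pauli measurements $Z$, $X$, $ZZ$, $XX$ (all with the syndrome-free outcome). Each gate is read as its standard ZX diagram: a CNOT is a $Z$-spider on the control joined to an $X$-spider on the target; $ZZ$ is two joined $Z$-spiders; $Z$ is a $Z$-spider joined to a one-legged $X$-spider; colours are reversed for $XX$ and $X$. **Proposition.**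 Let $D=(G,t,\alpha)$ be a ZX diagram on a finite simple graph $G$ of maximum degree at most $3$, with no isolated spider of phase $\pi$ (such a spider is the scalar $0$), and suppose $D$ has a well-covered MC flow. Then $D$ can be turned by distance-preserving rewriting into a circuit $C$ in low-weight Clifford and measurement form. More precisely, there are such a circuit $C$ and a bijection between the boundaries of $D$ and those of $C$ for which the rewrite $D\to C$ is distance-preserving, and for which the inputs (outputs) of $C$ correspond to the boundaries of $D$ at which a path of the flow of nonzero length starts (finishes). -/

import Mathlib

/-! # ZX diagrams, ZX distance, measurement-circuit flow and low-weight Clifford circuits -/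

/-- The two colours of the calculus: of spiders, and of edge flips. -/
inductive Color where
  | Z
  | X

/-- The opposite colour. -/
def Color.opp : Color → Color
  | .Z => .X
  | .X => .Z

/-- Vertex types: `Z`- and `X`-spiders, Hadamard nodes, boundary nodes. -/
inductive NodeType where
  | spider (c : Color)
  | hadamard
  | boundary

/-- An undirected multigraph with vertex types and phases; the phase `k : ZMod 4` stands for
`k * π / 2` and only matters at spiders. Each edge `e` has the two ends `ends e false` and
`ends e true`; the order of the two ends carries no meaning. -/
structure ZXDiagram (V E : Type) where
  ends : E → Bool → V
  type : V → NodeType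
  phase : V → ZMod 4

namespace ZXDiagram

variable {V E : Type}

/-- Boundary nodes. -/
abbrev Boundary (D : ZXDiagram V E) : Type := {v : V // D.type v = .boundary}

/-- Nodes that are not boundary nodes. -/
abbrev Interior (D : ZXDiagram V E) : Type := {v : V // D.type v ≠ .boundary}

/-- `v` is a `Z`- or `X`-spider. -/
def IsSpider (D : ZXDiagram V E) (v : V) : Prop := ∃ c, D.type v = .spider c

/-- The two vertices are joined by an edge. -/
def Adj (D : ZXDiagram V E) (v w : V) : Prop :=
  ∃ e, (D.ends e false = v ∧ D.ends e true = w) ∨ (D.ends e false = w ∧ D.ends e true = v)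

/-- The underlying graph is simple: there are no loops and no parallel edges. -/
def IsSimple (D : ZXDiagram V E) : Prop :=
  (∀ e, D.ends e false ≠ D.ends e true) ∧
    Function.Injective fun e => s(D.ends e false, D.ends e true)

open Classical in
/-- The legs of `v`: the edge ends at `v`. -/
noncomputable def legs [Fintype E] (D : ZXDiagram V E) (v : V) : Finset (E × Bool) :=
  Finset.univ.filter fun h => D.ends h.1 h.2 = v

/-- The degree of `v` (a loop counts twice). -/
noncomputable def degree [Fintype E] (D : ZXDiagram V E) (v : V) : ℕ := (D.legs v).card

/-- Hadamard nodes have exactly two legs, boundary nodes exactly one. -/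
def WellFormed [Fintype E] (D : ZXDiagram V E) : Prop :=
  (∀ v, D.type v = .hadamard → D.degree v = 2) ∧ (∀ v, D.type v = .boundary → D.degree v = 1)

/-! ## Errors and interpretation -/

/-- An error is a set of edge flips `(e, t)`, `t` being `Z` or `X`; both flips on an edge make
a `Y` flip. -/
abbrev Error (_D : ZXDiagram V E) : Type := Finset (E × Color)

open Classical in
/-- The weight of an error is the number of affected edges. -/
noncomputable def Error.weight {D : ZXDiagram V E} (err : D.Error) : ℕ := (err.image Prod.fst).card

open Classical in
/-- The tensor of the vertex `v`, when the legs carry the basis labels `x` (`false` is `|0⟩`, `true`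
is `|1⟩`) and the boundary nodes the labels `b`:
`|0…0⟩ + i^k |1…1⟩` for a `Z`-spider, `|+…+⟩ + i^k |-…-⟩` for an `X`-spider, the Hadamard matrix,
and the identity at a boundary node. -/
noncomputable def nodeTensor [Fintype E] (D : ZXDiagram V E) (b : D.Boundary → Bool)
    (x : E × Bool → Bool) (v : V) : ℂ :=
  match D.type v with
  | .spider .Z =>
      (∏ h ∈ D.legs v, if x h then 0 else 1) +
        Complex.I ^ (D.phase v).val * ∏ h ∈ D.legs v, if x h then 1 else 0
  | .spider .X =>
      (∏ _h ∈ D.legs v, ((1 / Real.sqrt 2 : ℝ) : ℂ)) +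
        Complex.I ^ (D.phase v).val *
          ∏ h ∈ D.legs v, if x h then -((1 / Real.sqrt 2 : ℝ) : ℂ) else ((1 / Real.sqrt 2 : ℝ) : ℂ)
  | .hadamard => ((1 / Real.sqrt 2 : ℝ) : ℂ) * if ∀ h ∈ D.legs v, x h = true then -1 else 1
  | .boundary => ∏ h ∈ D.legs v, if ∃ hv, x h = b ⟨v, hv⟩ then 1 else 0

open Classical in
/-- The matrix on the edge `e`: the identity, with the Pauli matrices of the flips on `e` inserted.
(For a `Y` flip the order of the two factors only changes a sign.) -/
noncomputable def edgeTensor (D : ZXDiagram V E) (err : D.Error) (x : E × Bool → Bool) (e : E) : ℂ :=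
  (if (e, Color.Z) ∈ err ∧ x (e, false) = true then -1 else 1) *
    (if x (e, false) ≠ x (e, true) ↔ (e, Color.X) ∈ err then 1 else 0)

open Classical in
/-- The interpretation of `D` with the error `err`: the linear map, given as the tensor of its
matrix entries, indexed by the labels of all boundary nodes. -/
noncomputable def interpErr [Fintype V] [Fintype E] (D : ZXDiagram V E) (err : D.Error) :
    (D.Boundary → Bool) → ℂ :=
  fun b => ∑ x : E × Bool → Bool, (∏ v, D.nodeTensor b x v) * ∏ e, D.edgeTensor err x e

/-- The interpretation of `D`. -/
noncomputable def interp [Fintype V] [Fintype E] (D : ZXDiagram V E) : (D.Boundary → Bool) → ℂ :=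
  D.interpErr ∅

/-- Equality up to a nonzero scalar. -/
def EqUpToScalar {α : Type} (f g : α → ℂ) : Prop := ∃ c : ℂ, c ≠ 0 ∧ f = c • g

/-- The error leaves the interpretation unchanged. -/
def Error.Trivial [Fintype V] [Fintype E] {D : ZXDiagram V E} (err : D.Error) : Prop :=
  EqUpToScalar (D.interpErr err) D.interp

/-- The error makes the interpretation zero. -/
def Error.Detectable [Fintype V] [Fintype E] {D : ZXDiagram V E} (err : D.Error) : Prop :=
  D.interpErr err = 0

/-- The ZX distance: the least weight of a non-trivial undetectable error (`⊤` if there is none). -/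
noncomputable def dist [Fintype V] [Fintype E] (D : ZXDiagram V E) : ℕ∞ :=
  ⨅ err ∈ {err : D.Error | ¬ err.Trivial ∧ ¬ err.Detectable}, (err.weight : ℕ∞)

end ZXDiagram

/-! ## Distance-preserving rewrites -/

/-- A surrounding of a diagram with boundary `B`: the remaining vertices `W` and the
remaining edges `F` of a diagram in which it occurs, where `attach b` is the vertex
outside at which the leg `b` ends (possibly a boundary node of the whole). -/
structure ZXContext (B W F : Type) extends ZXDiagram W F where
  attach : B → W

namespace ZXContext

variable {V E W F : Type}

open Classical in
/-- The whole diagram, in which `D` occurs with surrounding `K`. -/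
noncomputable def plug (D : ZXDiagram V E) (K : ZXContext D.Boundary W F) :
    ZXDiagram (D.Interior ⊕ W) (E ⊕ F) where
  ends := Sum.elim
    (fun e s =>
      if h : D.type (D.ends e s) = .boundary then Sum.inr (K.attach ⟨D.ends e s, h⟩)
      else Sum.inl ⟨D.ends e s, h⟩)
    (fun f s => Sum.inr (K.ends f s))
  type := Sum.elim (fun v => D.type v) K.type
  phase := Sum.elim (fun v => D.phase v) K.phase

/-- The same surrounding, for a diagram whose legs correspond to the given ones via `σ`. -/
def transport {B B' : Type} (K : ZXContext B W F) (σ : B ≃ B') : ZXContext B' W F where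
  toZXDiagram := K.toZXDiagram
  attach := fun b => K.attach (σ.symm b)

end ZXContext

namespace ZXDiagram

variable {V E V' E' : Type}

/-- The two diagrams have the same interpretation up to a nonzero scalar, when their legs are
matched by `σ`. -/
def SemEquiv [Fintype V] [Fintype E] [Fintype V'] [Fintype E'] (D₁ : ZXDiagram V E)
    (D₂ : ZXDiagram V' E') (σ : D₁.Boundary ≃ D₂.Boundary) : Prop :=
  EqUpToScalar (fun b => D₂.interp fun v => b (σ.symm v)) D₁.interp

/-- In no diagram in which `D₁` occurs does replacing it by `D₂` decrease the distance. -/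
def DistanceNonDecreasing [Fintype V] [Fintype E] [Fintype V'] [Fintype E'] (D₁ : ZXDiagram V E)
    (D₂ : ZXDiagram V' E') (σ : D₁.Boundary ≃ D₂.Boundary) : Prop :=
  ∀ (W F : Type) [Fintype W] [Fintype F] (K : ZXContext D₁.Boundary W F),
    (K.plug D₁).WellFormed →
      (letI := Fintype.ofFinite D₁.Interior; (K.plug D₁).dist) ≤
        (letI := Fintype.ofFinite D₂.Interior; ((K.transport σ).plug D₂).dist)

/-- The rewrite `D₁ → D₂` is distance-preserving: it is sound, and it and its inverse are
distance non-decreasing. -/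
def DistancePreserving [Fintype V] [Fintype E] [Fintype V'] [Fintype E'] (D₁ : ZXDiagram V E)
    (D₂ : ZXDiagram V' E') (σ : D₁.Boundary ≃ D₂.Boundary) : Prop :=
  SemEquiv D₁ D₂ σ ∧ DistanceNonDecreasing D₁ D₂ σ ∧ DistanceNonDecreasing D₂ D₁ σ.symm

/-! ## Measurement-circuit flow (on simple graphs) -/

/-- A measurement-circuit flow: a partial order on the vertices and directed paths
`path 1, …, path k`, each given by its sequence of (distinct, consecutively adjacent) vertices.
`[x, y] <:+: path i` says that the path traverses the directed edge `x → y`. -/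
structure MCFlow (D : ZXDiagram V E) where
  order : PartialOrder V
  k : ℕ
  path : Fin k → List V
  path_ne_nil : ∀ i, path i ≠ []
  path_nodup : ∀ i, (path i).Nodup
  path_adj : ∀ i x y, [x, y] <:+: path i → D.Adj x y
  o1 : ∀ i x y, [x, y] <:+: path i → order.le x y
  o2 : ∀ i x y z, [x, y] <:+: path i → D.Adj y z → (∃ j, [z, y] <:+: path j) ∨ order.le x z
  p1 : ∀ v, D.type v = .boundary ∨ D.type v = .hadamard →
    ∃ i, v ∈ path i ∧ ∀ z, D.Adj v z → [v, z] <:+: path i ∨ [z, v] <:+: path i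
  p2 : ∀ v, D.IsSpider v → ∀ z z', D.Adj v z → D.Adj v z' →
    (∀ i, ¬ ([v, z] <:+: path i ∨ [z, v] <:+: path i)) →
    (∀ i, ¬ ([v, z'] <:+: path i ∨ [z', v] <:+: path i)) → z = z'
  p3 : ∀ i j x y, ([x, y] <:+: path i ∨ [y, x] <:+: path i) →
    ([x, y] <:+: path j ∨ [y, x] <:+: path j) → i = j

/-- No path starts or finishes at a spider of degree more than one. -/
def MCFlow.WellCovered [Fintype E] {D : ZXDiagram V E} (φ : D.MCFlow) : Prop :=
  ∀ i v, D.IsSpider v → ((φ.path i).head? = some v ∨ (φ.path i).getLast? = some v) → D.degree v ≤ 1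

/-- The boundary nodes at which the flow enters the diagram. -/
def MCFlow.IsInput {D : ZXDiagram V E} (φ : D.MCFlow) (b : D.Boundary) : Prop :=
  ∃ i y, [b.1, y] <:+: φ.path i

/-- The boundary nodes at which the flow leaves the diagram. -/
def MCFlow.IsOutput {D : ZXDiagram V E} (φ : D.MCFlow) (b : D.Boundary) : Prop :=
  ∃ i x, [x, b.1] <:+: φ.path i

/-! ## Circuits -/

/-- Equality of diagrams up to names of vertices and edges (only connectivity matters). -/
structure Iso (D : ZXDiagram V E) (D' : ZXDiagram V' E') where
  vert : V ≃ V'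
  edge : E ≃ E'
  ends_eq : ∀ e, s(D'.ends (edge e) false, D'.ends (edge e) true) =
    s(vert (D.ends e false), vert (D.ends e true))
  type_eq : ∀ v, D'.type (vert v) = D.type v
  phase_eq : ∀ v, D.IsSpider v → D'.phase (vert v) = D.phase v

/-- The empty diagram. -/
def emptyDiagram : ZXDiagram Empty Empty where
  ends := Empty.elim
  type := Empty.elim
  phase := Empty.elim

open Classical in
/-- Turn the vertex `v` into one of type `t` and phase `k`. -/
noncomputable def retype (D : ZXDiagram V E) (v : V) (t : NodeType) (k : ZMod 4) :
    ZXDiagram V E where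
  ends := D.ends
  type := Function.update D.type v t
  phase := Function.update D.phase v k

/-- Add a vertex `none` of type `t` and phase `k`. -/
def addNode (D : ZXDiagram V E) (t : NodeType) (k : ZMod 4) : ZXDiagram (Option V) E where
  ends := fun e s => some (D.ends e s)
  type := fun v => v.elim t D.type
  phase := fun v => v.elim k D.phase

/-- Add an edge between `v` and `w`. -/
def addEdge (D : ZXDiagram V E) (v w : V) : ZXDiagram V (Option E) where
  ends := fun e s => e.elim (if s then w else v) fun e => D.ends e s
  type := D.type
  phase := D.phase

/-- Add a vertex `none` of type `t` and phase `k`, and an edge from `v` to it. -/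
def addLeg (D : ZXDiagram V E) (v : V) (t : NodeType) (k : ZMod 4) :
    ZXDiagram (Option V) (Option E) :=
  (D.addNode t k).addEdge (some v) none

end ZXDiagram

open ZXDiagram in
/-- `IsCircuit D I O`: the diagram `D` is (the ZX diagram of) a circuit in low-weight Clifford
and measurement form with inputs `I` and outputs `O`. A circuit is built from the empty circuit
by adding qubits and applying gates to qubits; the current end of a qubit is an output
`o`, and applying a gate turns `o` into a node of the gate, with a new output behind it.
Measurement outcomes are the syndrome-free ones. -/
inductive IsCircuit : {V E : Type} → ZXDiagram V E → Set V → Set V → Prop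
  /-- The circuit on no qubits. -/
  | empty : IsCircuit emptyDiagram ∅ ∅
  /-- Names of vertices and edges are irrelevant. -/
  | relabel {V E V' E' : Type} {D : ZXDiagram V E} {D' : ZXDiagram V' E'} {I O : Set V}
      (f : Iso D D') : IsCircuit D I O → IsCircuit D' (f.vert '' I) (f.vert '' O)
  /-- An input qubit. -/
  | input {V E : Type} {D : ZXDiagram V E} {I O : Set V} : IsCircuit D I O →
      IsCircuit ((D.addNode .boundary 0).addLeg none .boundary 0)
        (insert (some none) ((fun v => some (some v)) '' I))
        (insert none ((fun v => some (some v)) '' O))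
  /-- Preparation of a qubit in `|0⟩` (`c = X`) or `|+⟩` (`c = Z`). -/
  | prep (c : Color) {V E : Type} {D : ZXDiagram V E} {I O : Set V} : IsCircuit D I O →
      IsCircuit ((D.addNode (.spider c) 0).addLeg none .boundary 0)
        ((fun v => some (some v)) '' I)
        (insert none ((fun v => some (some v)) '' O))
  /-- Destructive measurement `⟨0|` (`c = X`) or `⟨+|` (`c = Z`) of a qubit. -/
  | meas (c : Color) {V E : Type} {D : ZXDiagram V E} {I O : Set V} (o : V) (ho : o ∈ O) :
      IsCircuit D I O → IsCircuit (D.retype o (.spider c) 0) I (O \ {o})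
  /-- The `Z`- or `X`-rotation by `k * π / 2`. Together with the Hadamard gate, these are
  single-qubit Clifford gates that generate all of them. -/
  | rotation (c : Color) (k : ZMod 4) {V E : Type} {D : ZXDiagram V E} {I O : Set V}
      (o : V) (ho : o ∈ O) : IsCircuit D I O →
      IsCircuit ((D.retype o (.spider c) k).addLeg o .boundary 0)
        (some '' I) (insert none (some '' (O \ {o})))
  /-- The Hadamard gate. -/
  | hadamard {V E : Type} {D : ZXDiagram V E} {I O : Set V} (o : V) (ho : o ∈ O) :
      IsCircuit D I O →
      IsCircuit ((D.retype o .hadamard 0).addLeg o .boundary 0)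
        (some '' I) (insert none (some '' (O \ {o})))
  /-- The CNOT gate with control `o` and target `p`. -/
  | cnot {V E : Type} {D : ZXDiagram V E} {I O : Set V} (o p : V) (ho : o ∈ O) (hp : p ∈ O)
      (hne : o ≠ p) : IsCircuit D I O →
      IsCircuit
        (((((D.retype o (.spider .Z) 0).retype p (.spider .X) 0).addEdge o p).addLeg
          o .boundary 0).addLeg (some p) .boundary 0)
        ((fun v => some (some v)) '' I)
        ({none, some none} ∪ (fun v => some (some v)) '' (O \ {o, p}))
  /-- The Pauli measurement `Z` (`c = Z`) or `X` (`c = X`) of one qubit. -/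
  | measPauli₁ (c : Color) {V E : Type} {D : ZXDiagram V E} {I O : Set V} (o : V) (ho : o ∈ O) :
      IsCircuit D I O →
      IsCircuit
        (((D.retype o (.spider c) 0).addLeg o (.spider c.opp) 0).addLeg (some o) .boundary 0)
        ((fun v => some (some v)) '' I)
        (insert none ((fun v => some (some v)) '' (O \ {o})))
  /-- The Pauli measurement `ZZ` (`c = Z`) or `XX` (`c = X`) of two qubits. -/
  | measPauli₂ (c : Color) {V E : Type} {D : ZXDiagram V E} {I O : Set V} (o p : V)
      (ho : o ∈ O) (hp : p ∈ O) (hne : o ≠ p) : IsCircuit D I O →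
      IsCircuit
        (((((D.retype o (.spider c) 0).retype p (.spider c) 0).addEdge o p).addLeg
          o .boundary 0).addLeg (some p) .boundary 0)
        ((fun v => some (some v)) '' I)
        ({none, some none} ∪ (fun v => some (some v)) '' (O \ {o, p}))

set_option linter.unusedSectionVars false

/-! # Network sums -/

namespace ZXDiagram

open scoped Classical

/-- A Pauli flip: the `Z` component and the `X` component. -/
abbrev Pauli : Type := Bool × Bool

/-- The matrix of an edge that carries the flip `n`. -/
def edgeMat (n : Pauli) (a a' : Bool) : ℂ :=
  (if n.1 = true ∧ a = true then -1 else 1) * (if (a ≠ a') ↔ n.2 = true then 1 else 0)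

/-- The tensor of a `Z`- or `X`-spider as a function of the multiset of labels of its legs. -/
noncomputable def spiderVal (c : Color) (k : ZMod 4) (m : Multiset Bool) : ℂ :=
  match c with
  | .Z => (m.map fun a => if a then 0 else 1).prod +
      Complex.I ^ k.val * (m.map fun a => if a then 1 else 0).prod
  | .X => (m.map fun _ => ((1 / Real.sqrt 2 : ℝ) : ℂ)).prod +
      Complex.I ^ k.val * (m.map fun a =>
        if a then -((1 / Real.sqrt 2 : ℝ) : ℂ) else ((1 / Real.sqrt 2 : ℝ) : ℂ)).prod

/-- The tensor of a vertex as a function of the multiset of labels of its legs; a boundary vertex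
carries the outer label `β`. -/
noncomputable def nodeVal (t : NodeType) (k : ZMod 4) (β : Bool) (m : Multiset Bool) : ℂ :=
  match t with
  | .spider c => spiderVal c k m
  | .hadamard => ((1 / Real.sqrt 2 : ℝ) : ℂ) * if ∀ a ∈ m, a = true then -1 else 1
  | .boundary => (m.map fun a => if a = β then 1 else 0).prod

section net

variable {V E : Type}

/-- The multiset of labels at the legs of `v`. -/
noncomputable def labels [Fintype E] (ends : E → Bool → V) (x : E → Bool → Bool) (v : V) :
    Multiset Bool :=
  ∑ e, ∑ s, if ends e s = v then {x e s} else 0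

/-- The contraction of the network with vertex tensors `T` and flips `ε` on the edges. -/
noncomputable def net [Fintype V] [Fintype E] (ends : E → Bool → V)
    (T : V → Multiset Bool → ℂ) (ε : E → Pauli) : ℂ :=
  ∑ x : E → Bool → Bool, (∏ v, T v (labels ends x v)) * ∏ e, edgeMat (ε e) (x e false) (x e true)

theorem sum_legs_eq_labels [Fintype E] (D : ZXDiagram V E) (x : E → Bool → Bool) (v : V) :
    (D.legs v).val.map (fun h => x h.1 h.2) = labels D.ends x v := by
  rw [labels, ← Fintype.sum_prod_type' (f := fun e s => if D.ends e s = v then {x e s} else 0),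
    ← Finset.sum_filter]
  rw [← Multiset.sum_map_singleton (Multiset.map _ _), Multiset.map_map]
  rfl

theorem card_labels [Fintype E] (D : ZXDiagram V E) (x : E → Bool → Bool) (v : V) :
    (labels D.ends x v).card = D.degree v := by
  rw [← sum_legs_eq_labels, Multiset.card_map]; rfl

theorem nodeTensor_eq [Fintype E] (D : ZXDiagram V E) (b : D.Boundary → Bool) (β : V → Bool)
    (hb : ∀ v, b v = β v.1) (x : E → Bool → Bool) (v : V) :
    D.nodeTensor b (fun h => x h.1 h.2) v =
      nodeVal (D.type v) (D.phase v) (β v) (labels D.ends x v) := by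
  rw [← sum_legs_eq_labels]
  unfold nodeTensor nodeVal
  simp only [hb, exists_prop]
  rcases D.type v with c | _ | _
  · cases c <;> simp [spiderVal, Multiset.map_map]
  · simp [Multiset.mem_map]
  · simp only [Multiset.map_map]
    refine Finset.prod_congr rfl fun l _ => ?_
    simp

/-- The flips of an error, edge by edge. -/
noncomputable def Error.flips {D : ZXDiagram V E} (err : D.Error) (e : E) : Pauli :=
  (decide ((e, Color.Z) ∈ err), decide ((e, Color.X) ∈ err))

/-- The number of edges with a flip. -/
noncomputable def wt [Fintype E] (ε : E → Pauli) : ℕ := (Finset.univ.filter fun e => ε e ≠ (false, false)).card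

theorem Error.weight_eq [Fintype E] {D : ZXDiagram V E} (err : D.Error) : err.weight = wt err.flips := by
  unfold Error.weight wt
  congr 1
  ext e
  simp only [Finset.mem_image, Prod.exists, exists_and_right, exists_eq_right, Error.flips,
    Finset.mem_filter, Finset.mem_univ, true_and, ne_eq, Prod.mk.injEq, decide_eq_false_iff_not,
    not_and_or, not_not]
  constructor
  · rintro ⟨c, hc⟩
    cases c <;> simp [hc]
  · rintro (h | h)
    exacts [⟨_, h⟩, ⟨_, h⟩]

/-- Sets of flips and functions from edges to `Pauli` carry the same information; the functions are
easier to extend and to update edge by edge. -/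
theorem exists_flips_eq [Fintype E] (D : ZXDiagram V E) (ε : E → Pauli) : ∃ err : D.Error, err.flips = ε := by
  refine ⟨(Finset.univ.filter fun e => (ε e).1 = true).image (fun e => (e, Color.Z)) ∪
    (Finset.univ.filter fun e => (ε e).2 = true).image (fun e => (e, Color.X)), ?_⟩
  funext e
  ext <;> simp [Error.flips]

/-- The outer labels are given on all vertices, although only boundary vertices read them; this
avoids carrying subtypes through the gate constructions. -/
theorem interpErr_eq [Fintype V] [Fintype E] (D : ZXDiagram V E) (err : D.Error) (b : D.Boundary → Bool) (β : V → Bool)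
    (hb : ∀ v, b v = β v.1) :
    D.interpErr err b =
      net D.ends (fun v => nodeVal (D.type v) (D.phase v) (β v)) err.flips := by
  unfold interpErr net
  rw [← (Equiv.curry E Bool Bool).symm.sum_comp]
  refine Finset.sum_congr rfl fun x _ => ?_
  congr 1
  · exact Finset.prod_congr rfl fun v _ => nodeTensor_eq D b β hb x v
  · refine Finset.prod_congr rfl fun e _ => ?_
    unfold edgeTensor edgeMat Error.flips
    simp only [Equiv.curry_symm_apply, Function.uncurry, decide_eq_true_eq]

theorem labels_congr [Fintype E] {ends : E → Bool → V} {x y : E → Bool → Bool} {v : V}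
    (h : ∀ e s, ends e s = v → x e s = y e s) : labels ends x v = labels ends y v := by
  refine Finset.sum_congr rfl fun e _ => Finset.sum_congr rfl fun s _ => ?_
  split_ifs with hs
  · rw [h e s hs]
  · rfl

theorem net_congr [Fintype V] [Fintype E] {ends : E → Bool → V} {T T' : V → Multiset Bool → ℂ} {ε : E → Pauli}
    (h : ∀ v x, T v (labels ends x v) = T' v (labels ends x v)) : net ends T ε = net ends T' ε := by
  refine Finset.sum_congr rfl fun x _ => ?_
  congr 1
  exact Finset.prod_congr rfl fun v _ => h v x

/-! ### Adding vertices and edges -/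

theorem net_addNode [Fintype V] [Fintype E] (ends : E → Bool → V) (T : Option V → Multiset Bool → ℂ) (ε : E → Pauli) :
    net (fun e s => some (ends e s)) T ε = T none 0 * net ends (fun v => T (some v)) ε := by
  unfold net
  rw [Finset.mul_sum]
  refine Finset.sum_congr rfl fun x _ => ?_
  rw [Fintype.prod_option]
  simp [labels, mul_assoc]

theorem sum_option_arrow [Fintype E] {inst : Fintype (Option E → Bool → Bool)}
    (f : (Option E → Bool → Bool) → ℂ) :
    ∑ x, f x = ∑ p, ∑ q, ∑ x : E → Bool → Bool,
      f fun e s => e.elim (if s then q else p) fun e => x e s := by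
  obtain rfl := Subsingleton.elim inst Pi.instFintype
  rw [← (Equiv.piOptionEquivProd (β := fun _ : Option E => Bool → Bool)).symm.sum_comp,
    Fintype.sum_prod_type, ← (Equiv.boolArrowEquivProd Bool).symm.sum_comp, Fintype.sum_prod_type]
  refine Finset.sum_congr rfl fun p _ => Finset.sum_congr rfl fun q _ =>
    Finset.sum_congr rfl fun x _ => congrArg f ?_
  funext e s
  cases e <;> cases s <;> rfl

/-- The ends of the edges after adding an edge from `v` to `w`. -/
def addEnds (ends : E → Bool → V) (v w : V) : Option E → Bool → V :=
  fun e s => e.elim (if s then w else v) fun e => ends e s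

theorem labels_addEnds [DecidableEq V] [Fintype E] (ends : E → Bool → V) (v w : V) (p q : Bool)
    (x : E → Bool → Bool) (u : V) :
    labels (addEnds ends v w) (fun e s => e.elim (if s then q else p) fun e => x e s) u =
      (if u = v then {p} else 0) + (if u = w then {q} else 0) + labels ends x u := by
  unfold labels
  rw [Fintype.sum_option]
  refine congrArg₂ _ ?_ rfl
  rw [Fintype.sum_bool, add_comm]
  refine congrArg₂ _ ?_ ?_
  · by_cases h : u = v <;> simp [addEnds, h]
    exact fun h' => absurd h'.symm h
  · by_cases h : u = w <;> simp [addEnds, h]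
    exact fun h' => absurd h'.symm h

/-- The new edge is contracted last: with its end labels `p` and `q` fixed, its end vertices merely
see one more label each. A loop is covered as well. -/
theorem net_addEnds [DecidableEq V] [Fintype V] [Fintype E] (ends : E → Bool → V) (v w : V) (T : V → Multiset Bool → ℂ)
    (ε : Option E → Pauli) :
    net (addEnds ends v w) T ε = ∑ p, ∑ q, edgeMat (ε none) p q *
      net ends (fun u m => T u ((if u = v then {p} else 0) + (if u = w then {q} else 0) + m))
        (fun e => ε (some e)) := by
  unfold net
  rw [sum_option_arrow]
  refine Finset.sum_congr rfl fun p _ => Finset.sum_congr rfl fun q _ => ?_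
  rw [Finset.mul_sum]
  refine Finset.sum_congr rfl fun x _ => ?_
  rw [Fintype.prod_option, mul_left_comm]
  congr 2
  refine Finset.prod_congr rfl fun u _ => ?_
  congr 1
  exact labels_addEnds ends v w p q x u

/-- Adding a leaf `none` at `v`. -/
theorem net_addLeg [DecidableEq V] [Fintype V] [Fintype E] (ends : E → Bool → V) (v : V) (T : Option V → Multiset Bool → ℂ)
    (ε : Option E → Pauli) :
    net (addEnds (fun e s => some (ends e s)) (some v) none) T ε =
      ∑ p, ∑ q, edgeMat (ε none) p q * T none {q} *
        net ends (fun u m => T (some u) ((if u = v then {p} else 0) + m))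
        (fun e => ε (some e)) := by
  rw [net_addEnds]
  refine Finset.sum_congr rfl fun p _ => Finset.sum_congr rfl fun q _ => ?_
  rw [net_addNode, ← mul_assoc]
  simp

/-! ### Leaves -/

/-- The tensor of a leaf with a fixed label. -/
noncomputable def deltaVal (a : Bool) (m : Multiset Bool) : ℂ := nodeVal .boundary 0 a m

theorem deltaVal_singleton (a b : Bool) : deltaVal a {b} = if b = a then 1 else 0 := by
  simp [deltaVal, nodeVal]

/-- The contraction is linear in the tensor of each single vertex. The decomposition is required
only for the label multisets that occur, so that the degree of the vertex can be used. -/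
theorem net_update_sum [Fintype V] [Fintype E] {ι : Type} [Fintype ι] (ends : E → Bool → V) (T : V → Multiset Bool → ℂ)
    (ε : E → Pauli) (o : V) (f : ι → ℂ) (t : ι → Multiset Bool → ℂ)
    (h : ∀ x, T o (labels ends x o) = ∑ i, f i * t i (labels ends x o)) :
    net ends T ε = ∑ i, f i * net ends (Function.update T o (t i)) ε := by
  unfold net
  simp_rw [Finset.mul_sum]
  rw [Finset.sum_comm]
  refine Finset.sum_congr rfl fun x _ => ?_
  rw [← Finset.mul_prod_erase _ _ (Finset.mem_univ o), h, Finset.sum_mul, Finset.sum_mul]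
  refine Finset.sum_congr rfl fun i _ => ?_
  rw [← Finset.mul_prod_erase Finset.univ (fun v => Function.update T o (t i) v (labels ends x v))
    (Finset.mem_univ o), Function.update_self]
  have : ∏ v ∈ Finset.univ.erase o, Function.update T o (t i) v (labels ends x v) =
      ∏ v ∈ Finset.univ.erase o, T v (labels ends x v) :=
    Finset.prod_congr rfl fun v hv => by rw [Function.update_of_ne (Finset.ne_of_mem_erase hv)]
  rw [this]
  ring

/-- A leaf sees one label, so its tensor is a combination of two delta tensors: the leaf can be cut
off and its label summed over outside. -/
theorem net_leaf [Fintype V] [Fintype E] (D : ZXDiagram V E) (T : V → Multiset Bool → ℂ) (ε : E → Pauli) (o : V)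
    (ho : D.degree o = 1) :
    net D.ends T ε = ∑ γ, T o {γ} * net D.ends (Function.update T o (deltaVal γ)) ε := by
  refine net_update_sum _ _ _ o _ _ fun x => ?_
  obtain ⟨a, ha⟩ := Multiset.card_eq_one.1 ((card_labels D x o).trans ho)
  rw [ha]
  simp [deltaVal_singleton]

end net


/-! # Labelled diagrams and gates -/

section labelled

variable {V E L : Type}

/-- The interpretation of `D` with flips `ε`, when the boundary vertex `v` is called `ℓ v`. -/
noncomputable def interpL [Fintype V] [Fintype E] (D : ZXDiagram V E) (ℓ : V → L) (ε : E → Pauli)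
    (β : L → Bool) : ℂ :=
  net D.ends (fun v => nodeVal (D.type v) (D.phase v) (β (ℓ v))) ε

/-- Boundary vertices are leaves, and `ℓ` distinguishes them. -/
structure Lbl [Fintype E] (D : ZXDiagram V E) (ℓ : V → L) : Prop where
  degree : ∀ v, D.type v = .boundary → D.degree v = 1
  inj : ∀ v w, D.type v = .boundary → D.type w = .boundary → ℓ v = ℓ w → v = w

theorem nodeVal_congr {t : NodeType} {k : ZMod 4} {a b : Bool} (h : t = .boundary → a = b) :
    nodeVal t k a = nodeVal t k b := by
  cases t with
  | boundary => rw [h rfl]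
  | _ => rfl

theorem interpL_congr [Fintype V] [Fintype E] {D : ZXDiagram V E} {ℓ ℓ' : V → L} {ε : E → Pauli}
    {β β' : L → Bool} (h : ∀ v, D.type v = .boundary → β (ℓ v) = β' (ℓ' v)) :
    interpL D ℓ ε β = interpL D ℓ' ε β' :=
  net_congr fun v _ => by rw [nodeVal_congr (h v)]

theorem nodeVal_boundary (k : ZMod 4) (a b : Bool) :
    nodeVal .boundary k a {b} = if b = a then 1 else 0 := by
  simp [nodeVal]

theorem Lbl.nodeVal_update [Fintype E] {D : ZXDiagram V E} {ℓ : V → L} (hD : Lbl D ℓ) {o : V}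
    (ho : D.type o = .boundary) {u : V} (hu : u ≠ o) (β : L → Bool) (γ : Bool) :
    nodeVal (D.type u) (D.phase u) (Function.update β (ℓ o) γ (ℓ u)) =
      nodeVal (D.type u) (D.phase u) (β (ℓ u)) := by
  refine nodeVal_congr fun h => ?_
  rw [Function.update_of_ne]
  exact fun h' => hu (hD.inj _ _ h ho h')

/-- This is how a gate sees what lies before it: only the output `o` has a new tensor, and cutting
there leaves interpretations of the old diagram. -/
theorem Lbl.net_eq [Fintype V] [Fintype E] {D : ZXDiagram V E} {ℓ : V → L} (hD : Lbl D ℓ) {o : V}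
    (ho : D.type o = .boundary) (T : V → Multiset Bool → ℂ) (ε : E → Pauli) (β : L → Bool)
    (hT : ∀ u, u ≠ o → T u = nodeVal (D.type u) (D.phase u) (β (ℓ u))) :
    net D.ends T ε = ∑ γ, T o {γ} * interpL D ℓ ε (Function.update β (ℓ o) γ) := by
  rw [net_leaf D T ε o (hD.degree o ho)]
  refine Finset.sum_congr rfl fun γ _ => congrArg _ (net_congr fun u x => ?_)
  by_cases hu : u = o
  · subst hu
    rw [Function.update_self, Function.update_self, ho]; rfl
  · rw [Function.update_of_ne hu, hT u hu, hD.nodeVal_update ho hu]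

theorem Lbl.net_eq₂ [Fintype V] [Fintype E] {D : ZXDiagram V E} {ℓ : V → L} (hD : Lbl D ℓ)
    {o p : V} (ho : D.type o = .boundary) (hp : D.type p = .boundary) (hop : o ≠ p)
    (T : V → Multiset Bool → ℂ) (ε : E → Pauli) (β : L → Bool)
    (hT : ∀ u, u ≠ o → u ≠ p → T u = nodeVal (D.type u) (D.phase u) (β (ℓ u))) :
    net D.ends T ε = ∑ γ, ∑ δ, T o {γ} * T p {δ} *
      interpL D ℓ ε (Function.update (Function.update β (ℓ o) γ) (ℓ p) δ) := by
  rw [net_leaf D T ε o (hD.degree o ho)]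
  refine Finset.sum_congr rfl fun γ _ => ?_
  rw [hD.net_eq hp _ ε (Function.update β (ℓ o) γ), Finset.mul_sum]
  · refine Finset.sum_congr rfl fun δ _ => ?_
    rw [Function.update_of_ne hop.symm, mul_assoc]
  · intro u hu
    by_cases huo : u = o
    · subst huo
      rw [Function.update_self, Function.update_self, ho]; rfl
    · rw [Function.update_of_ne huo, hT u huo hu, hD.nodeVal_update ho huo]

/-! ### Gates with arbitrary phases -/

/-- A vertex on one qubit. -/
noncomputable abbrev gateOne (D : ZXDiagram V E) (o : V) (t : NodeType) (k : ZMod 4) :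
    ZXDiagram (Option V) (Option E) :=
  (D.retype o t k).addLeg o .boundary 0

/-- Joined spiders on two qubits. -/
noncomputable abbrev gateTwo (D : ZXDiagram V E) (o p : V) (c : Color) (k : ZMod 4) (c' : Color)
    (k' : ZMod 4) : ZXDiagram (Option (Option V)) (Option (Option (Option E))) :=
  ((((D.retype o (.spider c) k).retype p (.spider c') k').addEdge o p).addLeg
    o .boundary 0).addLeg (some p) .boundary 0

/-- A spider on one qubit, joined to a one-legged spider. -/
noncomputable abbrev gateLeaf (D : ZXDiagram V E) (o : V) (c : Color) (k : ZMod 4) (c' : Color)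
    (k' : ZMod 4) : ZXDiagram (Option (Option V)) (Option (Option E)) :=
  ((D.retype o (.spider c) k).addLeg o (.spider c') k').addLeg (some o) .boundary 0

/-- A new vertex, joined to a new boundary vertex. -/
abbrev gateWire (D : ZXDiagram V E) (t : NodeType) (k : ZMod 4) :
    ZXDiagram (Option (Option V)) (Option E) :=
  (D.addNode t k).addLeg none .boundary 0

/-- The tensor of a vertex with a flip on an outgoing leg with label `b`. -/
noncomputable def outVal (t : NodeType) (k : ZMod 4) (β : Bool) (m : Multiset Bool) (n : Pauli)
    (b : Bool) : ℂ :=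
  ∑ a, nodeVal t k β (a ::ₘ m) * edgeMat n a b

/-- The boundary vertex forces the label at the far end of its edge, so only the near label is
summed. -/
theorem sum_edge_boundary (n : Pauli) (b : Bool) (f : Bool → ℂ) :
    ∑ p, ∑ q, edgeMat n p q * nodeVal .boundary 0 b {q} * f p = ∑ p, f p * edgeMat n p b := by
  simp only [nodeVal_boundary]
  cases b <;> simp [mul_comm]

/-- Brings the sum over the label `γ` at the cut to the outside, where the gate appears as a matrix
acting on the old tensor. `sum_two_comm` does the same for two qubits. -/
theorem sum_leaf_comm (A : Bool → Bool → ℂ) (S : Bool → ℂ) (s : Bool → Bool → Bool → ℂ)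
    (B F : Bool → ℂ) :
    ∑ a, (∑ p, ∑ q, A p q * S q * ∑ γ, s a p γ * F γ) * B a =
      ∑ γ, (∑ p, ∑ q, A p q * S q * ∑ a, s a p γ * B a) * F γ := by
  simp only [Fintype.sum_bool]
  ring

theorem sum_two_comm (A : Bool → Bool → ℂ) (s s' : Bool → Bool → Bool → ℂ) (B B' : Bool → ℂ)
    (F : Bool → Bool → ℂ) :
    ∑ b', (∑ b, (∑ a, ∑ a', A a a' * ∑ γ, ∑ δ, s b a γ * s' b' a' δ * F γ δ) * B b) * B' b' =
      ∑ γ, ∑ δ, (∑ a, ∑ a', A a a' * (∑ b, s b a γ * B b) * ∑ b', s' b' a' δ * B' b') *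
        F γ δ := by
  simp only [Fintype.sum_bool]
  ring

variable [Fintype V] [Fintype E]

theorem Lbl.interpL_meas {D : ZXDiagram V E} {ℓ : V → L} (hD : Lbl D ℓ) {o : V}
    (ho : D.type o = .boundary) (c : Color) (k : ZMod 4) (ε : E → Pauli) (β : L → Bool) :
    interpL (D.retype o (.spider c) k) ℓ ε β =
      ∑ γ, spiderVal c k {γ} * interpL D ℓ ε (Function.update β (ℓ o) γ) := by
  unfold interpL
  rw [show (D.retype o (.spider c) k).ends = D.ends from rfl, hD.net_eq ho _ ε β]
  · simp [retype, nodeVal, interpL]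
  · intro u hu
    simp [retype, hu]

/-- The former output `o` keeps its label, which the new output also receives. There is no clash,
because labels are read only at boundary vertices. -/
theorem Lbl.interpL_one {D : ZXDiagram V E} {ℓ : V → L} (hD : Lbl D ℓ) {o : V}
    (ho : D.type o = .boundary) {t : NodeType} (ht : t ≠ .boundary) (k : ZMod 4)
    (ε : Option E → Pauli) (β : L → Bool) :
    interpL (D.gateOne o t k) (fun v => v.elim (ℓ o) ℓ) ε β =
      ∑ γ, outVal t k false {γ} (ε none) (β (ℓ o)) *
        interpL D ℓ (fun e => ε (some e)) (Function.update β (ℓ o) γ) := by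
  have key : ∀ p : Bool, net D.ends (fun u m => nodeVal ((D.gateOne o t k).type (some u))
      ((D.gateOne o t k).phase (some u)) (β (ℓ u)) ((if u = o then {p} else 0) + m))
      (fun e => ε (some e)) = ∑ γ, nodeVal t k false {p, γ} *
        interpL D ℓ (fun e => ε (some e)) (Function.update β (ℓ o) γ) := by
    intro p
    rw [hD.net_eq ho _ _ β]
    · refine Finset.sum_congr rfl fun γ _ => ?_
      congr 1
      simp only [addLeg, addEdge, addNode, retype, Option.elim_some, Function.update_self, if_true]
      -- A vertex that is no boundary vertex ignores the outer label, so this may be taken to be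
      -- `false`.
      rw [nodeVal_congr fun h => absurd h ht]; rfl
    · intro u hu
      funext m
      simp [addLeg, addEdge, addNode, retype, hu]
  refine (net_addLeg D.ends o _ ε).trans ?_
  refine (sum_edge_boundary (ε none) (β (ℓ o)) _).trans ?_
  simp only [outVal, Option.elim_some]
  simp_rw [key, Finset.sum_mul]
  rw [Finset.sum_comm]
  exact Finset.sum_congr rfl fun _ _ => Finset.sum_congr rfl fun _ _ => mul_right_comm _ _ _

theorem interpL_wire (D : ZXDiagram V E) (ℓ : V → L) (l₀ l₁ : L) (t : NodeType) (k : ZMod 4)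
    (ε : Option E → Pauli) (β : L → Bool) :
    interpL (D.gateWire t k) (fun v => v.elim l₀ fun v => v.elim l₁ ℓ) ε β =
      outVal t k (β l₁) 0 (ε none) (β l₀) * interpL D ℓ (fun e => ε (some e)) β := by
  refine (net_addLeg (fun e s => some (D.ends e s)) none _ ε).trans ?_
  refine (sum_edge_boundary (ε none) (β l₀) _).trans ?_
  simp_rw [net_addNode]
  simp only [outVal, Finset.sum_mul]
  refine Finset.sum_congr rfl fun p _ => ?_
  rw [mul_right_comm]
  congr 1
  refine net_congr fun v x => ?_
  simp [addLeg, addEdge, addNode]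

theorem interpL_addNode (D : ZXDiagram V E) (ℓ : V → L) (l₁ : L) (t : NodeType) (k : ZMod 4)
    (ε : E → Pauli) (β : L → Bool) :
    interpL (D.addNode t k) (fun v => v.elim l₁ ℓ) ε β =
      nodeVal t k (β l₁) 0 * interpL D ℓ ε β :=
  net_addNode D.ends _ ε

theorem Lbl.interpL_leaf {D : ZXDiagram V E} {ℓ : V → L} (hD : Lbl D ℓ) {o : V}
    (ho : D.type o = .boundary) (c : Color) (k : ZMod 4) (c' : Color) (k' : ZMod 4)
    (ε : Option (Option E) → Pauli) (β : L → Bool) :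
    interpL (D.gateLeaf o c k c' k') (fun v => v.elim (ℓ o) fun v => v.elim (ℓ o) ℓ) ε β =
      ∑ γ, (∑ p, ∑ q, edgeMat (ε (some none)) p q * spiderVal c' k' {q} *
          outVal (.spider c) k false {p, γ} (ε none) (β (ℓ o))) *
        interpL D ℓ (fun e => ε (some (some e))) (Function.update β (ℓ o) γ) := by
  have key : ∀ p p' : Bool, net D.ends (fun u m =>
      nodeVal ((D.gateLeaf o c k c' k').type (some (some u)))
      ((D.gateLeaf o c k c' k').phase (some (some u))) (β (ℓ u))
      ((if some u = some o then {p'} else 0) + ((if u = o then {p} else 0) + m)))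
      (fun e => ε (some (some e))) = ∑ γ, spiderVal c k {p', p, γ} *
        interpL D ℓ (fun e => ε (some (some e))) (Function.update β (ℓ o) γ) := by
    intro p p'
    rw [hD.net_eq ho _ _ β]
    · refine Finset.sum_congr rfl fun γ _ => ?_
      congr 1
      simp only [addLeg, addEdge, addNode, retype, Option.elim_some, Function.update_self, if_true]
      rfl
    · intro u hu
      funext m
      simp [addLeg, addEdge, addNode, retype, hu]
  refine (net_addLeg (D.gateOne o (.spider c) k).ends (some o) _ ε).trans ?_
  refine (sum_edge_boundary (ε none) (β (ℓ o)) _).trans ?_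
  have key' : ∀ p', net (D.gateOne o (.spider c) k).ends (fun u m =>
      nodeVal ((D.gateLeaf o c k c' k').type (some u))
      ((D.gateLeaf o c k c' k').phase (some u)) (β ((some u).elim (ℓ o) fun v => v.elim (ℓ o) ℓ))
      ((if u = some o then {p'} else 0) + m)) (fun e => ε (some e)) =
      ∑ p, ∑ q, edgeMat (ε (some none)) p q * spiderVal c' k' {q} *
      ∑ γ, spiderVal c k {p', p, γ} *
        interpL D ℓ (fun e => ε (some (some e))) (Function.update β (ℓ o) γ) := by
    intro p'
    refine (net_addLeg D.ends o _ _).trans ?_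
    refine Finset.sum_congr rfl fun p _ => Finset.sum_congr rfl fun q _ => ?_
    rw [← key]
    rfl
  refine (Finset.sum_congr rfl fun p' _ =>
    congrArg (fun z => z * edgeMat (ε none) p' (β (ℓ o))) (key' p')).trans ?_
  exact sum_leaf_comm (edgeMat (ε (some none))) (fun q => spiderVal c' k' {q})
    (fun a p γ => spiderVal c k {a, p, γ}) (fun a => edgeMat (ε none) a (β (ℓ o)))
    fun γ => interpL D ℓ (fun e => ε (some (some e))) (Function.update β (ℓ o) γ)

theorem Lbl.interpL_two {D : ZXDiagram V E} {ℓ : V → L} (hD : Lbl D ℓ) {o p : V}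
    (ho : D.type o = .boundary) (hp : D.type p = .boundary) (hop : o ≠ p)
    (c : Color) (k : ZMod 4) (c' : Color) (k' : ZMod 4)
    (ε : Option (Option (Option E)) → Pauli) (β : L → Bool) :
    interpL (D.gateTwo o p c k c' k') (fun v => v.elim (ℓ p) fun v => v.elim (ℓ o) ℓ) ε β =
      ∑ γ, ∑ δ, (∑ a, ∑ a', edgeMat (ε (some (some none))) a a' *
          outVal (.spider c) k false {a, γ} (ε (some none)) (β (ℓ o)) *
          outVal (.spider c') k' false {a', δ} (ε none) (β (ℓ p))) *
        interpL D ℓ (fun e => ε (some (some (some e))))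
          (Function.update (Function.update β (ℓ o) γ) (ℓ p) δ) := by
  set G := D.gateTwo o p c k c' k' with hG
  have key : ∀ a a' b b' : Bool, net D.ends (fun u m =>
      nodeVal (G.type (some (some u))) (G.phase (some (some u))) (β (ℓ u))
      ((if some u = some p then {b'} else 0) + ((if u = o then {b} else 0) +
        ((if u = o then {a} else 0) + (if u = p then {a'} else 0) + m))))
      (fun e => ε (some (some (some e)))) = ∑ γ, ∑ δ, spiderVal c k {b, a, γ} *
        spiderVal c' k' {b', a', δ} * interpL D ℓ (fun e => ε (some (some (some e))))
          (Function.update (Function.update β (ℓ o) γ) (ℓ p) δ) := by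
    intro a a' b b'
    rw [hD.net_eq₂ ho hp hop _ _ β]
    · refine Finset.sum_congr rfl fun γ _ => Finset.sum_congr rfl fun δ _ => ?_
      congr 1
      simp [hG, addLeg, addEdge, addNode, retype, hop, hop.symm, nodeVal]
      rw [Multiset.cons_swap a b, Multiset.cons_swap a' b']
    · intro u hu hu'
      funext m
      simp [hG, addLeg, addEdge, addNode, retype, hu, hu']
  refine (net_addLeg (((((D.retype o (.spider c) k).retype p (.spider c') k').addEdge o p).addLeg
    o .boundary 0).ends) (some p) _ ε).trans ?_
  refine (sum_edge_boundary (ε none) (β (ℓ p)) _).trans ?_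
  have key' : ∀ b', net (((((D.retype o (.spider c) k).retype p (.spider c') k').addEdge o p).addLeg
      o .boundary 0).ends) (fun u m => nodeVal (G.type (some u)) (G.phase (some u))
        (β ((some u).elim (ℓ p) fun v => v.elim (ℓ o) ℓ))
      ((if u = some p then {b'} else 0) + m)) (fun e => ε (some e)) =
      ∑ b, (∑ a, ∑ a', edgeMat (ε (some (some none))) a a' * ∑ γ, ∑ δ, spiderVal c k {b, a, γ} *
        spiderVal c' k' {b', a', δ} * interpL D ℓ (fun e => ε (some (some (some e))))
          (Function.update (Function.update β (ℓ o) γ) (ℓ p) δ)) *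
            edgeMat (ε (some none)) b (β (ℓ o)) := by
    intro b'
    refine (net_addLeg (addEnds D.ends o p) o _ _).trans ?_
    refine Eq.trans ?_ (sum_edge_boundary (ε (some none)) (β (ℓ o)) _)
    refine Finset.sum_congr rfl fun b _ => Finset.sum_congr rfl fun q _ => ?_
    refine congrArg₂ _ rfl ((net_addEnds _ _ _ _ _).trans ?_)
    refine Finset.sum_congr rfl fun a _ => Finset.sum_congr rfl fun a' _ => ?_
    rw [← key]
    rfl
  refine (Finset.sum_congr rfl fun p' _ =>
    congrArg (fun z => z * edgeMat (ε none) p' (β (ℓ p))) (key' p')).trans ?_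
  exact sum_two_comm (edgeMat (ε (some (some none)))) (fun b a γ => spiderVal c k {b, a, γ})
    (fun b a γ => spiderVal c' k' {b, a, γ}) (fun b => edgeMat (ε (some none)) b (β (ℓ o)))
    (fun b => edgeMat (ε none) b (β (ℓ p))) fun γ δ =>
      interpL D ℓ (fun e => ε (some (some (some e))))
        (Function.update (Function.update β (ℓ o) γ) (ℓ p) δ)

end labelled


/-! # Spider identities -/

/-- The basis of the colour `c`: computational for `Z`, and `|+⟩`, `|-⟩` for `X`. -/
noncomputable def bas (c : Color) (i a : Bool) : ℂ :=
  match c with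
  | .Z => if a = i then 1 else 0
  | .X => if i && a then -((1 / Real.sqrt 2 : ℝ) : ℂ) else ((1 / Real.sqrt 2 : ℝ) : ℂ)

/-- The power of `i` with exponent in `ZMod 4`. -/
noncomputable def iexp (k : ZMod 4) : ℂ := Complex.I ^ k.val

/-- The sign `-1` for `true`. -/
def sgn (b : Bool) : ℂ := if b then -1 else 1

theorem sgn_ne_zero (b : Bool) : sgn b ≠ 0 := by cases b <;> simp [sgn]

theorem sgn_xor (a b : Bool) : sgn (xor a b) = sgn a * sgn b := by
  cases a <;> cases b <;> simp [sgn]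

theorem sgn_mul_self (a : Bool) : sgn a * sgn a = 1 := by cases a <;> simp [sgn]

theorem iexp_add (a b : ZMod 4) : iexp (a + b) = iexp a * iexp b := by
  rw [iexp, iexp, iexp, ← pow_add, ZMod.val_add]
  conv_rhs => rw [← Nat.div_add_mod (a.val + b.val) 4, pow_add, pow_mul, Complex.I_pow_four,
    one_pow, one_mul]

theorem iexp_zero : iexp 0 = 1 := by simp [iexp]

theorem iexp_ne_zero (k : ZMod 4) : iexp k ≠ 0 := pow_ne_zero _ Complex.I_ne_zero

/-- The parity of a phase. -/
def oddPhase (k : ZMod 4) : Bool := k.val % 2 = 1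

/-- Exchanging the branches of a spider of phase `k` gives phase `-k` up to a scalar; the
discrepancy `i^(2k)` is a sign, and hence again a flip. -/
theorem iexp_mul_self (k : ZMod 4) : iexp k * iexp k = sgn (oddPhase k) := by
  fin_cases k <;> simp [iexp, oddPhase, sgn, ZMod.val]

/-- This is the scalar of a spider without legs; phase π is the only one for which it vanishes. -/
theorem one_add_iexp_ne_zero {k : ZMod 4} (hk : k ≠ 2) : 1 + iexp k ≠ 0 := by
  have h : iexp k ≠ -1 := by
    intro h
    apply hk
    revert h
    fin_cases k <;> simp [iexp, ZMod.val, Complex.ext_iff]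
    all_goals first | rfl | norm_num [pow_succ]
  exact fun h' => h (by linear_combination h')

theorem rsqrt_mul_self : ((1 / Real.sqrt 2 : ℝ) : ℂ) * ((1 / Real.sqrt 2 : ℝ) : ℂ) = 1 / 2 := by
  rw [← Complex.ofReal_mul, div_mul_div_comm, Real.mul_self_sqrt (by norm_num)]
  norm_num

theorem sum_bas_mul_bas (c : Color) (i j : Bool) :
    ∑ a, bas c i a * bas c j a = if i = j then 1 else 0 := by
  have := rsqrt_mul_self
  cases c <;> cases i <;> cases j <;> simp [bas] at this ⊢ <;> rw [this] <;> norm_num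

/-- In the basis of its own colour every spider is a sum of two product branches, the second with a
phase. Computing in this basis treats both colours at once. -/
theorem spiderVal_eq (c : Color) (k : ZMod 4) (m : Multiset Bool) :
    spiderVal c k m = (m.map (bas c false)).prod + iexp k * (m.map (bas c true)).prod := by
  cases c
  · simp only [spiderVal, bas, iexp]
    congr! 5 with a _ a
    cases a <;> simp [bas]
  · simp only [spiderVal, bas, iexp]
    congr! 4

/-- The component of a flip in the colour `c`. -/
def Pauli.same (c : Color) (n : Pauli) : Bool :=
  match c with
  | .Z => n.1
  | .X => n.2

/-- The component of a flip in the colour opposite to `c`. -/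
def Pauli.opp (c : Color) (n : Pauli) : Bool :=
  match c with
  | .Z => n.2
  | .X => n.1

/-- The flip with given components in the colour `c` and the opposite colour. -/
def Pauli.mk (c : Color) (p f : Bool) : Pauli :=
  match c with
  | .Z => (p, f)
  | .X => (f, p)

@[simp] theorem Pauli.same_mk (c : Color) (p f : Bool) : (Pauli.mk c p f).same c = p := by
  cases c <;> rfl

@[simp] theorem Pauli.opp_mk (c : Color) (p f : Bool) : (Pauli.mk c p f).opp c = f := by
  cases c <;> rfl

/-- The global sign of a flip in the basis of the colour `c`. -/
def Pauli.glob (c : Color) (n : Pauli) : ℂ :=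
  match c with
  | .Z => 1
  | .X => sgn (n.1 && n.2)

theorem Pauli.glob_ne_zero (c : Color) (n : Pauli) : n.glob c ≠ 0 := by
  cases c
  · exact one_ne_zero
  · exact sgn_ne_zero _

/-- In the basis of colour `c` the component of that colour is diagonal and the other one exchanges
the basis vectors. As `edgeMat` fixes an order of the two factors, a `Y` flip gets a further sign
for `X`. -/
theorem sum_bas_mul_edgeMat (c : Color) (i : Bool) (n : Pauli) (b : Bool) :
    ∑ a, bas c i a * edgeMat n a b = n.glob c * (sgn (n.same c && i) * bas c (xor i (n.opp c)) b) := by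
  obtain ⟨z, x⟩ := n
  cases c <;> cases i <;> cases b <;> cases z <;> cases x <;>
    simp [bas, edgeMat, Pauli.glob, Pauli.same, Pauli.opp, sgn]

/-- Of the four matrices only that of a `Y` flip is antisymmetric; this sign is the cost of turning
an edge around. -/
theorem edgeMat_comm (n : Pauli) (a b : Bool) : edgeMat n a b = sgn (n.1 && n.2) * edgeMat n b a := by
  obtain ⟨z, x⟩ := n
  cases a <;> cases b <;> cases z <;> cases x <;> simp [edgeMat, sgn]

theorem outVal_spider (c : Color) (k : ZMod 4) (β : Bool) (m : Multiset Bool) (n : Pauli) (b : Bool) :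
    outVal (.spider c) k β m n b = n.glob c * ((m.map (bas c false)).prod * bas c (n.opp c) b +
      iexp k * sgn (n.same c) * ((m.map (bas c true)).prod * bas c (!n.opp c) b)) := by
  have h0 := sum_bas_mul_edgeMat c false n b
  have h1 := sum_bas_mul_edgeMat c true n b
  simp only [Bool.and_false, Bool.and_true, Bool.false_xor, Bool.true_xor] at h0 h1
  rw [show sgn false = 1 from rfl, one_mul] at h0
  simp only [outVal, nodeVal, spiderVal_eq, Multiset.map_cons, Multiset.prod_cons]
  calc _ = (m.map (bas c false)).prod * (∑ a, bas c false a * edgeMat n a b) +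
        iexp k * (m.map (bas c true)).prod * (∑ a, bas c true a * edgeMat n a b) := by
        simp only [Fintype.sum_bool]; ring
    _ = _ := by rw [h0, h1]; ring

/-- Two tensors with two branches each are contracted by orthonormality. The case `i ≠ j` is that of
an odd number of exchanging flips between them. -/
theorem sum_bas_pair (c : Color) (i j : Bool) (p₀ p₁ q₀ q₁ : ℂ) :
    ∑ a, (p₀ * bas c i a + p₁ * bas c (!i) a) * (q₀ * bas c j a + q₁ * bas c (!j) a) =
      if i = j then p₀ * q₀ + p₁ * q₁ else p₀ * q₁ + p₁ * q₀ := by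
  calc _ = p₀ * q₀ * (∑ a, bas c i a * bas c j a) + p₀ * q₁ * (∑ a, bas c i a * bas c (!j) a) +
        p₁ * q₀ * (∑ a, bas c (!i) a * bas c j a) + p₁ * q₁ * (∑ a, bas c (!i) a * bas c (!j) a) := by
        simp only [Fintype.sum_bool]; ring
    _ = _ := by
        simp only [sum_bas_mul_bas]
        cases i <;> cases j <;> simp

/-- A spider with two legs fuses with its neighbour. -/
theorem sum_outVal_outVal (c : Color) (k₀ k : ZMod 4) (n n' : Pauli) :
    ∃ r : Pauli, ((n = (false, false) ∧ n' = (false, false)) → r = (false, false)) ∧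
      ∃ s : ℂ, s ≠ 0 ∧ ∀ m b, ∑ a, outVal (.spider c) k₀ false m n a *
        outVal (.spider c) k false {a} n' b = s * outVal (.spider c) (k₀ + k) false m r b := by
  -- The flip `n` is pushed through the second spider. Its component of colour `c` commutes; the
  -- other one turns the phase `k` into `-k`, and for odd `k` this leaves an additional flip of
  -- colour `c` behind.
  refine ⟨Pauli.mk c (xor (xor (n.same c) (n'.same c)) (oddPhase k && n.opp c))
    (xor (n.opp c) (n'.opp c)), ?_, n.glob c * n'.glob c * (Pauli.mk c (xor (xor (n.same c)
    (n'.same c)) (oddPhase k && n.opp c)) (xor (n.opp c) (n'.opp c))).glob c *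
    (if n.opp c then iexp k * sgn (n'.same c) else 1), ?_, ?_⟩
  · rintro ⟨rfl, rfl⟩
    cases c <;> simp [Pauli.mk, Pauli.same, Pauli.opp]
  · refine mul_ne_zero (mul_ne_zero (mul_ne_zero (Pauli.glob_ne_zero _ _) (Pauli.glob_ne_zero _ _))
      (Pauli.glob_ne_zero _ _)) ?_
    split_ifs
    · exact mul_ne_zero (iexp_ne_zero _) (sgn_ne_zero _)
    · exact one_ne_zero
  · intro m b
    have hg : ∀ r : Pauli, r.glob c * r.glob c = 1 := by
      intro r; cases c
      · simp [Pauli.glob]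
      · exact sgn_mul_self _
    simp only [outVal_spider, Pauli.same_mk, Pauli.opp_mk, Multiset.map_singleton,
      Multiset.prod_singleton]
    generalize (Multiset.map (bas c false) m).prod = P₀
    generalize (Multiset.map (bas c true) m).prod = P₁
    have hg := hg (Pauli.mk c (xor (xor (n.same c) (n'.same c)) (oddPhase k && n.opp c))
      (xor (n.opp c) (n'.opp c)))
    generalize (Pauli.mk c (xor (xor (n.same c) (n'.same c)) (oddPhase k && n.opp c))
      (xor (n.opp c) (n'.opp c))).glob c = g at hg ⊢
    have key := sum_bas_pair c (n.opp c) false P₀ (iexp k₀ * sgn (n.same c) * P₁)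
      (bas c (n'.opp c) b) (iexp k * sgn (n'.same c) * bas c (!n'.opp c) b)
    have hk := iexp_mul_self k
    have h2 := sgn_mul_self (n'.same c)
    calc _ = n.glob c * n'.glob c * ∑ a, (P₀ * bas c (n.opp c) a + (iexp k₀ * sgn (n.same c) * P₁) *
          bas c (!n.opp c) a) * (bas c (n'.opp c) b * bas c false a +
          (iexp k * sgn (n'.same c) * bas c (!n'.opp c) b) * bas c (!false) a) := by
          rw [Finset.mul_sum]
          exact Finset.sum_congr rfl fun a _ => by simp only [Bool.not_false]; ring
      _ = _ := by
          rw [key]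
          cases h : n.opp c
          · simp only [Bool.and_false, Bool.xor_false, Bool.false_xor, if_true, Bool.false_eq_true,
              if_false, iexp_add, sgn_xor]
            linear_combination (-(n.glob c * n'.glob c * (P₀ * bas c (n'.opp c) b +
              iexp k₀ * iexp k * (sgn (n.same c) * sgn (n'.same c)) *
              (P₁ * bas c (!n'.opp c) b)))) * hg
          · simp only [Bool.and_true, Bool.true_xor, Bool.not_not, if_true, Bool.true_eq_false,
              if_false, iexp_add, sgn_xor, ← hk]
            have hk4 : iexp k * iexp k * (iexp k * iexp k) = 1 := by rw [hk, sgn_mul_self]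
            linear_combination (-(n.glob c * n'.glob c * (iexp k * sgn (n'.same c)) *
              (P₀ * bas c (!n'.opp c) b +
              iexp k₀ * iexp k * (sgn (n.same c) * sgn (n'.same c) * (iexp k * iexp k)) *
              (P₁ * bas c (n'.opp c) b)))) * hg
              - n.glob c * n'.glob c * iexp k₀ * sgn (n.same c) * P₁ * bas c (n'.opp c) b *
                (sgn (n'.same c) * sgn (n'.same c)) * hk4
              - n.glob c * n'.glob c * iexp k₀ * sgn (n.same c) * P₁ * bas c (n'.opp c) b * h2

/-- A flip on a one-legged spider changes at most the relative sign of the branches: the exchanging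
component replaces `k` by `-k`, which is the sign `i^(2k)` once more. -/
theorem sum_edgeMat_spiderVal (c : Color) (k : ZMod 4) (n : Pauli) :
    ∃ s : ℂ, s ≠ 0 ∧ ∀ p, ∑ q, edgeMat n p q * spiderVal c k {q} =
      s * (bas c false p + iexp k * sgn (xor (n.same c) (oddPhase k && n.opp c)) * bas c true p) := by
  have h : ∀ p, ∑ q, edgeMat n p q * spiderVal c k {q} =
      sgn (n.1 && n.2) * outVal (.spider c) k false 0 n p := by
    intro p
    rw [outVal, Finset.mul_sum]
    refine Finset.sum_congr rfl fun q _ => ?_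
    rw [edgeMat_comm n p q]
    simp only [nodeVal, Multiset.cons_zero]
    ring
  have hk := iexp_mul_self k
  refine ⟨sgn (n.1 && n.2) * n.glob c * (if n.opp c then iexp k * sgn (n.same c) else 1), ?_, ?_⟩
  · refine mul_ne_zero (mul_ne_zero (sgn_ne_zero _) (Pauli.glob_ne_zero _ _)) ?_
    split_ifs
    · exact mul_ne_zero (iexp_ne_zero _) (sgn_ne_zero _)
    · exact one_ne_zero
  · intro p
    rw [h, outVal_spider]
    cases n.opp c
    · simp; ring
    · have hk4 : iexp k * iexp k * sgn (oddPhase k) = 1 := by rw [hk, sgn_mul_self]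
      have h2 := sgn_mul_self (n.same c)
      simp [sgn_xor]
      linear_combination (-sgn (n.1 && n.2) * n.glob c * bas c true p) *
        (sgn (n.same c) * sgn (n.same c) * hk4 + h2)

/-- The tensor of a spider with two legs and a one-legged spider attached to it. -/
noncomputable def leafVal (c : Color) (k : ZMod 4) (c' : Color) (k' : ZMod 4) (n n' : Pauli)
    (γ b : Bool) : ℂ :=
  ∑ p, ∑ q, edgeMat n p q * spiderVal c' k' {q} * outVal (.spider c) k false {p, γ} n' b

/-- By orthonormality, attaching a one-legged tensor to a spider multiplies the two branches by its
two coefficients. -/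
theorem leafVal_eq {c : Color} {k : ZMod 4} {c' : Color} {k' : ZMod 4} {n n' : Pauli} {s p₀ p₁ : ℂ}
    (h : ∀ p, ∑ q, edgeMat n p q * spiderVal c' k' {q} = s * (p₀ * bas c false p + p₁ * bas c true p))
    (γ b : Bool) : leafVal c k c' k' n n' γ b = s * n'.glob c * (p₀ * bas c false γ *
      bas c (n'.opp c) b + p₁ * iexp k * sgn (n'.same c) * (bas c true γ * bas c (!n'.opp c) b)) := by
  simp only [leafVal, ← Finset.sum_mul, h]
  have h00 := sum_bas_mul_bas c false false
  have h01 := sum_bas_mul_bas c true false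
  have h10 := sum_bas_mul_bas c false true
  have h11 := sum_bas_mul_bas c true true
  simp only [outVal_spider, Multiset.insert_eq_cons, Multiset.map_cons, Multiset.map_singleton,
    Multiset.prod_cons, Multiset.prod_singleton, Fintype.sum_bool] at *
  simp only [Bool.false_eq_true, Bool.true_eq_false, if_true, if_false] at *
  linear_combination (s * n'.glob c * p₀ * bas c false γ * bas c (n'.opp c) b) * h00 +
    (s * n'.glob c * p₁ * bas c false γ * bas c (n'.opp c) b) * h01 +
    (s * n'.glob c * p₀ * iexp k * sgn (n'.same c) * (bas c true γ * bas c (!n'.opp c) b)) * h10 +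
    (s * n'.glob c * p₁ * iexp k * sgn (n'.same c) * (bas c true γ * bas c (!n'.opp c) b)) * h11

/-- A one-legged spider of the same colour fuses. -/
theorem leafVal_same (c : Color) (k k' : ZMod 4) (n n' : Pauli) :
    ∃ r : Pauli, ((n = (false, false) ∧ n' = (false, false)) → r = (false, false)) ∧
      ∃ s : ℂ, s ≠ 0 ∧ ∀ γ b, leafVal c k c k' n n' γ b =
        s * outVal (.spider c) (k + k') false {γ} r b := by
  obtain ⟨s, hs, h⟩ := sum_edgeMat_spiderVal c k' n
  set t := xor (n.same c) (oddPhase k' && n.opp c) with ht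
  have h' : ∀ p, ∑ q, edgeMat n p q * spiderVal c k' {q} =
      s * (1 * bas c false p + (iexp k' * sgn t) * bas c true p) := by
    intro p; rw [h]; ring
  have hg : (Pauli.mk c (xor t (n'.same c)) (n'.opp c)).glob c *
      (Pauli.mk c (xor t (n'.same c)) (n'.opp c)).glob c = 1 := by
    cases c
    · simp [Pauli.glob]
    · exact sgn_mul_self _
  refine ⟨Pauli.mk c (xor t (n'.same c)) (n'.opp c), ?_, s * n'.glob c *
    (Pauli.mk c (xor t (n'.same c)) (n'.opp c)).glob c, ?_, ?_⟩
  · rintro ⟨rfl, rfl⟩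
    cases c <;> simp [ht, Pauli.mk, Pauli.same, Pauli.opp]
  · exact mul_ne_zero (mul_ne_zero hs (Pauli.glob_ne_zero _ _)) (Pauli.glob_ne_zero _ _)
  · intro γ b
    rw [leafVal_eq h', outVal_spider]
    simp only [Pauli.same_mk, Pauli.opp_mk, Multiset.map_singleton, Multiset.prod_singleton,
      iexp_add, sgn_xor]
    linear_combination (-s * n'.glob c * (bas c false γ * bas c (n'.opp c) b +
      iexp k * iexp k' * (sgn t * sgn (n'.same c)) * (bas c true γ * bas c (!n'.opp c) b))) * hg

/-- A one-legged spider with an odd phase also has the opposite colour. -/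
theorem spiderVal_opp (c : Color) {k : ZMod 4} (hk : k = 1 ∨ k = 3) :
    ∃ s : ℂ, s ≠ 0 ∧ ∀ q, spiderVal c.opp k {q} = s * spiderVal c (-k) {q} := by
  have h2 := rsqrt_mul_self
  have hr : ((1 / Real.sqrt 2 : ℝ) : ℂ) ≠ 0 := fun h => by rw [h] at h2; norm_num at h2
  set r := ((1 / Real.sqrt 2 : ℝ) : ℂ) with hr'
  have hv3 : (3 : ZMod 4).val = 3 := rfl
  have hv1 : (1 : ZMod 4).val = 1 := rfl
  have hn1 : (-1 : ZMod 4) = 3 := rfl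
  have hn3 : (-3 : ZMod 4) = 1 := rfl
  have hI := Complex.I_mul_I
  have hI1 : (1 + Complex.I) ≠ 0 := by simp [Complex.ext_iff]
  have hI2 : (1 - Complex.I) ≠ 0 := by simp [Complex.ext_iff]
  have e1 : iexp 1 = Complex.I := by simp [iexp, hv1]
  have e3 : iexp 3 = -Complex.I := by simp [iexp, hv3]
  have z00 : bas .Z false false = 1 := rfl
  have z01 : bas .Z false true = 0 := rfl
  have z10 : bas .Z true false = 0 := rfl
  have z11 : bas .Z true true = 1 := rfl
  have x00 : bas .X false false = r := rfl
  have x01 : bas .X false true = r := rfl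
  have x10 : bas .X true false = r := rfl
  have x11 : bas .X true true = -r := rfl
  clear_value r
  set J := Complex.I
  rcases hk with rfl | rfl <;> cases c
  · refine ⟨r * (1 + J), mul_ne_zero hr hI1, fun q => ?_⟩
    cases q <;> simp only [spiderVal_eq, Color.opp, hn1, e1, e3, Multiset.map_singleton,
      Multiset.prod_singleton, z00, z01, z10, z11, x00, x01, x10, x11]
    · ring
    · linear_combination r * hI
  · refine ⟨r * (1 + J), mul_ne_zero hr hI1, fun q => ?_⟩
    cases q <;> simp only [spiderVal_eq, Color.opp, hn1, e1, e3, Multiset.map_singleton,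
      Multiset.prod_singleton, z00, z01, z10, z11, x00, x01, x10, x11]
    · linear_combination (-(1 - J * J)) * h2 + 1 / 2 * hI
    · linear_combination (-(1 + 2 * J + J * J)) * h2 - 1 / 2 * hI
  · refine ⟨r * (1 - J), mul_ne_zero hr hI2, fun q => ?_⟩
    cases q <;> simp only [spiderVal_eq, Color.opp, hn3, e1, e3, Multiset.map_singleton,
      Multiset.prod_singleton, z00, z01, z10, z11, x00, x01, x10, x11]
    · ring
    · linear_combination r * hI
  · refine ⟨r * (1 - J), mul_ne_zero hr hI2, fun q => ?_⟩
    cases q <;> simp only [spiderVal_eq, Color.opp, hn3, e1, e3, Multiset.map_singleton,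
      Multiset.prod_singleton, z00, z01, z10, z11, x00, x01, x10, x11]
    · linear_combination (-(1 - J * J)) * h2 + 1 / 2 * hI
    · linear_combination (-(1 - 2 * J + J * J)) * h2 - 1 / 2 * hI

/-- `|+⟩ ± |-⟩` is a multiple of a computational basis vector, and likewise with the colours
exchanged. -/
theorem spiderVal_opp_pi (c : Color) (h : Bool) :
    ∃ s : ℂ, s ≠ 0 ∧ ∀ q, spiderVal c.opp (if h then 2 else 0) {q} = s * bas c h q := by
  have h2 := rsqrt_mul_self
  have hr : ((1 / Real.sqrt 2 : ℝ) : ℂ) ≠ 0 := fun h => by rw [h] at h2; norm_num at h2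
  set r := ((1 / Real.sqrt 2 : ℝ) : ℂ) with hr'
  have e2 : iexp 2 = -1 := by
    rw [iexp, show (2 : ZMod 4).val = 2 from rfl, Complex.I_sq]
  have z00 : bas .Z false false = 1 := rfl
  have z01 : bas .Z false true = 0 := rfl
  have z10 : bas .Z true false = 0 := rfl
  have z11 : bas .Z true true = 1 := rfl
  have x00 : bas .X false false = r := rfl
  have x01 : bas .X false true = r := rfl
  have x10 : bas .X true false = r := rfl
  have x11 : bas .X true true = -r := rfl
  clear_value r
  refine ⟨2 * r, mul_ne_zero two_ne_zero hr, fun q => ?_⟩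
  cases c <;> cases h <;> cases q <;> simp only [spiderVal_eq, Color.opp, iexp_zero, e2,
    Multiset.map_singleton, Multiset.prod_singleton, if_true, if_false, Bool.false_eq_true,
    z00, z01, z10, z11, x00, x01, x10, x11] <;> first | ring1 | linear_combination (-2) * h2 | linear_combination 2 * h2

/-- A one-legged spider of the opposite colour with phase `0` or `π` projects to a basis vector. -/
theorem leafVal_pi (c : Color) (h : Bool) (n n' : Pauli) :
    ∃ s : ℂ, s ≠ 0 ∧ ∀ γ b, leafVal c 0 c.opp (if h then 2 else 0) n n' γ b =
      s * (bas c (xor h (n.opp c)) γ * bas c (xor (xor h (n.opp c)) (n'.opp c)) b) := by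
  obtain ⟨s, hs, hv⟩ := spiderVal_opp_pi c h
  have hsum : ∀ p, ∑ q, edgeMat n p q * spiderVal c.opp (if h then 2 else 0) {q} =
      s * sgn (n.1 && n.2) * n.glob c * sgn (n.same c && h) * bas c (xor h (n.opp c)) p := by
    intro p
    have := sum_bas_mul_edgeMat c h n p
    calc _ = s * sgn (n.1 && n.2) * ∑ q, bas c h q * edgeMat n q p := by
          rw [Finset.mul_sum]
          refine Finset.sum_congr rfl fun q _ => ?_
          rw [hv, edgeMat_comm n p q]; ring
      _ = _ := by rw [this]; ring
  have hs' : s * sgn (n.1 && n.2) * n.glob c * sgn (n.same c && h) ≠ 0 :=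
    mul_ne_zero (mul_ne_zero (mul_ne_zero hs (sgn_ne_zero _)) (Pauli.glob_ne_zero _ _))
      (sgn_ne_zero _)
  revert hsum hs'
  generalize s * sgn (n.1 && n.2) * n.glob c * sgn (n.same c && h) = s'
  generalize xor h (n.opp c) = j
  intro hsum hs'
  -- Behind a projection to the branch `j`, the component of `n'` in the colour `c` acts as a
  -- scalar.
  refine ⟨s' * n'.glob c * (if j then sgn (n'.same c) else 1), ?_, fun γ b => ?_⟩
  · refine mul_ne_zero (mul_ne_zero hs' (Pauli.glob_ne_zero _ _)) ?_
    split_ifs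
    · exact sgn_ne_zero _
    · exact one_ne_zero
  · rw [leafVal_eq (s := s') (p₀ := if j then 0 else 1) (p₁ := if j then 1 else 0)]
    · cases j <;> simp [iexp_zero]
      ring
    · intro p
      rw [hsum]
      cases j <;> simp

/-- The spider with two legs and phase `π` is a flip. -/
theorem spiderVal_pi (c : Color) (i b : Bool) :
    ∑ a, bas c i a * spiderVal c.opp 2 {b, a} = bas c (!i) b := by
  have h2 := rsqrt_mul_self
  set r := ((1 / Real.sqrt 2 : ℝ) : ℂ) with hr'
  have e2 : iexp 2 = -1 := by
    rw [iexp, show (2 : ZMod 4).val = 2 from rfl, Complex.I_sq]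
  have z00 : bas .Z false false = 1 := rfl
  have z01 : bas .Z false true = 0 := rfl
  have z10 : bas .Z true false = 0 := rfl
  have z11 : bas .Z true true = 1 := rfl
  have x00 : bas .X false false = r := rfl
  have x01 : bas .X false true = r := rfl
  have x10 : bas .X true false = r := rfl
  have x11 : bas .X true true = -r := rfl
  clear_value r
  cases c <;> cases i <;> cases b <;> simp only [spiderVal_eq, Color.opp, e2, Fintype.sum_bool,
    Multiset.insert_eq_cons, Multiset.map_cons, Multiset.prod_cons, Bool.not_true, Bool.not_false,
    Multiset.map_singleton, Multiset.prod_singleton, z00, z01, z10, z11, x00, x01, x10, x11] <;>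
    first | ring1 | linear_combination 2 * h2

/-- Measuring after a rotation. -/
theorem sum_outVal_spiderVal (c : Color) (k : ZMod 4) (n : Pauli) :
    ∃ r : Pauli, (n = (false, false) → r = (false, false)) ∧
      ∃ s : ℂ, s ≠ 0 ∧ ∀ γ, ∑ b, outVal (.spider c) k false {γ} n b * spiderVal c 0 {b} =
        s * ∑ b, edgeMat r γ b * spiderVal c k {b} := by
  obtain ⟨s, hs, h⟩ := sum_edgeMat_spiderVal c k (Pauli.mk c (n.same c) false)
  -- The component of `n` opposite to `c` exchanges the branches of the phase-free spider, which
  -- does not change that spider. Only the component of colour `c` has to be moved in front.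
  refine ⟨Pauli.mk c (n.same c) false, ?_, n.glob c * s⁻¹,
    mul_ne_zero (Pauli.glob_ne_zero _ _) (inv_ne_zero hs), fun γ => ?_⟩
  · rintro rfl
    cases c <;> rfl
  · rw [h]
    have := sum_bas_pair c (n.opp c) false (n.glob c * bas c false γ)
      (n.glob c * (iexp k * sgn (n.same c) * bas c true γ)) 1 1
    simp only [outVal_spider, spiderVal_eq, Multiset.map_singleton, Multiset.prod_singleton,
      iexp_zero, Pauli.same_mk, Pauli.opp_mk, Bool.and_false, Bool.xor_false]
    calc _ = ∑ a, ((n.glob c * bas c false γ) * bas c (n.opp c) a +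
          (n.glob c * (iexp k * sgn (n.same c) * bas c true γ)) * bas c (!n.opp c) a) *
          (1 * bas c false a + 1 * bas c (!false) a) :=
          Finset.sum_congr rfl fun a _ => by simp only [Bool.not_false]; ring
      _ = _ := by
          rw [this]
          field_simp
          split_ifs <;> ring

/-- Conjugating a projection with flips. -/
theorem leafVal_conj (c : Color) (n₁ n₂ n₃ n₄ : Pauli) :
    ∃ s : ℂ, s ≠ 0 ∧ ∀ γ b, ∑ γ₂, outVal (.spider c.opp) 2 false {γ} n₁ γ₂ *
      ∑ γ₁, leafVal c 0 c.opp 0 n₂ n₃ γ₂ γ₁ * outVal (.spider c.opp) 2 false {γ₁} n₄ b =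
      s * ∑ γ', edgeMat (Pauli.mk c false (n₁.opp c)) γ γ' *
        leafVal c 0 c.opp 2 n₂ (Pauli.mk c false (xor (n₃.opp c) (n₄.opp c))) γ' b := by
  -- Both sides are a basis vector at the input times one at the output. Components of colour `c`
  -- act on basis vectors as signs, so it suffices to count the exchanges.
  obtain ⟨s₀, hs₀, h₀⟩ := leafVal_pi c false n₂ n₃
  obtain ⟨s₂, hs₂, h₂⟩ := leafVal_pi c true n₂ (Pauli.mk c false (xor (n₃.opp c) (n₄.opp c)))
  simp only [Bool.false_xor, Bool.true_xor, Bool.false_eq_true, if_false, if_true] at h₀ h₂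
  set j := n₂.opp c with hj
  have out : ∀ i b, ∑ γ, bas c i γ * outVal (.spider c.opp) 2 false {γ} n₄ b =
      n₄.glob c * (sgn (n₄.same c && !i) * bas c (xor (!i) (n₄.opp c)) b) := by
    intro i b
    rw [← sum_bas_mul_edgeMat]
    simp only [outVal, nodeVal, ← spiderVal_pi c i, Finset.sum_mul, Finset.mul_sum,
      Multiset.insert_eq_cons]
    rw [Finset.sum_comm]
    exact Finset.sum_congr rfl fun _ _ => Finset.sum_congr rfl fun _ _ => by ring
  have inn : ∀ n i γ, ∑ b, edgeMat n γ b * bas c i b = sgn (n.1 && n.2) * (n.glob c *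
      (sgn (n.same c && i) * bas c (xor i (n.opp c)) γ)) := by
    intro n i γ
    rw [← sum_bas_mul_edgeMat, Finset.mul_sum]
    exact Finset.sum_congr rfl fun b _ => by rw [edgeMat_comm n γ b]; ring
  have inn' : ∀ i γ, ∑ γ₂, outVal (.spider c.opp) 2 false {γ} n₁ γ₂ * bas c i γ₂ =
      sgn (n₁.1 && n₁.2) * (n₁.glob c * (sgn (n₁.same c && i) * bas c (!xor i (n₁.opp c)) γ)) := by
    intro i γ
    rw [← spiderVal_pi c]
    have : ∀ a, sgn (n₁.1 && n₁.2) * (n₁.glob c * (sgn (n₁.same c && i) *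
        (bas c (xor i (n₁.opp c)) a * spiderVal c.opp 2 {γ, a}))) =
        (∑ b, edgeMat n₁ a b * bas c i b) * spiderVal c.opp 2 {a, γ} := by
      intro a
      rw [inn, Multiset.pair_comm]
      ring
    simp only [Finset.mul_sum]
    rw [Finset.sum_congr rfl fun a _ => this a]
    simp only [outVal, nodeVal, Finset.sum_mul, Multiset.insert_eq_cons]
    rw [Finset.sum_comm]
    exact Finset.sum_congr rfl fun _ _ => Finset.sum_congr rfl fun _ _ => by ring
  refine ⟨s₀ * (n₄.glob c * sgn (n₄.same c && !xor j (n₃.opp c))) * sgn (n₁.1 && n₁.2) * n₁.glob c *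
    sgn (n₁.same c && j) * (s₂ * (sgn ((Pauli.mk c false (n₁.opp c)).1 &&
      (Pauli.mk c false (n₁.opp c)).2) * (Pauli.mk c false (n₁.opp c)).glob c))⁻¹, ?_, ?_⟩
  · simp only [ne_eq, mul_eq_zero, inv_eq_zero, hs₀, hs₂, sgn_ne_zero, Pauli.glob_ne_zero, or_self,
      not_false_eq_true]
  · intro γ b
    have e₁ : ∀ γ₂, ∑ γ₁, leafVal c 0 c.opp 0 n₂ n₃ γ₂ γ₁ *
        outVal (.spider c.opp) 2 false {γ₁} n₄ b = bas c j γ₂ * (s₀ * (n₄.glob c *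
        (sgn (n₄.same c && !xor j (n₃.opp c)) * bas c (xor (!xor j (n₃.opp c)) (n₄.opp c)) b))) := by
      intro γ₂
      rw [← out, Finset.mul_sum, Finset.mul_sum]
      exact Finset.sum_congr rfl fun γ₁ _ => by rw [h₀]; ring
    have e₂ : ∑ γ', edgeMat (Pauli.mk c false (n₁.opp c)) γ γ' * leafVal c 0 c.opp 2 n₂
        (Pauli.mk c false (xor (n₃.opp c) (n₄.opp c))) γ' b =
        (∑ γ', edgeMat (Pauli.mk c false (n₁.opp c)) γ γ' * bas c (!j) γ') *
        (s₂ * bas c (xor (!j) (xor (n₃.opp c) (n₄.opp c))) b) := by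
      rw [Finset.sum_mul]
      exact Finset.sum_congr rfl fun γ' _ => by rw [h₂, Pauli.opp_mk]; ring
    rw [e₂, inn]
    simp only [e₁, ← mul_assoc]
    simp only [← Finset.sum_mul]
    rw [inn']
    have x₁ : xor (!j) (xor (n₃.opp c) (n₄.opp c)) = xor (!xor j (n₃.opp c)) (n₄.opp c) := by
      cases j <;> cases n₃.opp c <;> cases n₄.opp c <;> rfl
    have x₂ : xor (!j) (n₁.opp c) = !xor j (n₁.opp c) := by
      cases j <;> cases n₁.opp c <;> rfl
    rw [x₁]
    simp only [Pauli.same_mk, Pauli.opp_mk, x₂, Bool.false_and]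
    have := sgn_ne_zero ((Pauli.mk c false (n₁.opp c)).1 && (Pauli.mk c false (n₁.opp c)).2)
    have := Pauli.glob_ne_zero c (Pauli.mk c false (n₁.opp c))
    rw [show sgn false = 1 from rfl]
    field_simp

/-- Conjugating a projection with flips that are free of errors. -/
theorem leafVal_conj_zero (c : Color) (n₂ n : Pauli) :
    ∃ s : ℂ, s ≠ 0 ∧ ∀ γ b, ∑ γ₂, outVal (.spider c.opp) 2 false {γ} (false, false) γ₂ *
      ∑ γ₁, leafVal c 0 c.opp 0 n₂ (false, false) γ₂ γ₁ *
        outVal (.spider c.opp) 2 false {γ₁} n b = s * leafVal c 0 c.opp 2 n₂ n γ b := by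
  obtain ⟨s, hs, h⟩ := leafVal_conj c (false, false) n₂ (false, false) n
  obtain ⟨s₁, hs₁, h₁⟩ := leafVal_pi c true n₂ n
  obtain ⟨s₂, hs₂, h₂⟩ := leafVal_pi c true n₂
    (Pauli.mk c false (xor (Pauli.opp c (false, false)) (n.opp c)))
  rw [if_pos rfl] at h₁ h₂
  refine ⟨s * s₂ * s₁⁻¹, mul_ne_zero (mul_ne_zero hs hs₂) (inv_ne_zero hs₁), fun γ b => ?_⟩
  have hz : Pauli.opp c (false, false) = false := by cases c <;> rfl
  have hm : Pauli.mk c false false = (false, false) := by cases c <;> rfl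
  rw [h, h₁]
  simp only [h₂]
  simp only [Pauli.opp_mk, hz, hm, Bool.false_xor]
  rw [Finset.sum_eq_single γ]
  · rw [show edgeMat (false, false) γ γ = 1 by cases γ <;> simp [edgeMat]]
    field_simp
  · intro γ' _ h
    rw [show edgeMat (false, false) γ γ' = 0 by cases γ <;> cases γ' <;> simp_all [edgeMat]]
    ring
  · simp


/-! # Simulation of errors -/

section sim

variable {V E V' E' V'' E'' L : Type}

/-- The product of two flips, up to sign. -/
def Pauli.mul (m n : Pauli) : Pauli := (xor m.1 n.1, xor m.2 n.2)

/-- Apply the matrix `M` to the label `l`. -/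
noncomputable def op (M : Bool → Bool → ℂ) (l : L) (F : (L → Bool) → ℂ) (β : L → Bool) : ℂ :=
  ∑ γ, M γ (β l) * F (Function.update β l γ)

theorem op_op (M N : Bool → Bool → ℂ) (l : L) (F : (L → Bool) → ℂ) (β : L → Bool) :
    op M l (op N l F) β = op (fun δ b => ∑ γ, N δ γ * M γ b) l F β := by
  simp only [op, Function.update_self, Function.update_idem, Finset.mul_sum, Finset.sum_mul]
  rw [Finset.sum_comm]
  exact Finset.sum_congr rfl fun _ _ => Finset.sum_congr rfl fun _ _ => by ring

theorem op_smul {M N : Bool → Bool → ℂ} {s : ℂ} (h : ∀ γ b, M γ b = s * N γ b) (l : L)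
    (F : (L → Bool) → ℂ) (β : L → Bool) : op M l F β = s * op N l F β := by
  simp only [op, h, Finset.mul_sum, mul_assoc]

theorem op_congr_smul (M : Bool → Bool → ℂ) (l : L) {F G : (L → Bool) → ℂ} {s : ℂ}
    (h : ∀ β, F β = s * G β) (β : L → Bool) : op M l F β = s * op M l G β := by
  simp only [op, h, Finset.mul_sum]
  exact Finset.sum_congr rfl fun _ _ => by ring

/-- The weight of a flip. -/
noncomputable def Pauli.wt (n : Pauli) : ℕ := if n = (false, false) then 0 else 1

theorem Pauli.wt_le_of_imp {m n : Pauli} (h : n = (false, false) → m = (false, false)) :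
    m.wt ≤ n.wt := by
  unfold Pauli.wt
  split_ifs with h1 h2 <;> simp_all

/-- For the weight of a combined flip it only matters that it vanishes when the flips it replaces
do; its precise components are irrelevant. -/
theorem Pauli.wt_le_add_of_imp {m n n' : Pauli}
    (h : (n = (false, false) ∧ n' = (false, false)) → m = (false, false)) :
    m.wt ≤ n.wt + n'.wt := by
  unfold Pauli.wt
  split_ifs with h1 h2 <;> simp_all

theorem wt_eq_sum [Fintype E] (ε : E → Pauli) : wt ε = ∑ e, (ε e).wt := by
  rw [wt, Finset.card_filter]
  refine Finset.sum_congr rfl fun e _ => ?_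
  by_cases h : ε e = (false, false) <;> simp [Pauli.wt, h]

theorem wt_option [Fintype E] (ε : Option E → Pauli) :
    wt ε = (ε none).wt + wt fun e => ε (some e) := by
  simp only [wt_eq_sum, Fintype.sum_option]

theorem wt_update_le [Fintype E] (ε : E → Pauli) (e : E) (n : Pauli) :
    wt (Function.update ε e ((ε e).mul n)) ≤ wt ε + n.wt := by
  rw [wt_eq_sum, wt_eq_sum, ← Finset.add_sum_erase _ _ (Finset.mem_univ e),
    ← Finset.add_sum_erase _ (fun e => (ε e).wt) (Finset.mem_univ e)]
  have : ∑ x ∈ Finset.univ.erase e, (Function.update ε e ((ε e).mul n) x).wt =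
      ∑ x ∈ Finset.univ.erase e, (ε x).wt :=
    Finset.sum_congr rfl fun x hx => by rw [Function.update_of_ne (Finset.ne_of_mem_erase hx)]
  rw [this, Function.update_self]
  have h : ((ε e).mul n).wt ≤ (ε e).wt + n.wt := by
    refine Pauli.wt_le_add_of_imp ?_
    rintro ⟨h, rfl⟩
    rw [h]; rfl
  omega

theorem edgeMat_mul_right (m n : Pauli) : ∃ s : ℂ, s ≠ 0 ∧ ∀ a c b,
    edgeMat n a b * edgeMat m c a + edgeMat n (!a) b * edgeMat m c (!a) =
      s * ((if a = b then 1 else 0) * edgeMat (m.mul n) c a +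
        (if (!a) = b then 1 else 0) * edgeMat (m.mul n) c (!a)) := by
  refine ⟨sgn (n.1 && m.2), sgn_ne_zero _, ?_⟩
  obtain ⟨z, x⟩ := m
  obtain ⟨z', x'⟩ := n
  intro a c b
  cases a <;> cases c <;> cases b <;> cases z <;> cases x <;> cases z' <;> cases x' <;>
    simp [edgeMat, sgn, Pauli.mul]

theorem edgeMat_mul_left (m n : Pauli) : ∃ s : ℂ, s ≠ 0 ∧ ∀ a c b,
    edgeMat n a b * edgeMat m a c + edgeMat n (!a) b * edgeMat m (!a) c =
      s * ((if a = b then 1 else 0) * edgeMat (m.mul n) a c +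
        (if (!a) = b then 1 else 0) * edgeMat (m.mul n) (!a) c) := by
  obtain ⟨s, hs, h⟩ := edgeMat_mul_right m n
  refine ⟨sgn (m.1 && m.2) * s * sgn ((m.mul n).1 && (m.mul n).2),
    mul_ne_zero (mul_ne_zero (sgn_ne_zero _) hs) (sgn_ne_zero _), fun a c b => ?_⟩
  have h2 := sgn_mul_self ((m.mul n).1 && (m.mul n).2)
  rw [edgeMat_comm m a c, edgeMat_comm m (!a) c, edgeMat_comm (m.mul n) a c,
    edgeMat_comm (m.mul n) (!a) c]
  linear_combination sgn (m.1 && m.2) * h a c b - sgn (m.1 && m.2) * s *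
    ((if a = b then 1 else 0) * edgeMat (m.mul n) c a +
      (if (!a) = b then 1 else 0) * edgeMat (m.mul n) c (!a)) * h2

/-- Two sums over labellings agree if they agree after averaging over one label. -/
theorem sum_eq_of_flip [Fintype E] {inst : Fintype (E → Bool → Bool)}
    {F G : (E → Bool → Bool) → ℂ} (e : E) (s : Bool)
    (h : ∀ x, F x + F (Function.update x e (Function.update (x e) s (!x e s))) =
      G x + G (Function.update x e (Function.update (x e) s (!x e s)))) : ∑ x, F x = ∑ x, G x := by
  let i : (E → Bool → Bool) → (E → Bool → Bool) :=
    fun x => Function.update x e (Function.update (x e) s (!x e s))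
  have hi : Function.Involutive i := by
    intro x
    simp [i]
  have hF : ∀ F : (E → Bool → Bool) → ℂ, ∑ x, F (i x) = ∑ x, F x := fun F =>
    Equiv.sum_comp (hi.toPerm) F
  have : ∑ x, (F x + F (i x)) = ∑ x, (G x + G (i x)) := Finset.sum_congr rfl fun x _ => h x
  rw [Finset.sum_add_distrib, Finset.sum_add_distrib, hF, hF] at this
  linear_combination this / 2

/-- A flip at a boundary vertex can be absorbed into the error on its edge. -/
theorem Lbl.exists_flip [Fintype V] [Fintype E] {D : ZXDiagram V E} {ℓ : V → L} (hD : Lbl D ℓ)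
    {o : V} (ho : D.type o = .boundary) (n : Pauli) (ε : E → Pauli) :
    ∃ ε' : E → Pauli, wt ε' ≤ wt ε + n.wt ∧ ∃ s : ℂ, s ≠ 0 ∧ ∀ β,
      op (edgeMat n) (ℓ o) (interpL D ℓ ε) β = s * interpL D ℓ ε' β := by
  obtain ⟨⟨e, t⟩, het⟩ := Finset.card_eq_one.1 (hD.degree o ho)
  have mem : ∀ e' s', D.ends e' s' = o ↔ e' = e ∧ s' = t := by
    intro e' s'
    have : (e', s') ∈ D.legs o ↔ (e', s') ∈ ({(e, t)} : Finset (E × Bool)) := by rw [het]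
    simpa [legs] using this
  have hlab : ∀ x, labels D.ends x o = {x e t} := by
    intro x
    rw [← sum_legs_eq_labels, het]; rfl
  refine ⟨Function.update ε e ((ε e).mul n), wt_update_le ε e n, ?_⟩
  -- The leg of `o` can be either end of its edge, and accordingly the new flip multiplies from the
  -- left or from the right.
  have hs : ∃ s : ℂ, s ≠ 0 ∧ ∀ (y : Bool → Bool) b,
      edgeMat n (y t) b * edgeMat (ε e) (y false) (y true) +
        edgeMat n (!y t) b * edgeMat (ε e) (Function.update y t (!y t) false)
          (Function.update y t (!y t) true) =
      s * ((if y t = b then 1 else 0) * edgeMat ((ε e).mul n) (y false) (y true) +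
        (if (!y t) = b then 1 else 0) * edgeMat ((ε e).mul n) (Function.update y t (!y t) false)
          (Function.update y t (!y t) true)) := by
    cases t
    · obtain ⟨s, hs, h⟩ := edgeMat_mul_left (ε e) n
      exact ⟨s, hs, fun y b => by simpa using h (y false) (y true) b⟩
    · obtain ⟨s, hs, h⟩ := edgeMat_mul_right (ε e) n
      exact ⟨s, hs, fun y b => by simpa using h (y true) (y false) b⟩
  obtain ⟨s, hs, hloc⟩ := hs
  refine ⟨s, hs, fun β => ?_⟩
  -- `R` collects the factors that do not see the label at the leg of `o`.
  set R : (E → Bool → Bool) → ℂ := fun x => (∏ v ∈ Finset.univ.erase o,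
    nodeVal (D.type v) (D.phase v) (β (ℓ v)) (labels D.ends x v)) *
      ∏ e' ∈ Finset.univ.erase e, edgeMat (ε e') (x e' false) (x e' true) with hR
  have e₁ : ∀ γ, interpL D ℓ ε (Function.update β (ℓ o) γ) = ∑ x : E → Bool → Bool,
      (if x e t = γ then 1 else 0) * edgeMat (ε e) (x e false) (x e true) * R x := by
    intro γ
    refine Finset.sum_congr rfl fun x _ => ?_
    rw [← Finset.mul_prod_erase _ _ (Finset.mem_univ o),
      ← Finset.mul_prod_erase _ (fun e => edgeMat (ε e) (x e false) (x e true)) (Finset.mem_univ e),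
      hlab]
    simp only [ho, nodeVal_boundary, Function.update_self, hR]
    rw [Finset.prod_congr rfl fun v hv => by
      rw [hD.nodeVal_update ho (Finset.ne_of_mem_erase hv)]]
    ring
  have e₂ : interpL D ℓ (Function.update ε e ((ε e).mul n)) β = ∑ x : E → Bool → Bool,
      (if x e t = β (ℓ o) then 1 else 0) * edgeMat ((ε e).mul n) (x e false) (x e true) * R x := by
    refine Finset.sum_congr rfl fun x _ => ?_
    rw [← Finset.mul_prod_erase _ _ (Finset.mem_univ o),
      ← Finset.mul_prod_erase _ (fun e' => edgeMat (Function.update ε e ((ε e).mul n) e')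
        (x e' false) (x e' true)) (Finset.mem_univ e),
      hlab]
    simp only [ho, nodeVal_boundary, Function.update_self, hR]
    have : ∏ e' ∈ Finset.univ.erase e, edgeMat (Function.update ε e ((ε e).mul n) e')
        (x e' false) (x e' true) = ∏ e' ∈ Finset.univ.erase e, edgeMat (ε e') (x e' false)
        (x e' true) := Finset.prod_congr rfl fun e' he' => by
      rw [Function.update_of_ne (Finset.ne_of_mem_erase he')]
    rw [this]
    ring
  have e₃ : op (edgeMat n) (ℓ o) (interpL D ℓ ε) β = ∑ x : E → Bool → Bool,
      edgeMat n (x e t) (β (ℓ o)) * edgeMat (ε e) (x e false) (x e true) * R x := by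
    unfold op
    simp only [e₁, Finset.mul_sum]
    rw [Finset.sum_comm]
    refine Finset.sum_congr rfl fun x _ => ?_
    cases x e t <;> simp [mul_assoc]
  rw [e₃, e₂, Finset.mul_sum]
  -- The summands differ one by one; they agree after summing over the label at `o`, where the
  -- inserted flip and the error on the edge are composed.
  refine sum_eq_of_flip e t fun x => ?_
  have hRx : R (Function.update x e (Function.update (x e) t (!x e t))) = R x := by
    simp only [hR]
    congr 1
    · refine Finset.prod_congr rfl fun v hv => ?_
      congr 1
      refine labels_congr fun e' s' h => ?_
      by_cases he : e' = e
      · subst he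
        have : s' ≠ t := fun hs' => Finset.ne_of_mem_erase hv (h.symm.trans ((mem _ _).2 ⟨rfl, hs'⟩))
        rw [Function.update_self, Function.update_of_ne this]
      · rw [Function.update_of_ne he]
    · exact Finset.prod_congr rfl fun e' he' => by
        rw [Function.update_of_ne (Finset.ne_of_mem_erase he')]
  rw [hRx]
  simp only [Function.update_self]
  linear_combination R x * hloc (x e) (β (ℓ o))

/-- Every error of `D` acts like an error of `C` of at most the same weight. -/
def Sim [Fintype V] [Fintype E] [Fintype V'] [Fintype E'] (D : ZXDiagram V E) (ℓ : V → L)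
    (C : ZXDiagram V' E') (ℓ' : V' → L) : Prop :=
  ∀ ε : E → Pauli, ∃ ε' : E' → Pauli, wt ε' ≤ wt ε ∧ ∃ s : ℂ, s ≠ 0 ∧
    ∀ β, interpL D ℓ ε β = s * interpL C ℓ' ε' β

/-- The two diagrams simulate each other. -/
def FaultEquiv [Fintype V] [Fintype E] [Fintype V'] [Fintype E'] (D : ZXDiagram V E) (ℓ : V → L)
    (C : ZXDiagram V' E') (ℓ' : V' → L) : Prop :=
  Sim D ℓ C ℓ' ∧ Sim C ℓ' D ℓ

variable [Fintype V] [Fintype E] [Fintype V'] [Fintype E'] [Fintype V''] [Fintype E'']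
  {D : ZXDiagram V E} {ℓ : V → L} {C : ZXDiagram V' E'} {ℓ' : V' → L} {B : ZXDiagram V'' E''}
  {ℓ'' : V'' → L}

theorem Sim.trans (h₁ : Sim D ℓ C ℓ') (h₂ : Sim C ℓ' B ℓ'') : Sim D ℓ B ℓ'' := by
  intro ε
  obtain ⟨ε₁, hw₁, s₁, hs₁, e₁⟩ := h₁ ε
  obtain ⟨ε₂, hw₂, s₂, hs₂, e₂⟩ := h₂ ε₁
  exact ⟨ε₂, hw₂.trans hw₁, s₁ * s₂, mul_ne_zero hs₁ hs₂, fun β => by rw [e₁, e₂, mul_assoc]⟩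

theorem FaultEquiv.trans (h₁ : FaultEquiv D ℓ C ℓ') (h₂ : FaultEquiv C ℓ' B ℓ'') :
    FaultEquiv D ℓ B ℓ'' :=
  ⟨h₁.1.trans h₂.1, h₂.2.trans h₁.2⟩

theorem FaultEquiv.refl (D : ZXDiagram V E) (ℓ : V → L) : FaultEquiv D ℓ D ℓ :=
  have : Sim D ℓ D ℓ := fun ε => ⟨ε, le_rfl, 1, one_ne_zero, fun β => by rw [one_mul]⟩
  ⟨this, this⟩

/-- Outer labels are pulled back along `ρ`, so injectivity is not needed. -/
theorem Sim.relabel {L' : Type} (h : Sim D ℓ C ℓ') (ρ : L → L') :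
    Sim D (ρ ∘ ℓ) C (ρ ∘ ℓ') := by
  intro ε
  obtain ⟨ε₁, hw₁, s₁, hs₁, e₁⟩ := h ε
  exact ⟨ε₁, hw₁, s₁, hs₁, fun β => e₁ (β ∘ ρ)⟩

theorem FaultEquiv.relabel {L' : Type} (h : FaultEquiv D ℓ C ℓ') (ρ : L → L') :
    FaultEquiv D (ρ ∘ ℓ) C (ρ ∘ ℓ') :=
  ⟨h.1.relabel ρ, h.2.relabel ρ⟩

theorem FaultEquiv.of_labels {ℓ₁ : V → L} (h : ∀ v, D.type v = .boundary → ℓ₁ v = ℓ v) :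
    FaultEquiv D ℓ₁ D ℓ := by
  have key : ∀ ε β, interpL D ℓ₁ ε β = interpL D ℓ ε β := fun ε β =>
    interpL_congr fun v hv => by rw [h v hv]
  exact ⟨fun ε => ⟨ε, le_rfl, 1, one_ne_zero, fun β => by rw [one_mul, key]⟩,
    fun ε => ⟨ε, le_rfl, 1, one_ne_zero, fun β => by rw [one_mul, key]⟩⟩

end sim


/-! # Gates: labels, circuits and errors -/

section gates

variable {V E V' E' L : Type}

theorem degree_retype [Fintype E] (D : ZXDiagram V E) (v u : V) (t : NodeType) (k : ZMod 4) :
    (D.retype v t k).degree u = D.degree u := rfl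

theorem degree_addNode_some [Fintype E] (D : ZXDiagram V E) (u : V) (t : NodeType) (k : ZMod 4) :
    (D.addNode t k).degree (some u) = D.degree u := by
  rw [← card_labels _ (fun _ _ => false), ← card_labels _ (fun _ _ => false)]
  simp [labels, addNode]

theorem degree_addNode_none [Fintype E] (D : ZXDiagram V E) (t : NodeType) (k : ZMod 4) :
    (D.addNode t k).degree none = 0 := by
  rw [← card_labels _ (fun _ _ => false)]
  simp [labels, addNode]

theorem degree_addEdge [DecidableEq V] [Fintype E] (D : ZXDiagram V E) (v w u : V) :
    (D.addEdge v w).degree u =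
      (if u = v then 1 else 0) + (if u = w then 1 else 0) + D.degree u := by
  rw [← card_labels _ (fun e s => e.elim (if s then false else false) fun _ => false),
    ← card_labels _ (fun _ _ => false)]
  refine (congrArg _ (labels_addEnds D.ends v w false false (fun _ _ => false) u)).trans ?_
  rw [Multiset.card_add, Multiset.card_add]
  congr 2 <;> split_ifs <;> rfl

theorem degree_addLeg_some [DecidableEq V] [Fintype E] (D : ZXDiagram V E) (v u : V) (t : NodeType)
    (k : ZMod 4) : (D.addLeg v t k).degree (some u) = (if u = v then 1 else 0) + D.degree u := by
  rw [addLeg, degree_addEdge, degree_addNode_some]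
  simp

theorem degree_addLeg_none [Fintype E] (D : ZXDiagram V E) (v : V) (t : NodeType) (k : ZMod 4) :
    (D.addLeg v t k).degree none = 1 := by
  rw [addLeg, degree_addEdge, degree_addNode_none]
  simp

/-- The labels of the boundary vertices. -/
def bl (D : ZXDiagram V E) (ℓ : V → L) : Set L := {l | ∃ v, D.type v = .boundary ∧ ℓ v = l}

section lbl

variable [Fintype E] {D : ZXDiagram V E} {ℓ : V → L}

theorem Lbl.relabel {L' : Type} (hD : Lbl D ℓ) {ρ : L → L'} (hρ : Function.Injective ρ) :
    Lbl D (ρ ∘ ℓ) :=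
  ⟨hD.degree, fun v w hv hw h => hD.inj v w hv hw (hρ h)⟩

theorem Lbl.meas (hD : Lbl D ℓ) (o : V) (c : Color) (k : ZMod 4) :
    Lbl (D.retype o (.spider c) k) ℓ := by
  constructor
  · intro v hv
    by_cases h : v = o
    · subst h; simp [retype] at hv
    · simp only [retype, Function.update_of_ne h] at hv
      exact hD.degree v hv
  · intro v w hv hw
    by_cases h : v = o
    · subst h; simp [retype] at hv
    by_cases h' : w = o
    · subst h'; simp [retype] at hw
    simp only [retype, Function.update_of_ne h, Function.update_of_ne h'] at hv hw
    exact hD.inj v w hv hw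

theorem Lbl.one (hD : Lbl D ℓ) {o : V} (ho : D.type o = .boundary) {t : NodeType}
    (ht : t ≠ .boundary) (k : ZMod 4) : Lbl (D.gateOne o t k) (fun v => v.elim (ℓ o) ℓ) := by
  have key : ∀ v, (D.gateOne o t k).type (some v) = .boundary → v ≠ o ∧ D.type v = .boundary := by
    intro v hv
    by_cases h : v = o
    · subst h; simp [addLeg, addEdge, addNode, retype, ht] at hv
    · simpa [addLeg, addEdge, addNode, retype, h] using hv
  constructor
  · rintro (_ | v) hv
    · exact degree_addLeg_none _ _ _ _
    · obtain ⟨h, hv⟩ := key v hv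
      rw [degree_addLeg_some, if_neg h, degree_retype, hD.degree v hv]
  · rintro (_ | v) (_ | w) hv hw h
    · rfl
    · exact absurd (hD.inj _ _ ho (key w hw).2 h).symm (key w hw).1
    · exact absurd (hD.inj _ _ (key v hv).2 ho h) (key v hv).1
    · exact congrArg some (hD.inj _ _ (key v hv).2 (key w hw).2 h)

theorem Lbl.leaf (hD : Lbl D ℓ) {o : V} (ho : D.type o = .boundary) (c : Color) (k : ZMod 4)
    (c' : Color) (k' : ZMod 4) :
    Lbl (D.gateLeaf o c k c' k') (fun v => v.elim (ℓ o) fun v => v.elim (ℓ o) ℓ) := by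
  have key' : (D.gateLeaf o c k c' k').type (some none) ≠ .boundary := by
    simp [addLeg, addEdge, addNode]
  have key : ∀ v, (D.gateLeaf o c k c' k').type (some (some v)) = .boundary →
      v ≠ o ∧ D.type v = .boundary := by
    intro v hv
    by_cases h : v = o
    · subst h; simp [addLeg, addEdge, addNode, retype] at hv
    · simpa [addLeg, addEdge, addNode, retype, h] using hv
  constructor
  · rintro (_ | _ | v) hv
    · exact degree_addLeg_none _ _ _ _
    · exact absurd hv key'
    · obtain ⟨h, hv⟩ := key v hv
      rw [degree_addLeg_some, if_neg (by simpa using h), degree_addLeg_some, if_neg h,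
        degree_retype, hD.degree v hv]
  · rintro (_ | _ | v) (_ | _ | w) hv hw h
    · rfl
    · exact absurd hw key'
    · exact absurd (hD.inj _ _ ho (key w hw).2 h).symm (key w hw).1
    · exact absurd hv key'
    · exact absurd hv key'
    · exact absurd hv key'
    · exact absurd (hD.inj _ _ (key v hv).2 ho h) (key v hv).1
    · exact absurd hw key'
    · exact congrArg (fun v => some (some v)) (hD.inj _ _ (key v hv).2 (key w hw).2 h)

theorem Lbl.two (hD : Lbl D ℓ) {o p : V} (ho : D.type o = .boundary) (hp : D.type p = .boundary)
    (hop : o ≠ p) (c : Color) (k : ZMod 4) (c' : Color) (k' : ZMod 4) :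
    Lbl (D.gateTwo o p c k c' k') (fun v => v.elim (ℓ p) fun v => v.elim (ℓ o) ℓ) := by
  have key : ∀ v, (D.gateTwo o p c k c' k').type (some (some v)) = .boundary →
      v ≠ o ∧ v ≠ p ∧ D.type v = .boundary := by
    intro v hv
    by_cases h : v = o
    · subst h; simp [addLeg, addEdge, addNode, retype, hop] at hv
    by_cases h' : v = p
    · subst h'; simp [addLeg, addEdge, addNode, retype] at hv
    · simpa [addLeg, addEdge, addNode, retype, h, h'] using hv
  constructor
  · rintro (_ | _ | v) hv
    · exact degree_addLeg_none _ _ _ _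
    · rw [degree_addLeg_some, if_neg (by simp), degree_addLeg_none]
    · obtain ⟨h, h', hv⟩ := key v hv
      rw [degree_addLeg_some, if_neg (by simpa using h'), degree_addLeg_some, if_neg h,
        degree_addEdge, if_neg h, if_neg h', degree_retype, degree_retype, hD.degree v hv]
  · rintro (_ | _ | v) (_ | _ | w) hv hw h
    · rfl
    · exact absurd (hD.inj _ _ hp ho h).symm hop
    · exact absurd (hD.inj _ _ hp (key w hw).2.2 h).symm (key w hw).2.1
    · exact absurd (hD.inj _ _ ho hp h) hop
    · rfl
    · exact absurd (hD.inj _ _ ho (key w hw).2.2 h).symm (key w hw).1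
    · exact absurd (hD.inj _ _ (key v hv).2.2 hp h) (key v hv).2.1
    · exact absurd (hD.inj _ _ (key v hv).2.2 ho h) (key v hv).1
    · exact congrArg (fun v => some (some v)) (hD.inj _ _ (key v hv).2.2 (key w hw).2.2 h)

theorem Lbl.wire (hD : Lbl D ℓ) {t : NodeType} (k : ZMod 4) {l₀ l₁ : L} (h₀ : l₀ ∉ bl D ℓ)
    (h₁ : t = .boundary → l₁ ∉ bl D ℓ ∧ l₁ ≠ l₀) :
    Lbl (D.gateWire t k) (fun v => v.elim l₀ fun v => v.elim l₁ ℓ) := by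
  constructor
  · rintro (_ | _ | v) hv
    · exact degree_addLeg_none _ _ _ _
    · rw [degree_addLeg_some, if_pos rfl, degree_addNode_none]
    · rw [degree_addLeg_some, if_neg (by simp), degree_addNode_some, hD.degree v hv]
  · rintro (_ | _ | v) (_ | _ | w) hv hw h
    · rfl
    · exact absurd h.symm (h₁ hw).2
    · exact absurd ⟨w, hw, h.symm⟩ h₀
    · exact absurd h (h₁ hv).2
    · rfl
    · exact absurd ⟨w, hw, h.symm⟩ (h₁ hv).1
    · exact absurd ⟨v, hv, h⟩ h₀
    · exact absurd ⟨v, hv, h⟩ (h₁ hw).1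
    · exact congrArg (fun v => some (some v)) (hD.inj _ _ hv hw h)

theorem Lbl.addNode (hD : Lbl D ℓ) (c : Color) (k : ZMod 4) (l₁ : L) :
    Lbl (D.addNode (.spider c) k) (fun v => v.elim l₁ ℓ) := by
  constructor
  · rintro (_ | v) hv
    · cases hv
    · rw [degree_addNode_some, hD.degree v hv]
  · rintro (_ | v) (_ | w) hv hw h
    · rfl
    · cases hv
    · cases hw
    · exact congrArg some (hD.inj _ _ hv hw h)

end lbl

theorem bl_relabel {L' : Type} (D : ZXDiagram V E) (ℓ : V → L) (ρ : L → L') :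
    bl D (ρ ∘ ℓ) = ρ '' bl D ℓ := by
  ext l
  simp [bl]

theorem bl_meas [Fintype E] {D : ZXDiagram V E} {ℓ : V → L} (hD : Lbl D ℓ) {o : V}
    (ho : D.type o = .boundary) (c : Color) (k : ZMod 4) :
    bl (D.retype o (.spider c) k) ℓ = bl D ℓ \ {ℓ o} := by
  ext l
  simp only [bl, retype, Set.mem_ofPred_eq, Set.mem_sdiff, Set.mem_singleton_iff]
  constructor
  · rintro ⟨v, hv, rfl⟩
    by_cases h : v = o
    · subst h; simp at hv
    · rw [Function.update_of_ne h] at hv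
      exact ⟨⟨v, hv, rfl⟩, fun h' => h (hD.inj _ _ hv ho h')⟩
  · rintro ⟨⟨v, hv, rfl⟩, h⟩
    have : v ≠ o := fun h' => h (by rw [h'])
    exact ⟨v, by rwa [Function.update_of_ne this], rfl⟩

theorem bl_one (D : ZXDiagram V E) (ℓ : V → L) {o : V} (ho : D.type o = .boundary) {t : NodeType}
    (ht : t ≠ .boundary) (k : ZMod 4) :
    bl (D.gateOne o t k) (fun v => v.elim (ℓ o) ℓ) = bl D ℓ := by
  ext l
  simp only [bl, Set.mem_ofPred_eq, Option.exists, addLeg, addEdge, addNode, retype, Option.elim_none,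
    Option.elim_some, true_and]
  constructor
  · rintro (rfl | ⟨v, hv, rfl⟩)
    · exact ⟨o, ho, rfl⟩
    · by_cases h : v = o
      · subst h; simp [ht] at hv
      · exact ⟨v, by simpa [h] using hv, rfl⟩
  · rintro ⟨v, hv, rfl⟩
    by_cases h : v = o
    · exact .inl (by rw [h])
    · exact .inr ⟨v, by simpa [h] using hv, rfl⟩

theorem bl_leaf (D : ZXDiagram V E) (ℓ : V → L) {o : V} (ho : D.type o = .boundary) (c : Color)
    (k : ZMod 4) (c' : Color) (k' : ZMod 4) :
    bl (D.gateLeaf o c k c' k') (fun v => v.elim (ℓ o) fun v => v.elim (ℓ o) ℓ) = bl D ℓ := by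
  rw [← bl_one D ℓ ho (t := .spider c) (by simp) k]
  ext l
  simp [bl, Option.exists, addLeg, addEdge, addNode, retype]

theorem bl_two (D : ZXDiagram V E) (ℓ : V → L) {o p : V} (ho : D.type o = .boundary)
    (hp : D.type p = .boundary) (hop : o ≠ p) (c : Color) (k : ZMod 4) (c' : Color) (k' : ZMod 4) :
    bl (D.gateTwo o p c k c' k') (fun v => v.elim (ℓ p) fun v => v.elim (ℓ o) ℓ) = bl D ℓ := by
  ext l
  simp only [bl, Set.mem_ofPred_eq, Option.exists, addLeg, addEdge, addNode, retype, Option.elim_none,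
    Option.elim_some, true_and]
  constructor
  · rintro (rfl | rfl | ⟨v, hv, rfl⟩)
    · exact ⟨p, hp, rfl⟩
    · exact ⟨o, ho, rfl⟩
    · by_cases h : v = o
      · subst h; simp [hop] at hv
      by_cases h' : v = p
      · subst h'; simp at hv
      exact ⟨v, by simpa [h, h'] using hv, rfl⟩
  · rintro ⟨v, hv, rfl⟩
    by_cases h : v = o
    · exact .inr (.inl (by rw [h]))
    by_cases h' : v = p
    · exact .inl (by rw [h'])
    · exact .inr (.inr ⟨v, by simpa [h, h'] using hv, rfl⟩)

theorem bl_wire_spider (D : ZXDiagram V E) (ℓ : V → L) (c : Color) (k : ZMod 4) (l₀ l₁ : L) :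
    bl (D.gateWire (.spider c) k) (fun v => v.elim l₀ fun v => v.elim l₁ ℓ) =
      insert l₀ (bl D ℓ) := by
  ext l
  simp [bl, Option.exists, addLeg, addEdge, addNode, eq_comm (a := l)]

theorem bl_wire_boundary (D : ZXDiagram V E) (ℓ : V → L) (k : ZMod 4) (l₀ l₁ : L) :
    bl (D.gateWire .boundary k) (fun v => v.elim l₀ fun v => v.elim l₁ ℓ) =
      insert l₀ (insert l₁ (bl D ℓ)) := by
  ext l
  simp [bl, Option.exists, addLeg, addEdge, addNode, eq_comm (a := l)]

theorem bl_addNode (D : ZXDiagram V E) (ℓ : V → L) (c : Color) (k : ZMod 4) (l₁ : L) :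
    bl (D.addNode (.spider c) k) (fun v => v.elim l₁ ℓ) = bl D ℓ := by
  ext l
  simp [bl, Option.exists, addNode]

/-- A circuit whose inputs and outputs are the boundary vertices with labels in `In` and `Out`. -/
structure Circ (In Out : Set L) [Fintype E] (C : ZXDiagram V E) (ℓ : V → L) : Prop extends
    Lbl C ℓ where
  circuit : IsCircuit C {v | C.type v = .boundary ∧ ℓ v ∈ In} {v | C.type v = .boundary ∧ ℓ v ∈ Out}

section circ

variable {In Out : Set L} [Fintype E] {C : ZXDiagram V E} {ℓ : V → L}

theorem Circ.relabel {L' : Type} (hC : Circ In Out C ℓ) {ρ : L → L'} (hρ : Function.Injective ρ)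
    {In' Out' : Set L'} (hI : ∀ l, ρ l ∈ In' ↔ l ∈ In) (hO : ∀ l, ρ l ∈ Out' ↔ l ∈ Out) :
    Circ In' Out' C (ρ ∘ ℓ) := by
  refine ⟨hC.toLbl.relabel hρ, ?_⟩
  simp only [Function.comp, hI, hO]
  exact hC.circuit

theorem Circ.meas (hC : Circ In Out C ℓ) {o : V} (ho : C.type o = .boundary) (hI : ℓ o ∉ In)
    (hO : ℓ o ∈ Out) (c : Color) : Circ In Out (C.retype o (.spider c) 0) ℓ := by
  refine ⟨hC.toLbl.meas o c 0, ?_⟩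
  have mem : o ∈ {v | C.type v = .boundary ∧ ℓ v ∈ Out} := ⟨ho, hO⟩
  convert IsCircuit.meas c o mem hC.circuit using 1
  · ext v
    by_cases h : v = o
    · subst h; simp [retype, hI]
    · simp [retype, h]
  · ext v
    by_cases h : v = o
    · subst h; simp [retype]
    · simp [retype, h]

theorem Circ.one (hC : Circ In Out C ℓ) {o : V} (ho : C.type o = .boundary) (hI : ℓ o ∉ In)
    (hO : ℓ o ∈ Out) {t : NodeType} (ht : t ≠ .boundary) (k : ZMod 4) (hk : t = .hadamard → k = 0) :
    Circ In Out (C.gateOne o t k) (fun v => v.elim (ℓ o) ℓ) := by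
  refine ⟨hC.toLbl.one ho ht k, ?_⟩
  have hgate : IsCircuit (C.gateOne o t k) (some '' {v | C.type v = .boundary ∧ ℓ v ∈ In})
      (insert none (some '' ({v | C.type v = .boundary ∧ ℓ v ∈ Out} \ {o}))) := by
    cases t with
    | spider c => exact IsCircuit.rotation c k o ⟨ho, hO⟩ hC.circuit
    | hadamard =>
      rw [hk rfl]
      exact IsCircuit.hadamard o ⟨ho, hO⟩ hC.circuit
    | boundary => exact absurd rfl ht
  convert hgate using 1
  · ext v
    rcases v with _ | v
    · simp [hI]
    · by_cases h : v = o
      · subst h; simp [hI]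
      · simp [addLeg, addEdge, addNode, retype, h]
  · ext v
    rcases v with _ | v
    · simp [addLeg, addEdge, addNode, hO]
    · by_cases h : v = o
      · subst h; simp [addLeg, addEdge, addNode, retype, ht]
      · simp [addLeg, addEdge, addNode, retype, h]

theorem Circ.leaf (hC : Circ In Out C ℓ) {o : V} (ho : C.type o = .boundary) (hI : ℓ o ∉ In)
    (hO : ℓ o ∈ Out) (c : Color) :
    Circ In Out (C.gateLeaf o c 0 c.opp 0) (fun v => v.elim (ℓ o) fun v => v.elim (ℓ o) ℓ) := by
  refine ⟨hC.toLbl.leaf ho c 0 c.opp 0, ?_⟩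
  have mem : o ∈ {v | C.type v = .boundary ∧ ℓ v ∈ Out} := ⟨ho, hO⟩
  convert IsCircuit.measPauli₁ c o mem hC.circuit using 1
  · ext v
    rcases v with _ | _ | v
    · simp [hI]
    · simp [hI]
    · by_cases h : v = o
      · subst h; simp [hI]
      · simp [addLeg, addEdge, addNode, retype, h]
  · ext v
    rcases v with _ | _ | v
    · simp [addLeg, addEdge, addNode, hO]
    · simp [addLeg, addEdge, addNode]
    · by_cases h : v = o
      · subst h; simp [addLeg, addEdge, addNode, retype]
      · simp [addLeg, addEdge, addNode, retype, h]

/-- The admissible colour pairs are `ZZ`, `XX`, and control `Z` with target `X`. The remaining pair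
is a CNOT with its qubits listed in the other order. -/
theorem Circ.two (hC : Circ In Out C ℓ) {o p : V} (ho : C.type o = .boundary) (hoI : ℓ o ∉ In)
    (hoO : ℓ o ∈ Out) (hp : C.type p = .boundary) (hpI : ℓ p ∉ In) (hpO : ℓ p ∈ Out) (hop : o ≠ p)
    {c c' : Color} (hc : c = .Z ∨ c' = .X) :
    Circ In Out (C.gateTwo o p c 0 c' 0) (fun v => v.elim (ℓ p) fun v => v.elim (ℓ o) ℓ) := by
  refine ⟨hC.toLbl.two ho hp hop c 0 c' 0, ?_⟩
  have hgate : IsCircuit (C.gateTwo o p c 0 c' 0)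
      ((fun v => some (some v)) '' {v | C.type v = .boundary ∧ ℓ v ∈ In}) ({none, some none} ∪
        (fun v => some (some v)) '' ({v | C.type v = .boundary ∧ ℓ v ∈ Out} \ {o, p})) := by
    have memo : o ∈ {v | C.type v = .boundary ∧ ℓ v ∈ Out} := ⟨ho, hoO⟩
    have memp : p ∈ {v | C.type v = .boundary ∧ ℓ v ∈ Out} := ⟨hp, hpO⟩
    have h₁ := IsCircuit.cnot o p memo memp hop hC.circuit
    have h₂ := fun c => IsCircuit.measPauli₂ c o p memo memp hop hC.circuit
    cases c <;> cases c'
    · exact h₂ .Z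
    · exact h₁
    · simp at hc
    · exact h₂ .X
  convert hgate using 1
  · ext v
    rcases v with _ | _ | v
    · simp [hpI]
    · simp [hoI]
    · by_cases h : v = o
      · subst h; simp [hoI]
      · by_cases h' : v = p
        · subst h'; simp [hpI]
        · simp [addLeg, addEdge, addNode, retype, h, h']
  · ext v
    rcases v with _ | _ | v
    · simp [addLeg, addEdge, addNode, hpO]
    · simp [addLeg, addEdge, addNode, hoO]
    · by_cases h : v = o
      · subst h; simp [addLeg, addEdge, addNode, retype, hop]
      · by_cases h' : v = p
        · subst h'; simp [addLeg, addEdge, addNode, retype]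
        · simp [addLeg, addEdge, addNode, retype, h, h']

theorem Circ.prep (hC : Circ In Out C ℓ) {l₀ : L} (h₀ : l₀ ∉ bl C ℓ) (hI : l₀ ∉ In)
    (hO : l₀ ∈ Out) (l₁ : L) (c : Color) :
    Circ In Out (C.gateWire (.spider c) 0) (fun v => v.elim l₀ fun v => v.elim l₁ ℓ) := by
  refine ⟨hC.toLbl.wire 0 h₀ (by simp), ?_⟩
  convert IsCircuit.prep c hC.circuit using 1
  · ext v
    rcases v with _ | _ | v <;> simp [addLeg, addEdge, addNode, hI]
  · ext v
    rcases v with _ | _ | v <;> simp [addLeg, addEdge, addNode, hO]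

theorem Circ.input (hC : Circ In Out C ℓ) {l₀ l₁ : L} (h₀ : l₀ ∉ bl C ℓ) (h₁ : l₁ ∉ bl C ℓ)
    (hI : l₀ ∉ In) (hO : l₀ ∈ Out) (hI₁ : l₁ ∈ In) (hO₁ : l₁ ∉ Out) :
    Circ In Out (C.gateWire .boundary 0) (fun v => v.elim l₀ fun v => v.elim l₁ ℓ) := by
  refine ⟨hC.toLbl.wire 0 h₀ fun _ => ⟨h₁, fun h => hI (h ▸ hI₁)⟩, ?_⟩
  convert IsCircuit.input hC.circuit using 1
  · ext v
    rcases v with _ | _ | v <;> simp [addLeg, addEdge, addNode, hI, hI₁]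
  · ext v
    rcases v with _ | _ | v <;> simp [addLeg, addEdge, addNode, hO, hO₁]

end circ

end gates


/-! # Errors of gates -/

section simgates

variable {V E V' E' L : Type} [Fintype V] [Fintype E] [Fintype V'] [Fintype E']
  {D : ZXDiagram V E} {ℓ : V → L} {C : ZXDiagram V' E'} {ℓ' : V' → L}

theorem Pauli.wt_zero : Pauli.wt (false, false) = 0 := if_pos rfl

/-- Without a flip between the spiders fusion is exact. This is the direction in which a phase is
split off: the new edge stays free of errors. -/
theorem sum_outVal_outVal_zero (c : Color) (k₀ k : ZMod 4) (n : Pauli) (m : Multiset Bool) (b : Bool) :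
    ∑ a, outVal (.spider c) k₀ false m (false, false) a * outVal (.spider c) k false {a} n b =
      outVal (.spider c) (k₀ + k) false m n b := by
  have := sum_bas_pair c false false (m.map (bas c false)).prod
    (iexp k₀ * (m.map (bas c true)).prod) (n.glob c * bas c (n.opp c) b)
    (n.glob c * (iexp k * sgn (n.same c) * bas c (!n.opp c) b))
  rw [if_pos rfl] at this
  rw [outVal_spider, iexp_add]
  refine Eq.trans (Finset.sum_congr rfl fun a _ => ?_) (this.trans ?_)
  · rw [outVal_spider, outVal_spider]
    have h3 : Pauli.glob c (false, false) = 1 := by cases c <;> simp [Pauli.glob, sgn]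
    have h4 : Pauli.same c (false, false) = false := by cases c <;> rfl
    have h5 : Pauli.opp c (false, false) = false := by cases c <;> rfl
    simp only [h3, h4, h5, Multiset.map_singleton, Multiset.prod_singleton, Bool.not_false]
    rw [show sgn false = 1 from rfl]
    ring
  · ring

/-- Apply the matrix `W` to the labels `l` and `l'`. -/
noncomputable def op₂ (W : Bool → Bool → Bool → Bool → ℂ) (l l' : L) (F : (L → Bool) → ℂ)
    (β : L → Bool) : ℂ :=
  ∑ γ, ∑ δ, W γ δ (β l) (β l') * F (Function.update (Function.update β l γ) l' δ)

theorem op_op₂_left (N : Bool → Bool → ℂ) (W : Bool → Bool → Bool → Bool → ℂ) {l l' : L}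
    (h : l ≠ l') (F : (L → Bool) → ℂ) (β : L → Bool) :
    op N l (op₂ W l l' F) β = op₂ (fun γ δ x y => ∑ a, W γ δ a y * N a x) l l' F β := by
  simp only [op, op₂, Function.update_self, Function.update_of_ne h.symm, Function.update_idem,
    Fintype.sum_bool]
  ring

theorem op_op₂_right (N : Bool → Bool → ℂ) (W : Bool → Bool → Bool → Bool → ℂ) {l l' : L}
    (h : l ≠ l') (F : (L → Bool) → ℂ) (β : L → Bool) :
    op N l' (op₂ W l l' F) β = op₂ (fun γ δ x y => ∑ a, W γ δ x a * N a y) l l' F β := by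
  have e : ∀ a γ δ, Function.update (Function.update (Function.update β l' a) l γ) l' δ =
      Function.update (Function.update β l γ) l' δ := by
    intro a γ δ
    rw [Function.update_comm h.symm, Function.update_idem]
  simp only [op, op₂, Function.update_self, Function.update_of_ne h, e, Fintype.sum_bool]
  ring

theorem op₂_smul {M N : Bool → Bool → Bool → Bool → ℂ} {s : ℂ}
    (h : ∀ γ δ x y, M γ δ x y = s * N γ δ x y) (l l' : L)
    (F : (L → Bool) → ℂ) (β : L → Bool) : op₂ M l l' F β = s * op₂ N l l' F β := by
  simp only [op₂, h, Finset.mul_sum, mul_assoc]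

theorem op₂_congr_smul (M : Bool → Bool → Bool → Bool → ℂ) (l l' : L) {F G : (L → Bool) → ℂ} {s : ℂ}
    (h : ∀ β, F β = s * G β) (β : L → Bool) : op₂ M l l' F β = s * op₂ M l l' G β := by
  simp only [op₂, h, Finset.mul_sum]
  exact Finset.sum_congr rfl fun _ _ => Finset.sum_congr rfl fun _ _ => by ring

/-- The matrix of two joined spiders, with flips on the edge between them and the outgoing legs. -/
noncomputable def twoVal (c : Color) (k : ZMod 4) (c' : Color) (k' : ZMod 4) (n n' n'' : Pauli)
    (γ δ x y : Bool) : ℂ :=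
  ∑ a, ∑ a', edgeMat n a a' * outVal (.spider c) k false {a, γ} n' x *
    outVal (.spider c') k' false {a', δ} n'' y

theorem Lbl.interpL_meas' (hD : Lbl D ℓ) {o : V} {l : L} (ho : D.type o = .boundary) (hl : ℓ o = l)
    (c : Color) (k : ZMod 4) (ε : E → Pauli) (β : L → Bool) :
    interpL (D.retype o (.spider c) k) ℓ ε β =
      op (fun γ _ => spiderVal c k {γ}) l (interpL D ℓ ε) β := by
  subst hl
  exact hD.interpL_meas ho c k ε β

theorem Lbl.interpL_one' (hD : Lbl D ℓ) {o : V} {l : L} (ho : D.type o = .boundary) (hl : ℓ o = l)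
    {t : NodeType} (ht : t ≠ .boundary) (k : ZMod 4) (ε : Option E → Pauli) (β : L → Bool) :
    interpL (D.gateOne o t k) (fun v => v.elim l ℓ) ε β =
      op (fun γ b => outVal t k false {γ} (ε none) b) l (interpL D ℓ fun e => ε (some e)) β := by
  subst hl
  exact hD.interpL_one ho ht k ε β

theorem Lbl.interpL_leaf' (hD : Lbl D ℓ) {o : V} {l : L} (ho : D.type o = .boundary) (hl : ℓ o = l)
    (c : Color) (k : ZMod 4) (c' : Color) (k' : ZMod 4) (ε : Option (Option E) → Pauli)
    (β : L → Bool) :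
    interpL (D.gateLeaf o c k c' k') (fun v => v.elim l fun v => v.elim l ℓ) ε β =
      op (leafVal c k c' k' (ε (some none)) (ε none)) l
        (interpL D ℓ fun e => ε (some (some e))) β := by
  subst hl
  exact hD.interpL_leaf ho c k c' k' ε β

theorem Lbl.interpL_two' (hD : Lbl D ℓ) {o p : V} {l l' : L} (ho : D.type o = .boundary)
    (hl : ℓ o = l) (hp : D.type p = .boundary) (hl' : ℓ p = l') (hop : o ≠ p)
    (c : Color) (k : ZMod 4) (c' : Color) (k' : ZMod 4)
    (ε : Option (Option (Option E)) → Pauli) (β : L → Bool) :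
    interpL (D.gateTwo o p c k c' k') (fun v => v.elim l' fun v => v.elim l ℓ) ε β =
      op₂ (twoVal c k c' k' (ε (some (some none))) (ε (some none)) (ε none)) l l'
        (interpL D ℓ fun e => ε (some (some (some e)))) β := by
  subst hl hl'
  exact hD.interpL_two ho hp hop c k c' k' ε β

/-! ### Congruence -/

/-- A gate is a linear operator on the labelled tensor, so simulation passes through it. In the
following congruences the flips on the edges of the gate itself are copied. -/
theorem Sim.meas (h : Sim D ℓ C ℓ') (hD : Lbl D ℓ) (hC : Lbl C ℓ') {o : V} {o' : V'} {l : L}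
    (ho : D.type o = .boundary) (ho' : C.type o' = .boundary) (hl : ℓ o = l) (hl' : ℓ' o' = l)
    (c : Color) (k : ZMod 4) :
    Sim (D.retype o (.spider c) k) ℓ (C.retype o' (.spider c) k) ℓ' := by
  intro ε
  obtain ⟨ε', hw, s, hs, e⟩ := h ε
  refine ⟨ε', hw, s, hs, fun β => ?_⟩
  rw [hD.interpL_meas' ho hl, hC.interpL_meas' ho' hl', op_congr_smul _ _ e]

theorem Sim.one (h : Sim D ℓ C ℓ') (hD : Lbl D ℓ) (hC : Lbl C ℓ') {o : V} {o' : V'} {l : L}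
    (ho : D.type o = .boundary) (ho' : C.type o' = .boundary) (hl : ℓ o = l) (hl' : ℓ' o' = l)
    {t : NodeType} (ht : t ≠ .boundary) (k : ZMod 4) :
    Sim (D.gateOne o t k) (fun v => v.elim l ℓ) (C.gateOne o' t k) (fun v => v.elim l ℓ') := by
  intro ε
  obtain ⟨ε', hw, s, hs, e⟩ := h fun e => ε (some e)
  refine ⟨fun e => e.elim (ε none) ε', ?_, s, hs, fun β => ?_⟩
  · rw [wt_option, wt_option ε]
    exact Nat.add_le_add_left hw _
  · rw [hD.interpL_one' ho hl ht, hC.interpL_one' ho' hl' ht, op_congr_smul _ _ e]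
    rfl

theorem Sim.leaf (h : Sim D ℓ C ℓ') (hD : Lbl D ℓ) (hC : Lbl C ℓ') {o : V} {o' : V'} {l : L}
    (ho : D.type o = .boundary) (ho' : C.type o' = .boundary) (hl : ℓ o = l) (hl' : ℓ' o' = l)
    (c : Color) (k : ZMod 4) (c' : Color) (k' : ZMod 4) :
    Sim (D.gateLeaf o c k c' k') (fun v => v.elim l fun v => v.elim l ℓ)
      (C.gateLeaf o' c k c' k') (fun v => v.elim l fun v => v.elim l ℓ') := by
  intro ε
  obtain ⟨ε', hw, s, hs, e⟩ := h fun e => ε (some (some e))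
  refine ⟨fun e => e.elim (ε none) fun e => e.elim (ε (some none)) ε', ?_, s, hs, fun β => ?_⟩
  · rw [wt_option, wt_option ε, wt_option, wt_option fun e => ε (some e)]
    exact Nat.add_le_add_left (Nat.add_le_add_left hw _) _
  · rw [hD.interpL_leaf' ho hl, hC.interpL_leaf' ho' hl', op_congr_smul _ _ e]
    rfl

theorem Sim.two (h : Sim D ℓ C ℓ') (hD : Lbl D ℓ) (hC : Lbl C ℓ') {o p : V} {o' p' : V'} {l m : L}
    (ho : D.type o = .boundary) (ho' : C.type o' = .boundary) (hl : ℓ o = l) (hl' : ℓ' o' = l)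
    (hp : D.type p = .boundary) (hp' : C.type p' = .boundary) (hm : ℓ p = m) (hm' : ℓ' p' = m)
    (hlm : l ≠ m) (c : Color) (k : ZMod 4) (c' : Color) (k' : ZMod 4) :
    Sim (D.gateTwo o p c k c' k') (fun v => v.elim m fun v => v.elim l ℓ)
      (C.gateTwo o' p' c k c' k') (fun v => v.elim m fun v => v.elim l ℓ') := by
  have hop : o ≠ p := fun h => hlm (by rw [← hl, ← hm, h])
  have hop' : o' ≠ p' := fun h => hlm (by rw [← hl', ← hm', h])
  intro ε
  obtain ⟨ε', hw, s, hs, e⟩ := h fun e => ε (some (some (some e)))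
  refine ⟨fun e => e.elim (ε none) fun e => e.elim (ε (some none)) fun e =>
    e.elim (ε (some (some none))) ε', ?_, s, hs, fun β => ?_⟩
  · rw [wt_option, wt_option ε, wt_option, wt_option fun e => ε (some e), wt_option,
      wt_option fun e => ε (some (some e))]
    exact Nat.add_le_add_left (Nat.add_le_add_left (Nat.add_le_add_left hw _) _) _
  · rw [hD.interpL_two' ho hl hp hm hop, hC.interpL_two' ho' hl' hp' hm' hop',
      op₂_congr_smul _ _ _ e]
    rfl

theorem Sim.wire (h : Sim D ℓ C ℓ') (l₀ l₁ : L) (t : NodeType) (k : ZMod 4) :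
    Sim (D.gateWire t k) (fun v => v.elim l₀ fun v => v.elim l₁ ℓ)
      (C.gateWire t k) (fun v => v.elim l₀ fun v => v.elim l₁ ℓ') := by
  intro ε
  obtain ⟨ε', hw, s, hs, e⟩ := h fun e => ε (some e)
  refine ⟨fun e => e.elim (ε none) ε', ?_, s, hs, fun β => ?_⟩
  · rw [wt_option, wt_option ε]
    exact Nat.add_le_add_left hw _
  · rw [interpL_wire, interpL_wire, e]
    exact mul_left_comm _ _ _

theorem FaultEquiv.addNode (D : ZXDiagram V E) (ℓ : V → L) (c : Color) {k : ZMod 4} (hk : k ≠ 2)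
    (l₁ : L) : FaultEquiv (D.addNode (.spider c) k) (fun v => v.elim l₁ ℓ) D ℓ := by
  have key : ∀ ε β, interpL (D.addNode (.spider c) k) (fun v => v.elim l₁ ℓ) ε β =
      (1 + iexp k) * interpL D ℓ ε β := by
    intro ε β
    rw [interpL_addNode]
    simp [nodeVal, spiderVal_eq]
  have h0 := one_add_iexp_ne_zero hk
  refine ⟨fun ε => ⟨ε, le_rfl, _, h0, key ε⟩, fun ε => ⟨ε, le_rfl, _, inv_ne_zero h0, fun β => ?_⟩⟩
  rw [key, inv_mul_cancel_left₀ h0]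

/-! ### Moving phases -/

/-- A preparation with a phase is a phase-free preparation followed by a rotation; a flip between
the two moves to the outgoing edge. -/
theorem FaultEquiv.wire_phase (hD : Lbl D ℓ) {l₀ : L} (h₀ : l₀ ∉ bl D ℓ) (l₁ : L) (c : Color)
    (k : ZMod 4) :
    FaultEquiv (D.gateWire (.spider c) k) (fun v => v.elim l₀ fun v => v.elim l₁ ℓ)
      ((D.gateWire (.spider c) 0).gateOne none (.spider c) k)
      (fun v => v.elim l₀ fun v => v.elim l₀ fun v => v.elim l₁ ℓ) := by
  have hL : Lbl (D.gateWire (.spider c) 0) (fun v => v.elim l₀ fun v => v.elim l₁ ℓ) :=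
    hD.wire 0 h₀ (by simp)
  have hb : (D.gateWire (.spider c) 0).type none = .boundary := rfl
  have key : ∀ ε β, interpL ((D.gateWire (.spider c) 0).gateOne none (.spider c) k)
      (fun v => v.elim l₀ fun v => v.elim l₀ fun v => v.elim l₁ ℓ) ε β =
      (∑ a, outVal (.spider c) 0 false 0 (ε (some none)) a *
        outVal (.spider c) k false {a} (ε none) (β l₀)) *
      interpL D ℓ (fun e => ε (some (some e))) β := by
    intro ε β
    rw [hL.interpL_one' (l := l₀) hb rfl NodeType.noConfusion]
    simp only [op, interpL_wire, Function.update_self, Finset.sum_mul]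
    refine Finset.sum_congr rfl fun a _ => ?_
    have : interpL D ℓ (fun e => ε (some (some e))) (Function.update β l₀ a) =
        interpL D ℓ (fun e => ε (some (some e))) β := interpL_congr fun v hv => by
      rw [Function.update_of_ne]
      exact fun h => h₀ ⟨v, hv, h⟩
    rw [this]
    have h2 : ∀ b, outVal (.spider c) 0 b 0 = outVal (.spider c) 0 false 0 := fun _ => rfl
    rw [h2]
    ring
  constructor
  · intro ε
    refine ⟨fun e => e.elim (ε none) fun e => e.elim (false, false) fun e => ε (some e), ?_, 1,
      one_ne_zero, fun β => ?_⟩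
    · rw [wt_option, wt_option ε, wt_option]
      simp only [Option.elim_none, Option.elim_some, Pauli.wt_zero]
      omega
    · rw [key, interpL_wire, one_mul]
      refine congrArg (· * _) ?_
      have := sum_outVal_outVal_zero c 0 k (ε none) 0 (β l₀)
      rw [zero_add] at this
      exact this.symm
  · intro ε
    obtain ⟨r, hr, s, hs, h⟩ := sum_outVal_outVal c 0 k (ε (some none)) (ε none)
    refine ⟨fun e => e.elim r fun e => ε (some (some e)), ?_, s, hs, fun β => ?_⟩
    · rw [wt_option, wt_option ε, wt_option fun e => ε (some e)]
      have := Pauli.wt_le_add_of_imp hr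
      simp only [Option.elim_none, Option.elim_some]
      omega
    · rw [key, interpL_wire, h, zero_add, mul_assoc]
      rfl

/-- The rotation precedes the measurement, so there is no outgoing edge to take a flip between them.
It is moved in front of the rotation instead and absorbed by the edge that ended at `o`. -/
theorem FaultEquiv.meas_phase (hD : Lbl D ℓ) {o : V} {l : L} (ho : D.type o = .boundary)
    (hl : ℓ o = l) (c : Color) (k : ZMod 4) :
    FaultEquiv (D.retype o (.spider c) k) ℓ
      ((D.gateOne o (.spider c) k).retype none (.spider c) 0) (fun v => v.elim l ℓ) := by
  have hL : Lbl (D.gateOne o (.spider c) k) (fun v => v.elim l ℓ) := by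
    subst hl; exact hD.one ho NodeType.noConfusion k
  have hb : (D.gateOne o (.spider c) k).type none = .boundary := rfl
  have key : ∀ ε β, interpL ((D.gateOne o (.spider c) k).retype none (.spider c) 0)
      (fun v => v.elim l ℓ) ε β = op (fun δ _ => ∑ γ, outVal (.spider c) k false {δ} (ε none) γ *
        spiderVal c 0 {γ}) l (interpL D ℓ fun e => ε (some e)) β := by
    intro ε β
    rw [hL.interpL_meas' hb rfl, ← op_op]
    exact congrArg (fun F => op _ l F β) (funext fun β => hD.interpL_one' ho hl NodeType.noConfusion k ε β)
  constructor
  · intro ε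
    refine ⟨fun e => e.elim (false, false) ε, ?_, 1, one_ne_zero, fun β => ?_⟩
    · rw [wt_option]
      simp [Pauli.wt_zero]
    · rw [key, hD.interpL_meas' ho hl, one_mul]
      refine congrArg (fun M => op M l (interpL D ℓ ε) β) (funext fun γ => funext fun _ => ?_)
      have hbas := sum_bas_pair c false false (bas c false γ) (iexp k * bas c true γ) 1 1
      rw [if_pos rfl] at hbas
      have h3 : Pauli.glob c (false, false) = 1 := by cases c <;> simp [Pauli.glob, sgn]
      have h4 : Pauli.same c (false, false) = false := by cases c <;> rfl
      have h5 : Pauli.opp c (false, false) = false := by cases c <;> rfl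
      simp only [Option.elim_none, outVal_spider, spiderVal_eq, h3, h4, h5, iexp_zero,
        Multiset.map_singleton, Multiset.prod_singleton] at hbas ⊢
      rw [show sgn false = 1 from rfl]
      simp only [Bool.not_false, one_mul, mul_one] at hbas ⊢
      rw [← hbas]
      exact Finset.sum_congr rfl fun a _ => by ring
  · intro ε
    obtain ⟨r, hr, s, hs, h⟩ := sum_outVal_spiderVal c k (ε none)
    obtain ⟨ε', hw, s', hs', h'⟩ := hD.exists_flip ho r fun e => ε (some e)
    refine ⟨ε', ?_, s * s', mul_ne_zero hs hs', fun β => ?_⟩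
    · rw [wt_option ε]
      have := Pauli.wt_le_of_imp hr
      omega
    · rw [key, hD.interpL_meas' ho hl, op_smul (fun γ _ => h γ), mul_assoc, ← op_congr_smul _ _ h',
        hl, op_op]

/-- By fusion. A flip on the leg that disappears moves to the outgoing edge; in the other direction
that leg is left free of errors. -/
theorem FaultEquiv.leaf_same (hD : Lbl D ℓ) {o : V} {l : L} (ho : D.type o = .boundary)
    (hl : ℓ o = l) (c : Color) (k k' : ZMod 4) :
    FaultEquiv (D.gateLeaf o c k c k') (fun v => v.elim l fun v => v.elim l ℓ)
      (D.gateOne o (.spider c) (k + k')) (fun v => v.elim l ℓ) := by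
  have key : ∀ ε r s, (∀ γ b, leafVal c k c k' (ε (some none)) (ε none) γ b =
        s * outVal (.spider c) (k + k') false {γ} r b) → ∀ β,
      interpL (D.gateLeaf o c k c k') (fun v => v.elim l fun v => v.elim l ℓ) ε β =
      s * interpL (D.gateOne o (.spider c) (k + k')) (fun v => v.elim l ℓ)
        (fun e => e.elim r fun e => ε (some (some e))) β := by
    intro ε r s h β
    rw [hD.interpL_leaf' ho hl, hD.interpL_one' ho hl NodeType.noConfusion, op_smul h]
    rfl
  constructor
  · intro ε
    obtain ⟨r, hr, s, hs, h⟩ := leafVal_same c k k' (ε (some none)) (ε none)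
    refine ⟨fun e => e.elim r fun e => ε (some (some e)), ?_, s, hs, key ε r s h⟩
    rw [wt_option, wt_option ε, wt_option fun e => ε (some e)]
    have := Pauli.wt_le_add_of_imp hr
    simp only [Option.elim_none, Option.elim_some]
    omega
  · intro ε
    obtain ⟨s₀, hs₀, h₀⟩ := sum_edgeMat_spiderVal c k' (false, false)
    have h4 : Pauli.same c (false, false) = false := by cases c <;> rfl
    have h5 : Pauli.opp c (false, false) = false := by cases c <;> rfl
    have h : ∀ γ b, leafVal c k c k' (false, false) (ε none) γ b =
        s₀ * outVal (.spider c) (k + k') false {γ} (ε none) b := by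
      intro γ b
      rw [leafVal_eq (s := s₀) (p₀ := 1) (p₁ := iexp k'), outVal_spider, iexp_add]
      · simp only [Multiset.map_singleton, Multiset.prod_singleton]
        ring
      · intro p
        rw [h₀, h4, h5, Bool.and_false, Bool.xor_false, show sgn false = 1 from rfl]
        ring
    have := key (fun e => e.elim (ε none) fun e => e.elim (false, false) fun e => ε (some e)) _ s₀ h
    refine ⟨fun e => e.elim (ε none) fun e => e.elim (false, false) fun e => ε (some e), ?_,
      s₀⁻¹, inv_ne_zero hs₀, fun β => ?_⟩
    · rw [wt_option, wt_option ε, wt_option]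
      simp only [Option.elim_none, Option.elim_some, Pauli.wt_zero]
      omega
    · rw [this, inv_mul_cancel_left₀ hs₀]
      congr 1
      funext e
      cases e <;> rfl

/-- Only the description of the one-legged spider changes, so the same flips serve on both sides. -/
theorem FaultEquiv.leaf_odd (hD : Lbl D ℓ) {o : V} {l : L} (ho : D.type o = .boundary)
    (hl : ℓ o = l) (c : Color) (k : ZMod 4) {k' : ZMod 4} (hk : k' = 1 ∨ k' = 3) :
    FaultEquiv (D.gateLeaf o c k c.opp k') (fun v => v.elim l fun v => v.elim l ℓ)
      (D.gateLeaf o c k c (-k')) (fun v => v.elim l fun v => v.elim l ℓ) := by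
  obtain ⟨s, hs, h⟩ := spiderVal_opp c hk
  have key : ∀ ε β, interpL (D.gateLeaf o c k c.opp k') (fun v => v.elim l fun v => v.elim l ℓ) ε β =
      s * interpL (D.gateLeaf o c k c (-k')) (fun v => v.elim l fun v => v.elim l ℓ) ε β := by
    intro ε β
    rw [hD.interpL_leaf' ho hl, hD.interpL_leaf' ho hl, op_smul (s := s)]
    intro γ b
    simp only [leafVal, h, Finset.mul_sum]
    exact Finset.sum_congr rfl fun _ _ => Finset.sum_congr rfl fun _ _ => by ring
  refine ⟨fun ε => ⟨ε, le_rfl, s, hs, key ε⟩, fun ε => ⟨ε, le_rfl, s⁻¹, inv_ne_zero hs, fun β => ?_⟩⟩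
  rw [key, inv_mul_cancel_left₀ hs]

/-- The phase leaves along the outgoing edge of the qubit, while the one-legged spider and its edge
stay as they are. -/
theorem FaultEquiv.leaf_phase (hD : Lbl D ℓ) {o : V} {l : L} (ho : D.type o = .boundary)
    (hl : ℓ o = l) (c : Color) (k : ZMod 4) (c' : Color) (k' : ZMod 4) :
    FaultEquiv (D.gateLeaf o c k c' k') (fun v => v.elim l fun v => v.elim l ℓ)
      ((D.gateLeaf o c 0 c' k').gateOne none (.spider c) k)
      (fun v => v.elim l fun v => v.elim l fun v => v.elim l ℓ) := by
  have hL : Lbl (D.gateLeaf o c 0 c' k') (fun v => v.elim l fun v => v.elim l ℓ) := by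
    subst hl; exact hD.leaf ho c 0 c' k'
  have hb : (D.gateLeaf o c 0 c' k').type none = .boundary := rfl
  have key : ∀ ε β, interpL ((D.gateLeaf o c 0 c' k').gateOne none (.spider c) k)
      (fun v => v.elim l fun v => v.elim l fun v => v.elim l ℓ) ε β =
      op (fun δ b => ∑ γ, leafVal c 0 c' k' (ε (some (some none))) (ε (some none)) δ γ *
        outVal (.spider c) k false {γ} (ε none) b) l
        (interpL D ℓ fun e => ε (some (some (some e)))) β := by
    intro ε β
    rw [hL.interpL_one' (l := l) hb rfl NodeType.noConfusion, ← op_op]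
    exact congrArg (fun F => op _ l F β) (funext fun β => hD.interpL_leaf' ho hl c 0 c' k' _ β)
  have expand : ∀ n n' n'' δ b, ∑ γ, leafVal c 0 c' k' n n' δ γ *
      outVal (.spider c) k false {γ} n'' b = ∑ p, ∑ q, edgeMat n p q * spiderVal c' k' {q} *
      ∑ γ, outVal (.spider c) 0 false {p, δ} n' γ * outVal (.spider c) k false {γ} n'' b := by
    intro n n' n'' δ b
    simp only [leafVal, Fintype.sum_bool]
    ring
  constructor
  · intro ε
    refine ⟨fun e => e.elim (ε none) fun e => e.elim (false, false) fun e => ε (some e), ?_, 1,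
      one_ne_zero, fun β => ?_⟩
    · rw [wt_option, wt_option ε, wt_option]
      simp only [Option.elim_none, Option.elim_some, Pauli.wt_zero]
      omega
    · rw [key, hD.interpL_leaf' ho hl, one_mul]
      refine congrArg (fun M => op M l _ β) (funext fun γ => funext fun b => ?_)
      rw [expand]
      simp only [Option.elim_none, Option.elim_some, sum_outVal_outVal_zero, zero_add]
      rfl
  · intro ε
    obtain ⟨r, hr, s, hs, h⟩ := sum_outVal_outVal c 0 k (ε (some none)) (ε none)
    refine ⟨fun e => e.elim r fun e => ε (some (some e)), ?_, s, hs, fun β => ?_⟩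
    · rw [wt_option, wt_option ε, wt_option fun e => ε (some e)]
      have := Pauli.wt_le_add_of_imp hr
      simp only [Option.elim_none, Option.elim_some]
      omega
    · rw [key, hD.interpL_leaf' ho hl]
      refine op_smul (fun γ b => ?_) _ _ _
      rw [expand]
      simp only [h, zero_add, leafVal, Finset.mul_sum, Option.elim_none, Option.elim_some]
      exact Finset.sum_congr rfl fun _ _ => Finset.sum_congr rfl fun _ _ => by ring

/-- A one-legged spider of phase π projects to the second basis vector. The π-rotations of the
opposite colour exchange the basis vectors and so reduce this to the syndrome-free outcome. -/
theorem FaultEquiv.leaf_pi (hD : Lbl D ℓ) {o : V} {l : L} (ho : D.type o = .boundary)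
    (hl : ℓ o = l) (c : Color) :
    FaultEquiv (D.gateLeaf o c 0 c.opp 2) (fun v => v.elim l fun v => v.elim l ℓ)
      (((D.gateOne o (.spider c.opp) 2).gateLeaf none c 0 c.opp 0).gateOne none (.spider c.opp) 2)
      (fun v => v.elim l fun v => v.elim l fun v => v.elim l fun v => v.elim l ℓ) := by
  have hL : Lbl (D.gateOne o (.spider c.opp) 2) (fun v => v.elim l ℓ) := by
    subst hl; exact hD.one ho NodeType.noConfusion 2
  have hb : (D.gateOne o (.spider c.opp) 2).type none = .boundary := rfl
  have hL' : Lbl ((D.gateOne o (.spider c.opp) 2).gateLeaf none c 0 c.opp 0)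
      (fun v => v.elim l fun v => v.elim l fun v => v.elim l ℓ) := hL.leaf hb c 0 c.opp 0
  have hb' : ((D.gateOne o (.spider c.opp) 2).gateLeaf none c 0 c.opp 0).type none = .boundary := rfl
  have key : ∀ ε β, interpL (((D.gateOne o (.spider c.opp) 2).gateLeaf none c 0 c.opp 0).gateOne
      none (.spider c.opp) 2)
      (fun v => v.elim l fun v => v.elim l fun v => v.elim l fun v => v.elim l ℓ) ε β =
      op (fun γ b => ∑ γ₂, outVal (.spider c.opp) 2 false {γ} (ε (some (some (some none)))) γ₂ *
        ∑ γ₁, leafVal c 0 c.opp 0 (ε (some (some none))) (ε (some none)) γ₂ γ₁ *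
        outVal (.spider c.opp) 2 false {γ₁} (ε none) b) l
        (interpL D ℓ fun e => ε (some (some (some (some e))))) β := by
    intro ε β
    rw [hL'.interpL_one' (l := l) hb' rfl NodeType.noConfusion, ← op_op, ← op_op]
    refine congrArg (fun F => op _ l F β) (funext fun β => ?_)
    rw [hL.interpL_leaf' (l := l) hb rfl]
    exact congrArg (fun F => op _ l F β)
      (funext fun β => hD.interpL_one' ho hl NodeType.noConfusion 2 _ β)
  constructor
  · intro ε
    obtain ⟨s, hs, h⟩ := leafVal_conj_zero c (ε (some none)) (ε none)
    refine ⟨fun e => e.elim (ε none) fun e => e.elim (false, false) fun e => e.elim (ε (some none))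
      fun e => e.elim (false, false) fun e => ε (some (some e)), ?_, s⁻¹, inv_ne_zero hs,
      fun β => ?_⟩
    · rw [wt_option, wt_option ε, wt_option, wt_option fun e => ε (some e), wt_option, wt_option]
      simp only [Option.elim_none, Option.elim_some, Pauli.wt_zero]
      omega
    · rw [key, hD.interpL_leaf' ho hl, eq_inv_mul_iff_mul_eq₀ hs]
      exact (op_smul h _ _ _).symm
  · intro ε
    obtain ⟨s, hs, h⟩ := leafVal_conj c (ε (some (some (some none))))
      (ε (some (some none))) (ε (some none)) (ε none)
    have hr : ε (some (some (some none))) = (false, false) →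
        Pauli.mk c false (Pauli.opp c (ε (some (some (some none))))) = (false, false) := by
      intro h
      rw [h]
      cases c <;> rfl
    have hr' : ε (some none) = (false, false) ∧ ε none = (false, false) →
        Pauli.mk c false (xor (Pauli.opp c (ε (some none))) (Pauli.opp c (ε none))) =
          (false, false) := by
      rintro ⟨h, h'⟩
      rw [h, h']
      cases c <;> rfl
    revert h hr hr'
    generalize Pauli.mk c false (Pauli.opp c (ε (some (some (some none))))) = r
    generalize Pauli.mk c false (xor (Pauli.opp c (ε (some none))) (Pauli.opp c (ε none))) = r'
    intro h hr hr'
    -- The edge between the first rotation and the measurement has no counterpart; its flip is taken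
    -- over by the edge that ended at `o`.
    obtain ⟨ε', hw, s', hs', h'⟩ := hD.exists_flip ho r fun e => ε (some (some (some (some e))))
    refine ⟨fun e => e.elim r' fun e => e.elim (ε (some (some none))) ε', ?_, s * s',
      mul_ne_zero hs hs', fun β => ?_⟩
    · rw [wt_option, wt_option ε, wt_option fun e => ε (some e), wt_option,
        wt_option fun e => ε (some (some e)), wt_option fun e => ε (some (some (some e)))]
      have := Pauli.wt_le_of_imp hr
      have := Pauli.wt_le_add_of_imp hr'
      simp only [Option.elim_none, Option.elim_some]
      have : (wt fun e => ε' e) = wt ε' := rfl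
      omega
    · rw [key, hD.interpL_leaf' ho hl, op_smul h, mul_assoc]
      subst hl
      refine congrArg (s * ·) (Eq.trans ?_ (op_congr_smul _ _ h' β))
      exact (op_op _ _ _ _ _).symm

/-- Behind the gate the output of `o` is `some none` and that of `p` is `none`. Once the first
rotation is in place, the latter is called `some none`, so the two rotations act on different qubits
although both are applied at `some none`. -/
theorem FaultEquiv.two_phase (hD : Lbl D ℓ) {o p : V} {l m : L} (ho : D.type o = .boundary)
    (hl : ℓ o = l) (hp : D.type p = .boundary) (hm : ℓ p = m) (hlm : l ≠ m)
    (c : Color) (k : ZMod 4) (c' : Color) (k' : ZMod 4) :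
    FaultEquiv (D.gateTwo o p c k c' k') (fun v => v.elim m fun v => v.elim l ℓ)
      (((D.gateTwo o p c 0 c' 0).gateOne (some none) (.spider c) k).gateOne (some none)
        (.spider c') k')
      (fun v => v.elim m fun v => v.elim l fun v => v.elim m fun v => v.elim l ℓ) := by
  have hop : o ≠ p := fun h => hlm (by rw [← hl, ← hm, h])
  have hL : Lbl (D.gateTwo o p c 0 c' 0) (fun v => v.elim m fun v => v.elim l ℓ) := by
    subst hl hm; exact hD.two ho hp hop c 0 c' 0
  have hb : (D.gateTwo o p c 0 c' 0).type (some none) = .boundary := rfl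
  have hL' : Lbl ((D.gateTwo o p c 0 c' 0).gateOne (some none) (.spider c) k)
      (fun v => v.elim l fun v => v.elim m fun v => v.elim l ℓ) := hL.one hb NodeType.noConfusion k
  have hb' : ((D.gateTwo o p c 0 c' 0).gateOne (some none) (.spider c) k).type (some none) =
      .boundary := by
    have h : (none : Option (Option V)) ≠ some none := by simp
    exact (@Function.update_of_ne _ _ (fun _ _ => Classical.propDecidable _) _ _ h
      (NodeType.spider c) (D.gateTwo o p c 0 c' 0).type).trans rfl
  have key : ∀ ε β, interpL (((D.gateTwo o p c 0 c' 0).gateOne (some none) (.spider c) k).gateOne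
      (some none) (.spider c') k')
      (fun v => v.elim m fun v => v.elim l fun v => v.elim m fun v => v.elim l ℓ) ε β =
      op₂ (fun γ δ x y => ∑ b, (∑ a, twoVal c 0 c' 0 (ε (some (some (some (some none)))))
        (ε (some (some (some none)))) (ε (some (some none))) γ δ a b *
        outVal (.spider c) k false {a} (ε (some none)) x) *
        outVal (.spider c') k' false {b} (ε none) y) l m
        (interpL D ℓ fun e => ε (some (some (some (some (some e)))))) β := by
    intro ε β
    rw [hL'.interpL_one' (l := m) hb' rfl NodeType.noConfusion, ← op_op₂_right _ _ hlm]
    refine congrArg (fun F => op _ m F β) (funext fun β => ?_)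
    rw [hL.interpL_one' (l := l) hb rfl NodeType.noConfusion, ← op_op₂_left _ _ hlm]
    exact congrArg (fun F => op _ l F β)
      (funext fun β => hD.interpL_two' ho hl hp hm hop c 0 c' 0 _ β)
  have expand : ∀ n n₁ n₂ n₃ n₄ γ δ x y, ∑ b, (∑ a, twoVal c 0 c' 0 n n₁ n₂ γ δ a b *
      outVal (.spider c) k false {a} n₃ x) * outVal (.spider c') k' false {b} n₄ y =
      ∑ a, ∑ a', edgeMat n a a' *
        (∑ z, outVal (.spider c) 0 false {a, γ} n₁ z * outVal (.spider c) k false {z} n₃ x) *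
        ∑ z, outVal (.spider c') 0 false {a', δ} n₂ z * outVal (.spider c') k' false {z} n₄ y := by
    intro n n₁ n₂ n₃ n₄ γ δ x y
    simp only [twoVal, Fintype.sum_bool]
    ring
  constructor
  · intro ε
    refine ⟨fun e => e.elim (ε none) fun e => e.elim (ε (some none)) fun e => e.elim (false, false)
      fun e => e.elim (false, false) fun e => ε (some (some e)), ?_, 1,
      one_ne_zero, fun β => ?_⟩
    · rw [wt_option, wt_option ε, wt_option, wt_option fun e => ε (some e), wt_option, wt_option]
      simp only [Option.elim_none, Option.elim_some, Pauli.wt_zero]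
      omega
    · rw [key, hD.interpL_two' ho hl hp hm hop, one_mul]
      refine congrArg (fun M => op₂ M l m _ β)
        (funext fun γ => funext fun δ => funext fun x => funext fun y => ?_)
      rw [expand]
      simp only [Option.elim_none, Option.elim_some, sum_outVal_outVal_zero, zero_add]
      rfl
  · intro ε
    obtain ⟨r, hr, s, hs, h⟩ := sum_outVal_outVal c 0 k (ε (some (some (some none)))) (ε (some none))
    obtain ⟨r', hr', s', hs', h'⟩ := sum_outVal_outVal c' 0 k' (ε (some (some none))) (ε none)
    refine ⟨fun e => e.elim r' fun e => e.elim r fun e => ε (some (some (some (some e)))), ?_,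
      s * s', mul_ne_zero hs hs', fun β => ?_⟩
    · rw [wt_option, wt_option ε, wt_option, wt_option fun e => ε (some e),
        wt_option fun e => ε (some (some e)), wt_option fun e => ε (some (some (some e)))]
      have := Pauli.wt_le_add_of_imp hr
      have := Pauli.wt_le_add_of_imp hr'
      simp only [Option.elim_none, Option.elim_some]
      omega
    · rw [key, hD.interpL_two' ho hl hp hm hop]
      refine op₂_smul (fun γ δ x y => ?_) _ _ _ _
      rw [expand]
      simp only [h, h', zero_add, twoVal, Finset.mul_sum, Option.elim_none, Option.elim_some]
      exact Finset.sum_congr rfl fun _ _ => Finset.sum_congr rfl fun _ _ => by ring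

end simgates


/-! # Diagrams equivalent to circuits -/

section realizable

/-- `D` has the same errors as some circuit with the same boundary labels, of which those in `In`
are inputs and those in `Out` are outputs. -/
def Realizable {V E L : Type} [Fintype V] [Fintype E] (In Out : Set L) (D : ZXDiagram V E)
    (ℓ : V → L) : Prop :=
  Lbl D ℓ ∧ ∃ (V' E' : Type) (_ : Fintype V') (_ : Fintype E') (C : ZXDiagram V' E') (ℓ' : V' → L),
    Circ In Out C ℓ' ∧ bl D ℓ = bl C ℓ' ∧ FaultEquiv D ℓ C ℓ'

variable {V E V' E' L : Type} [Fintype V] [Fintype E] [Fintype V'] [Fintype E']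
  {In Out : Set L} {D : ZXDiagram V E} {ℓ : V → L} {D' : ZXDiagram V' E'} {ℓ' : V' → L}

theorem Realizable.of_equiv (h : Realizable In Out D' ℓ') (hL : Lbl D ℓ) (hb : bl D ℓ = bl D' ℓ')
    (he : FaultEquiv D ℓ D' ℓ') : Realizable In Out D ℓ := by
  obtain ⟨-, V'', E'', _, _, C, m, hC, hbC, heC⟩ := h
  exact ⟨hL, V'', E'', _, _, C, m, hC, hb.trans hbC, he.trans heC⟩

theorem Realizable.empty (ℓ : Empty → L) : Realizable In Out emptyDiagram ℓ := by
  have hL : Lbl emptyDiagram ℓ := ⟨fun v => v.elim, fun v => v.elim⟩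
  refine ⟨hL, Empty, Empty, _, _, emptyDiagram, ℓ, ⟨hL, ?_⟩, rfl, FaultEquiv.refl _ _⟩
  rw [Set.eq_empty_of_isEmpty {v | _}, Set.eq_empty_of_isEmpty {v | _}]
  exact IsCircuit.empty

/-- The label of an output may be replaced by a fresh label outside `In`. -/
theorem Realizable.rename (h : Realizable In Out D ℓ) {o : V} (ho : D.type o = .boundary)
    (hI : ℓ o ∉ In) (hO : ℓ o ∈ Out) {l : L} (hl : l = ℓ o ∨ l ∉ bl D ℓ) (hlI : l ∉ In)
    (hlO : l ∈ Out) {ℓ₁ : V → L}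
    (h₁ : ∀ v, D.type v = .boundary → ℓ₁ v = if v = o then l else ℓ v) :
    Realizable In Out D ℓ₁ := by
  obtain ⟨hD, V', E', _, _, C, ℓ', hC, hb, he⟩ := h
  -- Exchanging the two labels, rather than overwriting one, keeps the relabelling injective on the
  -- circuit and compatible with `In` and `Out`.
  set ρ := Equiv.swap (ℓ o) l with hρ
  have key : ∀ v, D.type v = .boundary → ℓ₁ v = ρ (ℓ v) := by
    intro v hv
    rw [h₁ v hv]
    split_ifs with hvo
    · rw [hvo, hρ, Equiv.swap_apply_left]
    · have hne : ℓ v ≠ ℓ o := fun h => hvo (hD.inj _ _ hv ho h)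
      rw [hρ, Equiv.swap_apply_of_ne_of_ne hne]
      rintro rfl
      exact hl.elim hne fun h => h ⟨v, hv, rfl⟩
  have hset : ∀ S : Set L, (l ∈ S ↔ ℓ o ∈ S) → ∀ m, ρ m ∈ S ↔ m ∈ S := by
    intro S hS m
    rw [hρ, Equiv.swap_apply_def]
    split_ifs with h1 h2
    · rw [h1, hS]
    · rw [h2, hS]
    · rfl
  have hbl : bl D ℓ₁ = bl D (ρ ∘ ℓ) := by
    ext m
    exact ⟨fun ⟨v, hv, h⟩ => ⟨v, hv, (key v hv).symm.trans h⟩,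
      fun ⟨v, hv, h⟩ => ⟨v, hv, (key v hv).trans h⟩⟩
  have hC' : Circ In Out C (ρ ∘ ℓ') :=
    hC.relabel ρ.injective (hset In (iff_of_false hlI hI)) (hset Out (iff_of_true hlO hO))
  refine ⟨⟨hD.degree, fun v w hv hw e => hD.inj v w hv hw ?_⟩, _, _, _, _, _, _, hC',
    by rw [hbl, bl_relabel, hb, bl_relabel],
    (FaultEquiv.of_labels (ℓ := ρ ∘ ℓ) key).trans (he.relabel ρ)⟩
  rw [key v hv, key w hw] at e
  exact ρ.injective e

theorem Realizable.congr (h : Realizable In Out D ℓ) {ℓ₁ : V → L}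
    (h₁ : ∀ v, D.type v = .boundary → ℓ₁ v = ℓ v) : Realizable In Out D ℓ₁ := by
  refine h.of_equiv ⟨h.1.degree, fun v w hv hw e => h.1.inj v w hv hw ?_⟩ ?_
    (FaultEquiv.of_labels h₁)
  · rwa [h₁ v hv, h₁ w hw] at e
  · ext m
    exact ⟨fun ⟨v, hv, h⟩ => ⟨v, hv, (h₁ v hv).symm.trans h⟩,
      fun ⟨v, hv, h⟩ => ⟨v, hv, (h₁ v hv).trans h⟩⟩

theorem Realizable.addNode (h : Realizable In Out D ℓ) (c : Color) {k : ZMod 4} (hk : k ≠ 2)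
    (l : L) : Realizable In Out (D.addNode (.spider c) k) (fun v => v.elim l ℓ) :=
  h.of_equiv (h.1.addNode c k l) (bl_addNode D ℓ c k l) (FaultEquiv.addNode D ℓ c hk l)

theorem exists_of_bl_eq {V E V' E' : Type} {D : ZXDiagram V E} {ℓ : V → L} {D' : ZXDiagram V' E'}
    {ℓ' : V' → L} (hb : bl D ℓ = bl D' ℓ') {o : V} (ho : D.type o = .boundary) :
    ∃ o', D'.type o' = .boundary ∧ ℓ' o' = ℓ o := by
  have : ℓ o ∈ bl D' ℓ' := hb ▸ ⟨o, ho, rfl⟩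
  exact this

theorem Realizable.gateOne (h : Realizable In Out D ℓ) {o : V} {l : L} (ho : D.type o = .boundary)
    (hl : ℓ o = l) (hI : l ∉ In) (hO : l ∈ Out) {t : NodeType} (ht : t ≠ .boundary) (k : ZMod 4)
    (hk : t = .hadamard → k = 0) :
    Realizable In Out (D.gateOne o t k) (fun v => v.elim l ℓ) := by
  subst hl
  obtain ⟨hD, V', E', _, _, C, ℓ', hC, hb, he⟩ := h
  obtain ⟨o', ho', hl'⟩ := exists_of_bl_eq hb ho
  have hC' := hC.one ho' (hl' ▸ hI) (hl' ▸ hO) ht k hk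
  have hb' := bl_one C ℓ' ho' ht k
  rw [hl'] at hC' hb'
  exact ⟨hD.one ho ht k, _, _, _, _, _, _, hC', by rw [bl_one D ℓ ho ht, hb, hb'],
    he.1.one hD hC.toLbl ho ho' rfl hl' ht k, he.2.one hC.toLbl hD ho' ho hl' rfl ht k⟩

theorem Realizable.meas (h : Realizable In Out D ℓ) {o : V} (ho : D.type o = .boundary)
    (hI : ℓ o ∉ In) (hO : ℓ o ∈ Out) (c : Color) (k : ZMod 4) :
    Realizable In Out (D.retype o (.spider c) k) ℓ := by
  have aux : ∀ {V E : Type} [Fintype V] [Fintype E] {D : ZXDiagram V E} {ℓ : V → L} {o : V},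
      Realizable In Out D ℓ → D.type o = .boundary → ℓ o ∉ In → ℓ o ∈ Out →
      Realizable In Out (D.retype o (.spider c) 0) ℓ := by
    intro V E _ _ D ℓ o h ho hI hO
    obtain ⟨hD, V', E', _, _, C, ℓ', hC, hb, he⟩ := h
    obtain ⟨o', ho', hl'⟩ := exists_of_bl_eq hb ho
    exact ⟨hD.meas o c 0, _, _, _, _, _, _, hC.meas ho' (hl' ▸ hI) (hl' ▸ hO) c,
      by rw [bl_meas hD ho, bl_meas hC.toLbl ho', hb, hl'],
      he.1.meas hD hC.toLbl ho ho' rfl hl' c 0, he.2.meas hC.toLbl hD ho' ho hl' rfl c 0⟩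
  have hL := h.1.one ho (NodeType.noConfusion : NodeType.spider c ≠ .boundary) k
  have hb : (D.gateOne o (.spider c) k).type none = .boundary := rfl
  refine (aux (h.gateOne ho rfl hI hO (t := .spider c) NodeType.noConfusion k
    (fun h => by cases h)) (o := none) hb hI hO).of_equiv (h.1.meas o c k) ?_
    (FaultEquiv.meas_phase h.1 ho rfl c k)
  rw [bl_meas h.1 ho, bl_meas hL hb, bl_one D ℓ ho NodeType.noConfusion]
  rfl

theorem Realizable.wire (h : Realizable In Out D ℓ) {l : L} (hl : l ∉ bl D ℓ) (hI : l ∉ In)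
    (hO : l ∈ Out) (l₁ : L) (c : Color) (k : ZMod 4) :
    Realizable In Out (D.gateWire (.spider c) k) (fun v => v.elim l fun v => v.elim l₁ ℓ) := by
  have h0 : Realizable In Out (D.gateWire (.spider c) 0)
      (fun v => v.elim l fun v => v.elim l₁ ℓ) := by
    obtain ⟨hD, V', E', _, _, C, ℓ', hC, hb, he⟩ := h
    exact ⟨hD.wire 0 hl (by simp), _, _, _, _, _, _, hC.prep (hb ▸ hl) hI hO l₁ c,
      by rw [bl_wire_spider, bl_wire_spider, hb], he.1.wire l l₁ _ 0, he.2.wire l l₁ _ 0⟩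
  have hb : (D.gateWire (.spider c) 0).type none = .boundary := rfl
  refine (h0.gateOne (o := none) (l := l) hb rfl hI hO (t := .spider c) NodeType.noConfusion k
    (fun h => by cases h)).of_equiv (h.1.wire k hl (by simp)) ?_ (FaultEquiv.wire_phase h.1 hl l₁ c k)
  refine Eq.trans ?_ (bl_one (D.gateWire (.spider c) 0) (fun v => v.elim l fun v => v.elim l₁ ℓ) hb
    NodeType.noConfusion k).symm
  rw [bl_wire_spider, bl_wire_spider]

theorem Realizable.input (h : Realizable In Out D ℓ) {l l₁ : L} (hl : l ∉ bl D ℓ) (hI : l ∉ In)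
    (hO : l ∈ Out) (hl₁ : l₁ ∉ bl D ℓ) (hI₁ : l₁ ∈ In) (hO₁ : l₁ ∉ Out) :
    Realizable In Out (D.gateWire .boundary 0) (fun v => v.elim l fun v => v.elim l₁ ℓ) := by
  obtain ⟨hD, V', E', _, _, C, ℓ', hC, hb, he⟩ := h
  exact ⟨hD.wire 0 hl fun _ => ⟨hl₁, fun h => hI (h ▸ hI₁)⟩, _, _, _, _, _, _,
    hC.input (hb ▸ hl) (hb ▸ hl₁) hI hO hI₁ hO₁,
    by rw [bl_wire_boundary, bl_wire_boundary, hb], he.1.wire l l₁ _ 0, he.2.wire l l₁ _ 0⟩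

/-- Four cases for the one-legged spider: it has the same colour and fuses; it has an odd phase and
can be recoloured; it has phase `0` and gives a Pauli measurement; it has phase π and gives a
conjugated one. In the last two cases the phase on the qubit becomes a rotation. -/
theorem Realizable.leaf (h : Realizable In Out D ℓ) {o : V} {l : L} (ho : D.type o = .boundary)
    (hl : ℓ o = l) (hI : l ∉ In) (hO : l ∈ Out) (c : Color) (k : ZMod 4) (c' : Color) (k' : ZMod 4) :
    Realizable In Out (D.gateLeaf o c k c' k') (fun v => v.elim l fun v => v.elim l ℓ) := by
  have bleaf : ∀ {V E : Type} {D : ZXDiagram V E} {ℓ : V → L} {o : V}, D.type o = .boundary →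
      ℓ o = l → ∀ c k c' k', bl (D.gateLeaf o c k c' k') (fun v => v.elim l fun v => v.elim l ℓ) =
        bl D ℓ := by
    intro V E D ℓ o ho hl c k c' k'
    subst hl
    exact bl_leaf D ℓ ho c k c' k'
  have bone : ∀ {V E : Type} {D : ZXDiagram V E} {ℓ : V → L} {o : V}, D.type o = .boundary →
      ℓ o = l → ∀ c k, bl (D.gateOne o (.spider c) k) (fun v => v.elim l ℓ) = bl D ℓ := by
    intro V E D ℓ o ho hl c k
    subst hl
    exact bl_one D ℓ ho NodeType.noConfusion k
  have lleaf : ∀ c k c' k', Lbl (D.gateLeaf o c k c' k') (fun v => v.elim l fun v => v.elim l ℓ) := by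
    intro c k c' k'
    subst hl
    exact h.1.leaf ho c k c' k'
  have rone : ∀ {V E : Type} [Fintype V] [Fintype E] {D : ZXDiagram V E} {ℓ : V → L} {o : V},
      Realizable In Out D ℓ → D.type o = .boundary → ℓ o = l → ∀ c k,
      Realizable In Out (D.gateOne o (.spider c) k) (fun v => v.elim l ℓ) := by
    intro V E _ _ D ℓ o h ho hl c k
    exact h.gateOne ho hl hI hO NodeType.noConfusion k (fun h => by cases h)
  have same : ∀ c k k', Realizable In Out (D.gateLeaf o c k c k')
      (fun v => v.elim l fun v => v.elim l ℓ) := fun c k k' =>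
    (rone h ho hl c (k + k')).of_equiv (lleaf c k c k') (by rw [bleaf ho hl, bone ho hl])
      (FaultEquiv.leaf_same h.1 ho hl c k k')
  have zero : ∀ {V E : Type} [Fintype V] [Fintype E] {D : ZXDiagram V E} {ℓ : V → L} {o : V},
      Realizable In Out D ℓ → D.type o = .boundary → ℓ o = l → ∀ c,
      Realizable In Out (D.gateLeaf o c 0 c.opp 0) (fun v => v.elim l fun v => v.elim l ℓ) := by
    intro V E _ _ D ℓ o h ho hl c
    obtain ⟨hD, V', E', _, _, C, ℓ', hC, hb, he⟩ := h
    obtain ⟨o', ho', hl'⟩ := exists_of_bl_eq hb ho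
    rw [hl] at hl'
    have hC' := hC.leaf ho' (hl' ▸ hI) (hl' ▸ hO) c
    have hL := hD.leaf ho c 0 c.opp 0
    rw [hl'] at hC'
    rw [hl] at hL
    exact ⟨hL, _, _, _, _, _, _, hC', by rw [bleaf ho hl, bleaf ho' hl', hb],
      he.1.leaf hD hC.toLbl ho ho' hl hl' c 0 _ 0, he.2.leaf hC.toLbl hD ho' ho hl' hl c 0 _ 0⟩
  have phase : ∀ c k c' k', Realizable In Out (D.gateLeaf o c 0 c' k')
      (fun v => v.elim l fun v => v.elim l ℓ) → Realizable In Out (D.gateLeaf o c k c' k')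
      (fun v => v.elim l fun v => v.elim l ℓ) := by
    intro c k c' k' h'
    have hb : (D.gateLeaf o c 0 c' k').type none = .boundary := rfl
    refine (rone h' hb rfl c k).of_equiv (lleaf c k c' k') ?_ (FaultEquiv.leaf_phase h.1 ho hl c k c' k')
    refine Eq.trans ?_ (bone hb rfl c k).symm
    rw [bleaf ho hl, bleaf ho hl]
  by_cases hc : c' = c
  · subst hc
    exact same _ k k'
  · obtain rfl : c' = c.opp := by cases c <;> cases c' <;> simp_all [Color.opp]
    by_cases hk : k' = 1 ∨ k' = 3
    · exact (same c k (-k')).of_equiv (lleaf c k c.opp k') (by rw [bleaf ho hl, bleaf ho hl])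
        (FaultEquiv.leaf_odd h.1 ho hl c k hk)
    · have hk' : k' = 0 ∨ k' = 2 := by
        revert k'
        decide
      rcases hk' with rfl | rfl
      · exact phase c k _ 0 (zero h ho hl c)
      · refine phase c k _ 2 ?_
        have h₁ := rone h ho hl c.opp 2
        have h₂ := zero h₁ (o := none) rfl rfl c
        refine (rone h₂ (o := none) rfl rfl c.opp 2).of_equiv (lleaf c 0 c.opp 2) ?_
          (FaultEquiv.leaf_pi h.1 ho hl c)
        refine Eq.trans ?_ (bone (o := none) rfl rfl c.opp 2).symm
        refine Eq.trans ?_ (bleaf (o := none) rfl rfl c 0 c.opp 0).symm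
        rw [bleaf ho hl, bone ho hl]

theorem Realizable.two (h : Realizable In Out D ℓ) {o p : V} {l m : L} (ho : D.type o = .boundary)
    (hl : ℓ o = l) (hp : D.type p = .boundary) (hm : ℓ p = m) (hlm : l ≠ m) (hlI : l ∉ In)
    (hlO : l ∈ Out) (hmI : m ∉ In) (hmO : m ∈ Out) {c c' : Color} (hc : c = .Z ∨ c' = .X)
    (k k' : ZMod 4) :
    Realizable In Out (D.gateTwo o p c k c' k') (fun v => v.elim m fun v => v.elim l ℓ) := by
  have hop : o ≠ p := fun h => hlm (by rw [← hl, ← hm, h])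
  have btwo : ∀ {V E : Type} {D : ZXDiagram V E} {ℓ : V → L} {o p : V}, D.type o = .boundary →
      ℓ o = l → D.type p = .boundary → ℓ p = m → ∀ k k',
      bl (D.gateTwo o p c k c' k') (fun v => v.elim m fun v => v.elim l ℓ) = bl D ℓ := by
    intro V E D ℓ o p ho hl hp hm k k'
    have hop : o ≠ p := fun h => hlm (by rw [← hl, ← hm, h])
    subst hl hm
    exact bl_two D ℓ ho hp hop c k c' k'
  have ltwo : ∀ {V E : Type} [Fintype E] {D : ZXDiagram V E} {ℓ : V → L} {o p : V}, Lbl D ℓ →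
      D.type o = .boundary → ℓ o = l → D.type p = .boundary → ℓ p = m → ∀ k k',
      Lbl (D.gateTwo o p c k c' k') (fun v => v.elim m fun v => v.elim l ℓ) := by
    intro V E _ D ℓ o p hD ho hl hp hm k k'
    have hop : o ≠ p := fun h => hlm (by rw [← hl, ← hm, h])
    subst hl hm
    exact hD.two ho hp hop c k c' k'
  have zero : Realizable In Out (D.gateTwo o p c 0 c' 0)
      (fun v => v.elim m fun v => v.elim l ℓ) := by
    obtain ⟨hD, V', E', _, _, C, ℓ', hC, hb, he⟩ := h
    obtain ⟨o', ho', hl'⟩ := exists_of_bl_eq hb ho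
    obtain ⟨p', hp', hm'⟩ := exists_of_bl_eq hb hp
    rw [hl] at hl'
    rw [hm] at hm'
    have hop' : o' ≠ p' := fun h => hlm (by rw [← hl', ← hm', h])
    have hC' := hC.two ho' (hl' ▸ hlI) (hl' ▸ hlO) hp' (hm' ▸ hmI) (hm' ▸ hmO) hop' hc
    rw [hl', hm'] at hC'
    exact ⟨ltwo hD ho hl hp hm 0 0, _, _, _, _, _, _, hC',
      by rw [btwo ho hl hp hm, btwo ho' hl' hp' hm', hb],
      he.1.two hD hC.toLbl ho ho' hl hl' hp hp' hm hm' hlm c 0 c' 0,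
      he.2.two hC.toLbl hD ho' ho hl' hl hp' hp hm' hm hlm c 0 c' 0⟩
  have hb₁ : (D.gateTwo o p c 0 c' 0).type (some none) = .boundary := rfl
  have hb₂ : ((D.gateTwo o p c 0 c' 0).gateOne (some none) (.spider c) k).type (some none) =
      .boundary := by
    have h : (none : Option (Option V)) ≠ some none := by simp
    exact (@Function.update_of_ne _ _ (fun _ _ => Classical.propDecidable _) _ _ h
      (NodeType.spider c) (D.gateTwo o p c 0 c' 0).type).trans rfl
  have h₁ := zero.gateOne (l := l) hb₁ rfl hlI hlO (t := .spider c) NodeType.noConfusion k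
    (fun h => by cases h)
  have h₂ := h₁.gateOne (l := m) hb₂ rfl hmI hmO (t := .spider c') NodeType.noConfusion k'
    (fun h => by cases h)
  refine h₂.of_equiv (ltwo h.1 ho hl hp hm k k') ?_
    (FaultEquiv.two_phase h.1 ho hl hp hm hlm c k c' k')
  have e₁ := bl_one (D.gateTwo o p c 0 c' 0) (fun v => v.elim m fun v => v.elim l ℓ) hb₁
    (NodeType.noConfusion : NodeType.spider c ≠ .boundary) k
  have e₂ := bl_one _ (fun v => v.elim l fun v => v.elim m fun v => v.elim l ℓ) hb₂
    (NodeType.noConfusion : NodeType.spider c' ≠ .boundary) k'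
  rw [btwo ho hl hp hm, ← btwo ho hl hp hm 0 0]
  exact (e₂.trans e₁).symm

/-! ### New names behind gates -/

theorem type_of_retype {V E : Type} {D : ZXDiagram V E} {t : NodeType} (ht : t ≠ .boundary)
    (k : ZMod 4) {o v : V}
    (h : (D.retype o t k).type v = .boundary) : v ≠ o ∧ D.type v = .boundary := by
  by_cases hv : v = o
  · subst hv
    simp [retype, ht] at h
  · exact ⟨hv, by simpa [retype, hv] using h⟩

/-- Outputs will be named after cut edges, so a gate has to change the name from the incoming to the
outgoing edge. The former output gets the name `x`, which is arbitrary because it is no longer a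
boundary vertex. -/
theorem Realizable.gateOne_rename (h : Realizable In Out D ℓ) {o : V} (ho : D.type o = .boundary)
    (hI : ℓ o ∉ In) (hO : ℓ o ∈ Out) {t : NodeType} (ht : t ≠ .boundary) (k : ZMod 4)
    (hk : t = .hadamard → k = 0) {l : L} (hl : l ∉ bl D ℓ) (hlI : l ∉ In) (hlO : l ∈ Out) (x : L) :
    Realizable In Out (D.gateOne o t k) (fun v => v.elim l (Function.update ℓ o x)) := by
  refine (h.gateOne ho rfl hI hO ht k hk).rename (o := none) rfl hI hO (l := l) ?_ hlI hlO ?_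
  · rw [bl_one D ℓ ho ht]
    exact .inr hl
  · rintro (_ | v) hv
    · rw [if_pos rfl]; rfl
    · rw [if_neg (by simp)]
      exact Function.update_of_ne (type_of_retype ht k hv).1 _ _

theorem Realizable.leaf_rename (h : Realizable In Out D ℓ) {o : V} (ho : D.type o = .boundary)
    (hI : ℓ o ∉ In) (hO : ℓ o ∈ Out) (c : Color) (k : ZMod 4) (c' : Color) (k' : ZMod 4)
    {l : L} (hl : l ∉ bl D ℓ) (hlI : l ∉ In) (hlO : l ∈ Out) (x y : L) :
    Realizable In Out (D.gateLeaf o c k c' k')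
      (fun v => v.elim l fun v => v.elim y (Function.update ℓ o x)) := by
  refine (h.leaf ho rfl hI hO c k c' k').rename (o := none) rfl hI hO (l := l) ?_ hlI hlO ?_
  · rw [bl_leaf D ℓ ho]
    exact .inr hl
  · rintro (_ | _ | v) hv
    · rw [if_pos rfl]; rfl
    · cases hv
    · rw [if_neg (by simp)]
      exact Function.update_of_ne (type_of_retype NodeType.noConfusion k hv).1 _ _

/-- The outputs are renamed one after the other; `l ≠ m` ensures that the second name is still fresh
after the first renaming. -/
theorem Realizable.two_rename (h : Realizable In Out D ℓ) {o p : V} (ho : D.type o = .boundary)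
    (hp : D.type p = .boundary) (hop : ℓ o ≠ ℓ p) (hoI : ℓ o ∉ In)
    (hoO : ℓ o ∈ Out) (hpI : ℓ p ∉ In) (hpO : ℓ p ∈ Out) {c c' : Color} (hc : c = .Z ∨ c' = .X)
    (k k' : ZMod 4) {l m : L} (hl : l ∉ bl D ℓ) (hlI : l ∉ In) (hlO : l ∈ Out)
    (hm : m ∉ bl D ℓ) (hmI : m ∉ In) (hmO : m ∈ Out) (hlm : l ≠ m) (x y : L) :
    Realizable In Out (D.gateTwo o p c k c' k')
      (fun v => v.elim m fun v => v.elim l (Function.update (Function.update ℓ o x) p y)) := by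
  have hb := bl_two D ℓ ho hp (fun h => hop (by rw [h])) c k c' k'
  have h₁ : Realizable In Out (D.gateTwo o p c k c' k')
      (fun v => v.elim (ℓ p) fun v => v.elim l ℓ) := by
    refine (h.two ho rfl hp rfl hop hoI hoO hpI hpO hc k k').rename (o := some none) rfl hoI hoO
      (l := l) ?_ hlI hlO ?_
    · rw [hb]
      exact .inr hl
    · rintro (_ | _ | v) hv <;> simp
  refine h₁.rename (o := none) rfl hpI hpO (l := m) (.inr ?_) hmI hmO ?_
  · rintro ⟨_ | _ | v, hv, e⟩
    · exact hm ⟨p, hp, e⟩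
    · exact hlm e
    · exact hm ⟨v, (type_of_retype NodeType.noConfusion k
        (type_of_retype NodeType.noConfusion k' hv).2).2, e⟩
  · rintro (_ | _ | v) hv
    · rw [if_pos rfl]; rfl
    · rw [if_neg (by simp)]; rfl
    · rw [if_neg (by simp)]
      obtain ⟨h₁, hv⟩ := type_of_retype NodeType.noConfusion k' hv
      obtain ⟨h₂, -⟩ := type_of_retype NodeType.noConfusion k hv
      exact (Function.update_of_ne h₁ _ _).trans (Function.update_of_ne h₂ _ _)

end realizable


/-! # Partial realizations -/

section partialDiagram

variable {V E V' E' : Type}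

/-- The name of the end `s` of the edge `e`, when the vertices in `A` are present: the vertex, or the
cut edge. -/
noncomputable def place (D : ZXDiagram V E) (A : Set (V ⊕ E)) (e : E) (s : Bool) : V ⊕ E :=
  if Sum.inl (D.ends e s) ∈ A then .inl (D.ends e s) else .inr e

/-- `X` is a part of `D`: its vertices are vertices of `D`, or boundary vertices that end cut edges of
`D`, and its edges are edges of `D`. -/
structure Part (D : ZXDiagram V E) (X : ZXDiagram V' E') (f : V' → V ⊕ E) (g : E' → E) : Prop where
  vert_inj : Function.Injective f
  edge_inj : Function.Injective g
  -- The bit `r` allows the edge of `X` to list its ends in the reverse order.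
  ends : ∀ e, ∃ r, ∀ s, f (X.ends e (xor r s)) = D.place (Set.range f) (g e) s
  type_eq : ∀ v w, f v = .inl w → X.type v = D.type w
  phase_eq : ∀ v w, f v = .inl w → D.IsSpider w → X.phase v = D.phase w
  cut : ∀ v e, f v = .inr e → X.type v = .boundary

variable {D : ZXDiagram V E} {X : ZXDiagram V' E'} {f : V' → V ⊕ E} {g : E' → E}

theorem mem_range_elim {α β : Type} {a x : β} {f : α → β} :
    x ∈ Set.range (fun v : Option α => v.elim a f) ↔ x = a ∨ x ∈ Set.range f := by
  simp only [Set.mem_range, Option.exists, Option.elim_none, Option.elim_some, eq_comm (a := x)]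

theorem mem_range_update {α β : Type} {b x : β} {f : α → β} (hf : Function.Injective f) {o : α} :
    x ∈ Set.range (Function.update f o b) ↔ x = b ∨ (x ∈ Set.range f ∧ x ≠ f o) := by
  constructor
  · rintro ⟨v, rfl⟩
    by_cases h : v = o
    · subst h; simp
    · rw [Function.update_of_ne h]
      exact .inr ⟨⟨v, rfl⟩, hf.ne h⟩
  · rintro (rfl | ⟨⟨v, rfl⟩, h⟩)
    · exact ⟨o, Function.update_self _ _ _⟩
    · exact ⟨v, Function.update_of_ne (fun h' => h (by rw [h'])) _ _⟩

theorem elim_injective {α β : Type} {a : β} {f : α → β} (hf : Function.Injective f)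
    (ha : a ∉ Set.range f) : Function.Injective fun v : Option α => v.elim a f := by
  rintro (_ | v) (_ | w) h
  · rfl
  · exact absurd ⟨w, h.symm⟩ ha
  · exact absurd ⟨v, h⟩ ha
  · exact congrArg some (hf h)

theorem place_congr {A B : Set (V ⊕ E)} {e : E} {s : Bool}
    (h : Sum.inl (D.ends e s) ∈ A ↔ Sum.inl (D.ends e s) ∈ B) : D.place A e s = D.place B e s := by
  simp only [place, h]

/-- No edge of the part may end at `v`: the presence of `v` would move such an end from its cut to
`v`. -/
theorem Part.addNode (h : Part D X f g) {v : V} (hv : Sum.inl v ∉ Set.range f)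
    (hg : ∀ e ∈ Set.range g, ∀ s, D.ends e s ≠ v) {t : NodeType} {k : ZMod 4} (ht : D.type v = t)
    (hk : D.IsSpider v → k = D.phase v) :
    Part D (X.addNode t k) (fun u => u.elim (.inl v) f) g where
  vert_inj := elim_injective h.vert_inj hv
  edge_inj := h.edge_inj
  ends e := by
    obtain ⟨r, hr⟩ := h.ends e
    refine ⟨r, fun s => (hr s).trans (place_congr ?_)⟩
    rw [mem_range_elim, Sum.inl.injEq, or_iff_right (hg _ ⟨e, rfl⟩ s)]
  type_eq := by
    rintro (_ | u) w hw
    · cases hw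
      exact ht.symm
    · exact h.type_eq u w hw
  phase_eq := by
    rintro (_ | u) w hw hs
    · cases hw
      exact hk hs
    · exact h.phase_eq u w hw hs
  cut := by
    rintro (_ | u) e hw
    · cases hw
    · exact h.cut u e hw

theorem Part.addCut (h : Part D X f g) {e : E} (he : Sum.inr e ∉ Set.range f) (k : ZMod 4) :
    Part D (X.addNode .boundary k) (fun u => u.elim (.inr e) f) g where
  vert_inj := elim_injective h.vert_inj he
  edge_inj := h.edge_inj
  ends e := by
    obtain ⟨r, hr⟩ := h.ends e
    refine ⟨r, fun s => (hr s).trans (place_congr ?_)⟩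
    rw [mem_range_elim, or_iff_right (by simp)]
  type_eq := by
    rintro (_ | u) w hw
    · cases hw
    · exact h.type_eq u w hw
  phase_eq := by
    rintro (_ | u) w hw hs
    · cases hw
    · exact h.phase_eq u w hw hs
  cut := by
    rintro (_ | u) e hw
    · rfl
    · exact h.cut u e hw

/-- The end of `e` placed at `u` is the one numbered `s`, so `s` becomes the reversal bit of the new
edge. -/
theorem Part.addEdge (h : Part D X f g) {e : E} (he : e ∉ Set.range g) {u w : V'} (s : Bool)
    (hu : f u = D.place (Set.range f) e s) (hw : f w = D.place (Set.range f) e (!s)) :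
    Part D (X.addEdge u w) f (fun e' => e'.elim e g) where
  vert_inj := h.vert_inj
  edge_inj := elim_injective h.edge_inj he
  ends := by
    rintro (_ | e')
    · refine ⟨s, fun t => ?_⟩
      show f (if xor s t then w else u) = D.place (Set.range f) e t
      cases s <;> cases t <;> simp_all
    · exact h.ends e'
  type_eq := h.type_eq
  phase_eq := h.phase_eq
  cut := h.cut

/-- The far end of `e` is not present yet, so a boundary vertex named after `e` stands in for it. -/
theorem Part.addLeg (h : Part D X f g) {e : E} (he : e ∉ Set.range g)
    (hc : Sum.inr e ∉ Set.range f) {u : V'} {s : Bool} (hu : f u = .inl (D.ends e s))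
    (hs : Sum.inl (D.ends e !s) ∉ Set.range f) :
    Part D (X.addLeg u .boundary 0) (fun v => v.elim (.inr e) f) (fun e' => e'.elim e g) := by
  refine (h.addCut hc 0).addEdge he s ?_ ?_
  · rw [place, if_pos]
    · exact hu
    · exact mem_range_elim.2 (.inr ⟨u, hu⟩)
  · rw [place, if_neg]
    · rfl
    · rw [mem_range_elim]
      simpa using hs

/-- The cut of `e` is filled by `v`. As the other end of `e` is present, the name `e` stands only
for the end at `v`, and no other edge of the part ends there. -/
theorem Part.retype (h : Part D X f g) {o : V'} {e : E}
    {v : V} (ho : f o = .inr e) (hv : Sum.inl v ∉ Set.range f)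
    (hg : ∀ e' ∈ Set.range g, ∀ s, D.ends e' s = v → e' = e) {s : Bool} (hs : D.ends e s = v)
    (hs' : Sum.inl (D.ends e !s) ∈ Set.range f) {t : NodeType} {k : ZMod 4} (ht : D.type v = t)
    (hk : D.IsSpider v → k = D.phase v) :
    Part D (X.retype o t k) (Function.update f o (.inl v)) g where
  vert_inj := by
    intro u w huw
    by_cases hu : u = o <;> by_cases hw : w = o
    · rw [hu, hw]
    · subst hu
      rw [Function.update_self, Function.update_of_ne hw] at huw
      exact absurd ⟨w, huw.symm⟩ hv
    · subst hw
      rw [Function.update_self, Function.update_of_ne hu] at huw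
      exact absurd ⟨u, huw⟩ hv
    · rw [Function.update_of_ne hu, Function.update_of_ne hw] at huw
      exact h.vert_inj huw
  edge_inj := h.edge_inj
  ends e' := by
    obtain ⟨r, hr⟩ := h.ends e'
    refine ⟨r, fun s' => ?_⟩
    have hr := hr s'
    show Function.update f o (.inl v) (X.ends e' (xor r s')) = _
    by_cases hv' : D.ends (g e') s' = v
    · have hge := hg _ ⟨e', rfl⟩ s' hv'
      have : X.ends e' (xor r s') = o := by
        apply h.vert_inj
        rw [hr, ho, place, if_neg (by rw [hv']; exact hv), hge]
      rw [this, Function.update_self, place, hv', if_pos]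
      exact (mem_range_update h.vert_inj).2 (.inl rfl)
    · have hpl : D.place (Set.range (Function.update f o (.inl v))) (g e') s' =
          D.place (Set.range f) (g e') s' := by
        apply place_congr
        rw [mem_range_update h.vert_inj, ho]
        simp [hv']
      rw [hpl, ← hr, Function.update_of_ne]
      -- Otherwise this would be a cut end of `e` away from `v`, hence the end `!s`, which is
      -- present and therefore not cut.
      intro h'
      rw [h', ho, place] at hr
      split_ifs at hr with hm
      have hge := Sum.inr.inj hr
      rw [← hge] at hm hv'
      have : s' = !s := by
        cases s <;> cases s' <;> simp_all
      rw [this] at hm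
      exact hm hs'
  type_eq u w hw := by
    by_cases hu : u = o
    · subst hu
      rw [Function.update_self] at hw
      cases hw
      simp [ZXDiagram.retype, ht]
    · rw [Function.update_of_ne hu] at hw
      simp only [ZXDiagram.retype, Function.update_of_ne hu]
      exact h.type_eq u w hw
  phase_eq u w hw hsp := by
    by_cases hu : u = o
    · subst hu
      rw [Function.update_self] at hw
      cases hw
      simp [ZXDiagram.retype, hk hsp]
    · rw [Function.update_of_ne hu] at hw
      simp only [ZXDiagram.retype, Function.update_of_ne hu]
      exact h.phase_eq u w hw hsp
  cut u e' hw := by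
    by_cases hu : u = o
    · subst hu
      rw [Function.update_self] at hw
      cases hw
    · rw [Function.update_of_ne hu] at hw
      simp only [ZXDiagram.retype, Function.update_of_ne hu]
      exact h.cut u e' hw

theorem retype_self (X : ZXDiagram V' E') (o : V') : X.retype o (X.type o) (X.phase o) = X := by
  cases X
  simp [ZXDiagram.retype]

end partialDiagram


/-! # Realizing a diagram along an orientation -/

section orientation

variable {V E : Type}

/-- `e` is directed into `v`; the edge `e` with `dir e = some s` is directed to its end `s`. -/
def Into (D : ZXDiagram V E) (dir : E → Option Bool) (v : V) (e : E) : Prop :=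
  ∃ s, dir e = some s ∧ D.ends e s = v

/-- `e` is directed out of `v`. -/
def From (D : ZXDiagram V E) (dir : E → Option Bool) (v : V) (e : E) : Prop :=
  ∃ s, dir e = some s ∧ D.ends e (!s) = v

/-- `e` is an undirected edge at `v`. -/
def Free (D : ZXDiagram V E) (dir : E → Option Bool) (v : V) (e : E) : Prop :=
  dir e = none ∧ ∃ s, D.ends e s = v

/-- A partial orientation of the edges, for which the directed edges form paths that can be read as
qubits. -/
structure QubitFlow (D : ZXDiagram V E) where
  dir : E → Option Bool
  rank : V → ℕ
  rank_lt : ∀ e s, dir e = some s → rank (D.ends e !s) < rank (D.ends e s)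
  rank_eq : ∀ e s, dir e = none → rank (D.ends e !s) = rank (D.ends e s)
  into_unique : ∀ v e e', D.Into dir v e → D.Into dir v e' → e = e'
  from_unique : ∀ v e e', D.From dir v e → D.From dir v e' → e = e'
  free_unique : ∀ v e e', D.Free dir v e → D.Free dir v e' → e = e'
  boundary : ∀ v, D.type v = .boundary → (∀ e, ¬ D.Free dir v e) ∧
    ((∃ e, D.Into dir v e) ∧ (∀ e, ¬ D.From dir v e) ∨
      (∀ e, ¬ D.Into dir v e) ∧ ∃ e, D.From dir v e)
  hadamard : ∀ v, D.type v = .hadamard → (∀ e, ¬ D.Free dir v e) ∧ (∃ e, D.Into dir v e) ∧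
    ∃ e, D.From dir v e
  free : ∀ v e, D.Free dir v e → ((∃ e, D.Into dir v e) ∧ ∃ e, D.From dir v e) ∨
    (∀ e, ¬ D.Into dir v e) ∧ ∀ e, ¬ D.From dir v e
  free_mate : ∀ e s, dir e = none → (∃ e', D.Into dir (D.ends e s) e') ∨
    ∃ e', D.Into dir (D.ends e !s) e'

variable {D : ZXDiagram V E} (F : D.QubitFlow)

namespace QubitFlow

/-- The labels of inputs. -/
def inputs : Set (V ⊕ E) :=
  {x | x.elim (fun v => D.type v = .boundary ∧ ∃ e, D.From F.dir v e) fun _ => False}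

/-- The labels of outputs. -/
def outputs : Set (V ⊕ E) :=
  {x | x.elim (fun v => D.type v = .boundary ∧ ∃ e, D.Into F.dir v e) fun _ => True}

/-- `S` is closed under predecessors and undirected edges. -/
def Closed (S : Set V) : Prop :=
  (∀ e s, F.dir e = some s → D.ends e s ∈ S → D.ends e (!s) ∈ S) ∧
    ∀ e s, F.dir e = none → D.ends e s ∈ S → D.ends e (!s) ∈ S

/-- `e` is directed out of the set `S`. -/
def Cut (S : Set V) (e : E) : Prop :=
  ∃ s, F.dir e = some s ∧ D.ends e (!s) ∈ S ∧ D.ends e s ∉ S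

/-- `X` is the part of `D` induced by `S`. -/
structure Induced (S : Set V) {V' E' : Type} (X : ZXDiagram V' E') (f : V' → V ⊕ E)
    (g : E' → E) : Prop extends Part D X f g where
  vert : ∀ v, Sum.inl v ∈ Set.range f ↔ v ∈ S
  cut_iff : ∀ e, Sum.inr e ∈ Set.range f ↔ F.Cut S e
  edge : ∀ e, e ∈ Set.range g ↔ ∃ s, D.ends e s ∈ S

/-- The part of `D` induced by `S` is realizable. -/
def Reached (S : Set V) : Prop :=
  ∃ (V' E' : Type) (_ : Fintype V') (_ : Fintype E') (X : ZXDiagram V' E') (f : V' → V ⊕ E)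
    (g : E' → E), F.Induced S X f g ∧ Realizable F.inputs F.outputs X f

variable {F}

theorem not_mem_inputs (e : E) : Sum.inr e ∉ F.inputs := fun h => h

theorem mem_outputs (e : E) : Sum.inr e ∈ F.outputs := trivial

/-- The edges into `v` stop being cut, and those out of `v` start to be, because their heads are
still missing. -/
theorem cut_insert {S : Set V} {v : V} (hout : ∀ e s, F.dir e = some s → D.ends e (!s) = v →
    D.ends e s ∉ S ∧ D.ends e s ≠ v) (e : E) :
    F.Cut (insert v S) e ↔ D.From F.dir v e ∨ (F.Cut S e ∧ ¬ D.Into F.dir v e) := by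
  constructor
  · rintro ⟨s, hs, h₁, h₂⟩
    rw [Set.mem_insert_iff, not_or] at h₂
    rcases h₁ with h₁ | h₁
    · exact .inl ⟨s, hs, h₁⟩
    · refine .inr ⟨⟨s, hs, h₁, h₂.2⟩, fun ⟨s', hs', h⟩ => h₂.1 ?_⟩
      rw [hs, Option.some.injEq] at hs'
      rw [hs', h]
  · rintro (⟨s, hs, h⟩ | ⟨⟨s, hs, h₁, h₂⟩, h⟩)
    · refine ⟨s, hs, .inl h, ?_⟩
      rintro (h' | h')
      · exact (hout e s hs h).2 h'
      · exact (hout e s hs h).1 h'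
    · refine ⟨s, hs, .inr h₁, ?_⟩
      rintro (h' | h')
      · exact h ⟨s, hs, h'⟩
      · exact h₂ h'

theorem edge_insert {S : Set V} {v : V} (e : E) :
    (∃ s, D.ends e s ∈ insert v S) ↔
      (∃ s, D.ends e s ∈ S) ∨ D.Into F.dir v e ∨ D.From F.dir v e ∨ D.Free F.dir v e := by
  constructor
  · rintro ⟨s, h | h⟩
    · cases hd : F.dir e with
      | none => exact .inr (.inr (.inr ⟨hd, s, h⟩))
      | some t =>
        by_cases hst : s = t
        · subst hst; exact .inr (.inl ⟨s, hd, h⟩)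
        · have : s = !t := by cases s <;> cases t <;> simp_all
          subst this
          exact .inr (.inr (.inl ⟨t, hd, h⟩))
    · exact .inl ⟨s, h⟩
  · rintro (⟨s, h⟩ | ⟨s, -, h⟩ | ⟨s, -, h⟩ | ⟨-, s, h⟩)
    exacts [⟨s, .inr h⟩, ⟨s, .inl h⟩, ⟨_, .inl h⟩, ⟨s, .inl h⟩]

/-- If an edge between `v` and the closed set were undirected or directed out of `v`, closedness
would force `v` into the set. -/
theorem into_of_edge {S : Set V} {v : V} (hS : F.Closed S) (hv : v ∉ S) {e : E} {s t : Bool}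
    (h : D.ends e s = v) (ht : D.ends e t ∈ S) : D.Into F.dir v e := by
  have hst : t = !s := by
    by_contra hne
    have : t = s := by cases s <;> cases t <;> simp_all
    exact hv (h ▸ this ▸ ht)
  subst hst
  cases hd : F.dir e with
  | none =>
    have := hS.2 e _ hd ht
    rw [Bool.not_not, h] at this
    exact absurd this hv
  | some u =>
    by_cases hu : u = s
    · subst hu; exact ⟨u, hd, h⟩
    · have : u = !s := by cases s <;> cases u <;> simp_all
      subst this
      have := hS.1 e _ hd ht
      rw [Bool.not_not, h] at this
      exact absurd this hv

/-- Only closedness under predecessors is assumed, since this is also applied to `insert v S`, which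
may contain just one end of an undirected edge. -/
theorem from_not_mem {S : Set V} {v : V}
    (hS : ∀ e s, F.dir e = some s → D.ends e s ∈ S → D.ends e (!s) ∈ S) (hv : v ∉ S) (e : E)
    (s : Bool) (hs : F.dir e = some s) (h : D.ends e (!s) = v) :
    D.ends e s ∉ S ∧ D.ends e s ≠ v := by
  refine ⟨fun h' => hv (h ▸ hS e s hs h'), fun h' => ?_⟩
  have := F.rank_lt e s hs
  rw [h, h'] at this
  exact lt_irrefl _ this

/-- The other end of an edge directed out of `v` comes later. -/
theorem from_new {S : Set V} {v : V} (hS : F.Closed S) (hv : v ∉ S) {e : E}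
    (h : D.From F.dir v e) : ¬ (∃ s, D.ends e s ∈ S) ∧ ¬ F.Cut S e := by
  obtain ⟨s, hs, h⟩ := h
  have h' := (from_not_mem hS.1 hv e s hs h).1
  constructor
  · rintro ⟨t, ht⟩
    by_cases hst : t = s
    · exact h' (hst ▸ ht)
    · have : t = !s := by cases s <;> cases t <;> simp_all
      exact hv (h ▸ this ▸ ht)
  · rintro ⟨t, ht, h₁, -⟩
    rw [hs, Option.some.injEq] at ht
    subst ht
    exact hv (h ▸ h₁)

section steps

variable {S : Set V} {v : V} {V' E' : Type} {X : ZXDiagram V' E'} {f : V' → V ⊕ E}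
  {g : E' → E} {V'' E'' : Type} [Fintype V''] [Fintype E''] {Y : ZXDiagram V'' E''}
  {f' : V'' → V ⊕ E} {g' : E'' → E}

theorem Induced.exists_cut (h : F.Induced S X f g) (hv : v ∉ S)
    (hin : ∀ e s, F.dir e = some s → D.ends e s = v → D.ends e (!s) ∈ S) {e : E}
    (he : D.Into F.dir v e) : (∃ s, D.ends e s = v ∧ Sum.inl (D.ends e !s) ∈ Set.range f) ∧
      (∃ s, D.ends e s ∈ S) ∧ ∃ o, f o = .inr e ∧ X.type o = .boundary := by
  obtain ⟨s, hs, hv'⟩ := he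
  obtain ⟨o, ho⟩ := (h.cut_iff e).2 ⟨s, hs, hin e s hs hv', hv' ▸ hv⟩
  exact ⟨⟨s, hv', (h.vert _).2 (hin e s hs hv')⟩, ⟨_, hin e s hs hv'⟩, o, ho, h.cut o e ho⟩

theorem not_mem_bl {x : V ⊕ E} (h : x ∉ Set.range f) : x ∉ bl X f :=
  fun ⟨v, _, hv⟩ => h ⟨v, hv⟩

/-- Reduces a step of the induction to computing the ranges of the two naming maps. -/
theorem Reached.of_insert (hP : Part D Y f' g') (hR : Realizable F.inputs F.outputs Y f')
    (hS : F.Closed S) (hv : v ∉ S) (h₁ : ∀ u, Sum.inl u ∈ Set.range f' ↔ u = v ∨ u ∈ S)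
    (h₂ : ∀ e, Sum.inr e ∈ Set.range f' ↔ D.From F.dir v e ∨ (F.Cut S e ∧ ¬ D.Into F.dir v e))
    (h₃ : ∀ e, e ∈ Set.range g' ↔
      (∃ s, D.ends e s ∈ S) ∨ D.Into F.dir v e ∨ D.From F.dir v e ∨ D.Free F.dir v e) :
    F.Reached (insert v S) :=
  ⟨_, _, _, _, _, _, _, ⟨hP, h₁, fun e => by rw [h₂, cut_insert (from_not_mem hS.1 hv)],
    fun e => by rw [h₃, edge_insert (F := F)]⟩, hR⟩

/-- Combinatorially the pair is added in two insertions, but realizability is only claimed at the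
end: `insert v S` need not be closed under undirected edges. -/
theorem Reached.of_insert_insert (hP : Part D Y f' g') (hR : Realizable F.inputs F.outputs Y f')
    (hS : F.Closed S) (hv : v ∉ S) {w : V} (hw : w ∉ insert v S)
    (hin : ∀ e s, F.dir e = some s → D.ends e s = v → D.ends e (!s) ∈ S)
    (h₁ : ∀ u, Sum.inl u ∈ Set.range f' ↔ u = w ∨ u = v ∨ u ∈ S)
    (h₂ : ∀ e, Sum.inr e ∈ Set.range f' ↔ D.From F.dir w e ∨
      ((D.From F.dir v e ∨ (F.Cut S e ∧ ¬ D.Into F.dir v e)) ∧ ¬ D.Into F.dir w e))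
    (h₃ : ∀ e, e ∈ Set.range g' ↔
      ((∃ s, D.ends e s ∈ S) ∨ D.Into F.dir v e ∨ D.From F.dir v e ∨ D.Free F.dir v e) ∨
        D.Into F.dir w e ∨ D.From F.dir w e ∨ D.Free F.dir w e) :
    F.Reached (insert w (insert v S)) := by
  have hS' : ∀ e s, F.dir e = some s → D.ends e s ∈ insert v S → D.ends e (!s) ∈ insert v S := by
    rintro e s hs (h | h)
    · exact .inr (hin e s hs h)
    · exact .inr (hS.1 e s hs h)
  exact ⟨_, _, _, _, _, _, _, ⟨hP, h₁,
    fun e => by rw [h₂, cut_insert (from_not_mem hS' hw), cut_insert (from_not_mem hS.1 hv)],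
    fun e => by rw [h₃, edge_insert (F := F), edge_insert (F := F)]⟩, hR⟩

end steps

section steps

variable {S : Set V} {v : V} {V' E' : Type} {X : ZXDiagram V' E'} {f : V' → V ⊕ E} {g : E' → E}

theorem Induced.addNode (h : F.Induced S X f g) (hS : F.Closed S) (hv : v ∉ S)
    (h₁ : ∀ e, ¬ D.Into F.dir v e) {t : NodeType} {k : ZMod 4} (ht : D.type v = t)
    (hk : D.IsSpider v → k = D.phase v) :
    Part D (X.addNode t k) (fun u => u.elim (.inl v) f) g :=
  h.toPart.addNode (fun h' => hv ((h.vert v).1 h')) (fun e he s' h' => by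
    obtain ⟨t, ht⟩ := (h.edge e).1 he
    exact h₁ e (into_of_edge hS hv h' ht)) ht hk

theorem Induced.wire (h : F.Induced S X f g) (hS : F.Closed S) (hv : v ∉ S)
    (h₁ : ∀ e, ¬ D.Into F.dir v e) {e : E} (h₂ : D.From F.dir v e) {t : NodeType} {k : ZMod 4}
    (ht : D.type v = t) (hk : D.IsSpider v → k = D.phase v) :
    Part D (X.gateWire t k) (fun u => u.elim (.inr e) fun u => u.elim (.inl v) f)
      (fun e' => e'.elim e g) := by
  obtain ⟨heB, heC⟩ := from_new hS hv h₂
  rw [← h.edge] at heB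
  rw [← h.cut_iff] at heC
  obtain ⟨s, hs, hse⟩ := h₂
  refine (h.addNode hS hv h₁ ht hk).addLeg (e := e) (s := !s) (u := none) heB
    (by rw [mem_range_elim]; simpa using heC) (by simp [hse]) ?_
  rw [mem_range_elim, Bool.not_not]
  have := from_not_mem hS.1 hv e s hs hse
  rintro (h' | h')
  · exact this.2 (Sum.inl.inj h')
  · exact this.1 ((h.vert _).1 h')

theorem Induced.retype (h : F.Induced S X f g) (hS : F.Closed S) (hv : v ∉ S)
    (hin : ∀ e s, F.dir e = some s → D.ends e s = v → D.ends e (!s) ∈ S) {i : E}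
    (h₁ : D.Into F.dir v i) {o : V'} (ho : f o = .inr i) {t : NodeType} {k : ZMod 4}
    (ht : D.type v = t) (hk : D.IsSpider v → k = D.phase v) :
    Part D (X.retype o t k) (Function.update f o (.inl v)) g := by
  obtain ⟨⟨s, hs, hs'⟩, -⟩ := h.exists_cut hv hin h₁
  refine h.toPart.retype ho (fun h' => hv ((h.vert v).1 h')) (fun e he s' h' => ?_) hs hs' ht hk
  obtain ⟨t, ht⟩ := (h.edge e).1 he
  exact F.into_unique v e i (into_of_edge hS hv h' ht) h₁

variable [Fintype V'] [Fintype E']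

theorem Induced.reached_of_wire (h : F.Induced S X f g) (hS : F.Closed S) (hv : v ∉ S)
    (h₁ : ∀ e, ¬ D.Into F.dir v e) {e : E} (h₂ : D.From F.dir v e) (h₃ : ∀ e, ¬ D.Free F.dir v e)
    {t : NodeType} {k : ZMod 4} (ht : D.type v = t) (hk : D.IsSpider v → k = D.phase v)
    (hR : Realizable F.inputs F.outputs (X.gateWire t k)
      (fun u => u.elim (.inr e) fun u => u.elim (.inl v) f)) : F.Reached (insert v S) := by
  have hfrom : ∀ e', D.From F.dir v e' ↔ e' = e :=
    fun e' => ⟨fun h' => F.from_unique v e' e h' h₂, fun h' => h' ▸ h₂⟩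
  refine Reached.of_insert (h.wire hS hv h₁ h₂ ht hk) hR hS hv (fun u => ?_) (fun e' => ?_) fun e' => ?_
  · simp only [mem_range_elim, h.vert, reduceCtorEq, false_or, Sum.inl.injEq]
  · simp only [mem_range_elim, h.cut_iff, h₁, hfrom, reduceCtorEq, false_or, Sum.inr.injEq,
      not_false_eq_true, and_true]
  · simp only [mem_range_elim, h.edge, h₁, hfrom, h₃, false_or, or_false]
    exact or_comm

theorem Induced.reached_of_retype (h : F.Induced S X f g) (hS : F.Closed S) (hv : v ∉ S)
    (hin : ∀ e s, F.dir e = some s → D.ends e s = v → D.ends e (!s) ∈ S) {i : E}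
    (h₁ : D.Into F.dir v i) (h₂ : ∀ e, ¬ D.From F.dir v e) (h₃ : ∀ e, ¬ D.Free F.dir v e)
    {o : V'} (ho : f o = .inr i) {t : NodeType} {k : ZMod 4}
    (ht : D.type v = t) (hk : D.IsSpider v → k = D.phase v)
    (hR : Realizable F.inputs F.outputs (X.retype o t k) (Function.update f o (.inl v))) :
    F.Reached (insert v S) := by
  have hinto : ∀ e', D.Into F.dir v e' ↔ e' = i :=
    fun e' => ⟨fun h' => F.into_unique v e' i h' h₁, fun h' => h' ▸ h₁⟩
  refine Reached.of_insert (h.retype hS hv hin h₁ ho ht hk) hR hS hv (fun u => ?_) (fun e' => ?_)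
    fun e' => ?_
  · simp [mem_range_update h.vert_inj, h.vert, ho]
  · simp [mem_range_update h.vert_inj, h.cut_iff, ho, hinto, h₂]
  · rw [h.edge, hinto]
    have := (h.exists_cut hv hin h₁).2.1
    constructor
    · exact .inl
    · rintro (h' | rfl | h' | h')
      exacts [h', this, absurd h' (h₂ _), absurd h' (h₃ _)]

theorem Induced.reached_of_one (h : F.Induced S X f g) (hS : F.Closed S) (hv : v ∉ S)
    (hin : ∀ e s, F.dir e = some s → D.ends e s = v → D.ends e (!s) ∈ S) {i e : E}
    (h₁ : D.Into F.dir v i) (h₂ : D.From F.dir v e) (h₃ : ∀ e, ¬ D.Free F.dir v e)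
    {o : V'} (ho : f o = .inr i) {t : NodeType} {k : ZMod 4}
    (ht : D.type v = t) (hk : D.IsSpider v → k = D.phase v)
    (hR : Realizable F.inputs F.outputs (X.gateOne o t k)
      (fun u => u.elim (.inr e) (Function.update f o (.inl v)))) :
    F.Reached (insert v S) := by
  have hinto : ∀ e', D.Into F.dir v e' ↔ e' = i :=
    fun e' => ⟨fun h' => F.into_unique v e' i h' h₁, fun h' => h' ▸ h₁⟩
  have hfrom : ∀ e', D.From F.dir v e' ↔ e' = e :=
    fun e' => ⟨fun h' => F.from_unique v e' e h' h₂, fun h' => h' ▸ h₂⟩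
  obtain ⟨heB, heC⟩ := from_new hS hv h₂
  obtain ⟨s, hs, hse⟩ := h₂
  have hnew := from_not_mem hS.1 hv e s hs hse
  have hP := (h.retype hS hv hin h₁ ho ht hk).addLeg (e := e) (s := !s) (u := o)
    (by rwa [h.edge]) (by
      rw [mem_range_update h.vert_inj, h.cut_iff]
      simp [heC]) (by rw [Function.update_self, hse])
    (by
      rw [mem_range_update h.vert_inj, Bool.not_not, h.vert]
      simp [hnew])
  refine Reached.of_insert hP hR hS hv (fun u => ?_) (fun e' => ?_) fun e' => ?_
  · rw [mem_range_elim, mem_range_update h.vert_inj, h.vert, ho]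
    simp
  · rw [mem_range_elim, mem_range_update h.vert_inj, h.cut_iff, ho, hinto, hfrom]
    simp
  · simp only [mem_range_elim, h.edge, hinto, hfrom, h₃, or_false]
    have := (h.exists_cut hv hin h₁).2.1
    constructor
    · tauto
    · rintro (h' | rfl | h')
      exacts [.inr h', .inr this, .inl h']

end steps

end QubitFlow

end orientation


/-! ### Adding two spiders joined by an undirected edge -/

namespace QubitFlow

section pairs

variable {V E : Type} {D : ZXDiagram V E} {F : D.QubitFlow} {S : Set V} {v w : V} {V' E' : Type}
  [Fintype V'] [Fintype E'] {X : ZXDiagram V' E'} {f : V' → V ⊕ E} {g : E' → E}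

theorem rank_from {e : E} (h : D.From F.dir v e) :
    ∃ s, F.dir e = some s ∧ D.ends e (!s) = v ∧ F.rank v < F.rank (D.ends e s) := by
  obtain ⟨s, hs, hv⟩ := h
  exact ⟨s, hs, hv, hv ▸ F.rank_lt e s hs⟩

/-- The spider `w` lies on no qubit and enters as the one-legged partner of `v`. Equal ranks across
`u` guarantee that the edge leaving `v` does not end at `w`, so its far end is really cut. -/
theorem Induced.reached_of_leaf (h : F.Induced S X f g) (hS : F.Closed S) (hv : v ∉ S) (hw : w ∉ S)
    (hvw : v ≠ w) (hin : ∀ e s, F.dir e = some s → D.ends e s = v → D.ends e (!s) ∈ S) {i e u : E}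
    {s : Bool} (hu : F.dir u = none) (huv : D.ends u s = v) (huw : D.ends u (!s) = w)
    (h₁ : D.Into F.dir v i) (h₂ : D.From F.dir v e) (h₁w : ∀ e, ¬ D.Into F.dir w e)
    (h₂w : ∀ e, ¬ D.From F.dir w e) {o : V'} (ho : f o = .inr i) {c c' : Color}
    (hc : D.type v = .spider c) (hc' : D.type w = .spider c')
    (hR : Realizable F.inputs F.outputs (X.gateLeaf o c (D.phase v) c' (D.phase w))
      (fun x => x.elim (.inr e) fun x => x.elim (.inl w) (Function.update f o (.inl v)))) :
    F.Reached (insert w (insert v S)) := by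
  have hinto : ∀ e', D.Into F.dir v e' ↔ e' = i :=
    fun e' => ⟨fun h' => F.into_unique v e' i h' h₁, fun h' => h' ▸ h₁⟩
  have hfrom : ∀ e', D.From F.dir v e' ↔ e' = e :=
    fun e' => ⟨fun h' => F.from_unique v e' e h' h₂, fun h' => h' ▸ h₂⟩
  have hfree : ∀ e', D.Free F.dir v e' ↔ e' = u :=
    fun e' => ⟨fun h' => F.free_unique v e' u h' ⟨hu, s, huv⟩, fun h' => h' ▸ ⟨hu, s, huv⟩⟩
  have hfree' : ∀ e', D.Free F.dir w e' ↔ e' = u :=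
    fun e' => ⟨fun h' => F.free_unique w e' u h' ⟨hu, _, huw⟩, fun h' => h' ▸ ⟨hu, _, huw⟩⟩
  have huB : ¬ ∃ s, D.ends u s ∈ S := by
    rintro ⟨t, ht⟩
    by_cases hts : t = s
    · exact hv (huv ▸ hts ▸ ht)
    · have : t = !s := by cases s <;> cases t <;> simp_all
      exact hw (huw ▸ this ▸ ht)
  have hrank : F.rank w = F.rank v := huv ▸ huw ▸ F.rank_eq u s hu
  obtain ⟨heB, heC⟩ := from_new hS hv h₂
  obtain ⟨t, ht, hte, hlt⟩ := rank_from h₂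
  have hnew := from_not_mem hS.1 hv e t ht hte
  have hne : D.ends e t ≠ w := fun h' => by rw [h', hrank] at hlt; exact lt_irrefl _ hlt
  have heu : e ≠ u := by
    rintro rfl
    rw [hu] at ht
    cases ht
  have r₁ : ∀ x, x ∈ Set.range (Function.update f o (.inl v)) ↔
      x = .inl v ∨ x ∈ Set.range f ∧ x ≠ .inr i := fun x => by
    rw [mem_range_update h.vert_inj, ho]
  have r₂ : ∀ x, x ∈ Set.range (fun x : Option V' => x.elim (.inl w) (Function.update f o (.inl v))) ↔
      x = .inl w ∨ x = .inl v ∨ x ∈ Set.range f ∧ x ≠ .inr i := fun x => by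
    rw [mem_range_elim, r₁]
  have P₁ := h.retype hS hv hin h₁ ho hc (fun _ => rfl)
  have P₂ := P₁.addNode (v := w) (t := .spider c') (k := D.phase w)
    (by
      rw [r₁, h.vert]
      simp [hvw.symm, hw])
    (fun e he s' h' => by
      obtain ⟨t, ht⟩ := (h.edge e).1 he
      exact h₁w e (into_of_edge hS hw h' ht)) hc' (fun _ => rfl)
  have P₃ := P₂.addEdge (e := u) (u := some o) (w := none) (by rwa [h.edge]) s
    (by
      rw [place, if_pos, huv]
      · show Function.update f o (.inl v) o = _
        rw [Function.update_self]
      · rw [r₂, huv]; simp)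
    (by
      rw [place, if_pos, huw]
      · rfl
      · rw [r₂, huw]; simp)
  have P₄ := P₃.addLeg (e := e) (s := !t) (u := some o) (by
      rw [mem_range_elim, h.edge]
      simp only [heu, heB, or_self, not_false_eq_true])
    (by
      rw [r₂, h.cut_iff]
      simp [heC]) (by
      show Function.update f o (.inl v) o = _
      rw [Function.update_self, hte])
    (by
      rw [r₂, Bool.not_not, h.vert]
      simp [hnew, hne])
  refine Reached.of_insert_insert P₄ hR hS hv (by simp [hvw.symm, hw]) hin (fun x => ?_) (fun x => ?_)
    fun x => ?_
  · rw [mem_range_elim, r₂, h.vert]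
    simp
  · rw [mem_range_elim, r₂, h.cut_iff, hinto, hfrom]
    simp [h₁w, h₂w]
  · rw [mem_range_elim, mem_range_elim, h.edge, hinto, hfrom, hfree, hfree']
    simp only [h₁w, h₂w, false_or]
    have := (h.exists_cut hv hin h₁).2.1
    constructor
    · tauto
    · rintro ((h' | rfl | h') | h')
      exacts [.inr (.inr h'), .inr (.inr this), by tauto, .inr (.inl h')]

/-- Most of the work consists of separations between incoming edges, outgoing edges and the joining
edge `u`, which keep the names distinct. Equal ranks exclude a directed edge from one spider to the
other. -/
theorem Induced.reached_of_two (h : F.Induced S X f g) (hS : F.Closed S) (hv : v ∉ S) (hw : w ∉ S)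
    (hvw : v ≠ w) (hin : ∀ e s, F.dir e = some s → D.ends e s = v → D.ends e (!s) ∈ S)
    (hin' : ∀ e s, F.dir e = some s → D.ends e s = w → D.ends e (!s) ∈ S) {i i' e e' u : E}
    {s : Bool} (hu : F.dir u = none) (huv : D.ends u s = v) (huw : D.ends u (!s) = w)
    (h₁ : D.Into F.dir v i) (h₂ : D.From F.dir v e) (h₁w : D.Into F.dir w i')
    (h₂w : D.From F.dir w e') {o p : V'} (ho : f o = .inr i) (hp : f p = .inr i') {c c' : Color}
    (hc : D.type v = .spider c) (hc' : D.type w = .spider c')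
    (hR : Realizable F.inputs F.outputs (X.gateTwo o p c (D.phase v) c' (D.phase w))
      (fun x => x.elim (.inr e') fun x => x.elim (.inr e)
        (Function.update (Function.update f o (.inl v)) p (.inl w)))) :
    F.Reached (insert w (insert v S)) := by
  have hinto : ∀ e', D.Into F.dir v e' ↔ e' = i :=
    fun e' => ⟨fun h' => F.into_unique v e' i h' h₁, fun h' => h' ▸ h₁⟩
  have hfrom : ∀ e', D.From F.dir v e' ↔ e' = e :=
    fun e' => ⟨fun h' => F.from_unique v e' e h' h₂, fun h' => h' ▸ h₂⟩
  have hinto' : ∀ e, D.Into F.dir w e ↔ e = i' :=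
    fun e' => ⟨fun h' => F.into_unique w e' i' h' h₁w, fun h' => h' ▸ h₁w⟩
  have hfrom' : ∀ e, D.From F.dir w e ↔ e = e' :=
    fun e => ⟨fun h' => F.from_unique w e e' h' h₂w, fun h' => h' ▸ h₂w⟩
  have hfree : ∀ e', D.Free F.dir v e' ↔ e' = u :=
    fun e' => ⟨fun h' => F.free_unique v e' u h' ⟨hu, s, huv⟩, fun h' => h' ▸ ⟨hu, s, huv⟩⟩
  have hfree' : ∀ e', D.Free F.dir w e' ↔ e' = u :=
    fun e' => ⟨fun h' => F.free_unique w e' u h' ⟨hu, _, huw⟩, fun h' => h' ▸ ⟨hu, _, huw⟩⟩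
  have huB : ¬ ∃ s, D.ends u s ∈ S := by
    rintro ⟨t, ht⟩
    by_cases hts : t = s
    · exact hv (huv ▸ hts ▸ ht)
    · have : t = !s := by cases s <;> cases t <;> simp_all
      exact hw (huw ▸ this ▸ ht)
  have hrank : F.rank w = F.rank v := huv ▸ huw ▸ F.rank_eq u s hu
  obtain ⟨heB, heC⟩ := from_new hS hv h₂
  obtain ⟨heB', heC'⟩ := from_new hS hw h₂w
  obtain ⟨t, ht, hte, hlt⟩ := rank_from h₂
  obtain ⟨t', ht', hte', hlt'⟩ := rank_from h₂w
  have hnew := from_not_mem hS.1 hv e t ht hte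
  have hnew' := from_not_mem hS.1 hw e' t' ht' hte'
  have hne : D.ends e t ≠ w := fun h' => by rw [h', hrank] at hlt; exact lt_irrefl _ hlt
  have hne' : D.ends e' t' ≠ v := fun h' => by rw [h', hrank] at hlt'; exact lt_irrefl _ hlt'
  have heu : e ≠ u := by
    rintro rfl
    rw [hu] at ht
    cases ht
  have heu' : e' ≠ u := by
    rintro rfl
    rw [hu] at ht'
    cases ht'
  have hee : e ≠ e' := by
    rintro rfl
    rw [ht, Option.some.injEq] at ht'
    subst ht'
    exact hvw (hte.symm.trans hte')
  have hei : e ≠ i' := by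
    rintro rfl
    exact heB (h.exists_cut hw hin' h₁w).2.1
  have hii : i' ≠ i := by
    rintro rfl
    obtain ⟨a, ha, hav⟩ := h₁
    obtain ⟨b, hb, hbw⟩ := h₁w
    rw [ha, Option.some.injEq] at hb
    subst hb
    exact hvw (hav.symm.trans hbw)
  have hop : p ≠ o := by
    rintro rfl
    rw [ho] at hp
    exact hii (Sum.inr.inj hp).symm
  have P₁ := h.retype hS hv hin h₁ ho hc (fun _ => rfl)
  have r₁ : ∀ x, x ∈ Set.range (Function.update f o (.inl v)) ↔
      x = .inl v ∨ x ∈ Set.range f ∧ x ≠ .inr i := fun x => by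
    rw [mem_range_update h.vert_inj, ho]
  have hp₁ : Function.update f o (.inl v) p = .inr i' := by rw [Function.update_of_ne hop, hp]
  have r₂ : ∀ x, x ∈ Set.range (Function.update (Function.update f o (.inl v)) p (.inl w)) ↔
      x = .inl w ∨ (x = .inl v ∨ x ∈ Set.range f ∧ x ≠ .inr i) ∧ x ≠ .inr i' := fun x => by
    rw [mem_range_update P₁.vert_inj, r₁, hp₁]
  obtain ⟨⟨b, hb, hb'⟩, -⟩ := h.exists_cut hw hin' h₁w
  have P₂ := P₁.retype (o := p) (v := w) (e := i') hp₁ (by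
      rw [r₁, h.vert]
      simp [hvw.symm, hw]) (fun e he s' h' => by
      obtain ⟨t, ht⟩ := (h.edge e).1 he
      exact (hinto' e).1 (into_of_edge hS hw h' ht)) hb (by
      rw [r₁]
      exact .inr ⟨hb', by simp⟩) hc' (fun _ => rfl)
  have P₃ := P₂.addEdge (e := u) (u := o) (w := p) (by rwa [h.edge]) s
    (by
      rw [place, if_pos, huv, Function.update_of_ne hop.symm, Function.update_self]
      rw [r₂, huv]; simp)
    (by
      rw [place, if_pos, huw, Function.update_self]
      rw [r₂, huw]; simp)
  have P₄ := P₃.addLeg (e := e) (s := !t) (u := o) (by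
      rw [mem_range_elim, h.edge]
      simp only [heu, heB, or_self, not_false_eq_true])
    (by
      rw [r₂, h.cut_iff]
      simp [heC])
    (by rw [hte, Function.update_of_ne hop.symm, Function.update_self])
    (by
      rw [r₂, Bool.not_not, h.vert]
      simp [hnew, hne])
  have P₅ := P₄.addLeg (e := e') (s := !t') (u := some p) (by
      rw [mem_range_elim, mem_range_elim, h.edge]
      simp only [heu', heB', hee.symm, or_self, not_false_eq_true])
    (by
      rw [mem_range_elim, r₂, h.cut_iff]
      simp [heC', hee.symm])
    (by
      show Function.update (Function.update f o (.inl v)) p (.inl w) p = _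
      rw [Function.update_self, hte'])
    (by
      rw [mem_range_elim, r₂, Bool.not_not, h.vert]
      simp [hnew', hne'])
  refine Reached.of_insert_insert P₅ hR hS hv (by simp [hvw.symm, hw]) hin (fun x => ?_) (fun x => ?_)
    fun x => ?_
  · rw [mem_range_elim, mem_range_elim, r₂, h.vert]
    simp
  · rw [mem_range_elim, mem_range_elim, r₂, h.cut_iff, hinto, hfrom, hinto', hfrom']
    simp only [Sum.inr.injEq, reduceCtorEq, false_or, ne_eq]
    constructor
    · rintro (h' | rfl | h')
      · exact .inl h'
      · exact .inr ⟨.inl rfl, hei⟩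
      · tauto
    · tauto
  · rw [mem_range_elim, mem_range_elim, mem_range_elim, h.edge, hinto, hfrom, hfree, hinto', hfrom',
      hfree']
    have a₁ := (h.exists_cut hv hin h₁).2.1
    have a₂ := (h.exists_cut hw hin' h₁w).2.1
    constructor
    · tauto
    · rintro ((h' | rfl | h' | h') | rfl | h' | h')
      · tauto
      · tauto
      · tauto
      · tauto
      · tauto
      · tauto
      · tauto

end pairs

end QubitFlow


/-! ### Induction over closed sets of vertices -/

namespace QubitFlow

section reach

variable {V E : Type} {D : ZXDiagram V E} {F : D.QubitFlow} {S : Set V} {v w : V}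

theorem Closed.insert (hS : F.Closed S)
    (hin : ∀ e s, F.dir e = some s → D.ends e s = v → D.ends e (!s) ∈ S)
    (hfree : ∀ e, ¬ D.Free F.dir v e) : F.Closed (insert v S) := by
  constructor
  · rintro e s hs (h | h)
    · exact .inr (hin e s hs h)
    · exact .inr (hS.1 e s hs h)
  · rintro e s hs (h | h)
    · exact absurd ⟨hs, s, h⟩ (hfree e)
    · exact .inr (hS.2 e s hs h)

/-- Undirected edges form a matching, so once both ends of `u` are added no undirected edge is half
inside. -/
theorem Closed.insert_insert (hS : F.Closed S)
    (hin : ∀ e s, F.dir e = some s → D.ends e s = v → D.ends e (!s) ∈ S)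
    (hin' : ∀ e s, F.dir e = some s → D.ends e s = w → D.ends e (!s) ∈ S) (hvw : v ≠ w) {u : E}
    {s : Bool} (hu : F.dir u = none) (huv : D.ends u s = v) (huw : D.ends u (!s) = w) :
    F.Closed (Insert.insert w (Insert.insert v S)) := by
  constructor
  · rintro e t ht (h | h | h)
    · exact .inr (.inr (hin' e t ht h))
    · exact .inr (.inr (hin e t ht h))
    · exact .inr (.inr (hS.1 e t ht h))
  · rintro e t ht (h | h | h)
    · obtain rfl := F.free_unique w e u ⟨ht, t, h⟩ ⟨hu, _, huw⟩
      have : t = !s := by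
        by_contra hne
        have : t = s := by cases s <;> cases t <;> simp_all
        exact hvw (huv.symm.trans (this ▸ h))
      subst this
      rw [Bool.not_not]
      exact .inr (.inl huv)
    · obtain rfl := F.free_unique v e u ⟨ht, t, h⟩ ⟨hu, _, huv⟩
      have : t = s := by
        by_contra hne
        have : t = !s := by cases s <;> cases t <;> simp_all
        exact hvw (h.symm.trans (this ▸ huw))
      subst this
      exact .inl huw
    · exact .inr (.inr (hS.2 e t ht h))

/-- The gate is dictated by the type of `v` and its directed edges. Incoming and outgoing: a
rotation or Hadamard gate. Only incoming: a measurement or an output. Only outgoing: a preparation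
or an input. Neither: a scalar. -/
theorem reached_insert
    (hscalar : ∀ v, (∀ e s, D.ends e s ≠ v) → D.phase v ≠ 2) (hS : F.Closed S) (hR : F.Reached S)
    (hv : v ∉ S) (hin : ∀ e s, F.dir e = some s → D.ends e s = v → D.ends e (!s) ∈ S)
    (hfree : ∀ e, ¬ D.Free F.dir v e) : F.Reached (insert v S) := by
  obtain ⟨V', E', _, _, X, f, g, hI, hR⟩ := hR
  have hvf : Sum.inl v ∉ Set.range f := fun h' => hv ((hI.vert v).1 h')
  have hcut : ∀ {e}, D.From F.dir v e → Sum.inr e ∉ bl X f := fun h =>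
    not_mem_bl (by rw [hI.cut_iff]; exact (from_new hS hv h).2)
  rcases ht : D.type v with c | _ | _
  · have hk : D.IsSpider v → D.phase v = D.phase v := fun _ => rfl
    have hsb : NodeType.spider c ≠ .boundary := NodeType.noConfusion
    by_cases h₁ : ∃ i, D.Into F.dir v i
    · obtain ⟨i, h₁⟩ := h₁
      obtain ⟨-, -, o, ho, hob⟩ := hI.exists_cut hv hin h₁
      have hoI : f o ∉ F.inputs := ho ▸ not_mem_inputs i
      have hoO : f o ∈ F.outputs := ho ▸ mem_outputs i
      by_cases h₂ : ∃ e, D.From F.dir v e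
      · obtain ⟨e, h₂⟩ := h₂
        exact hI.reached_of_one hS hv hin h₁ h₂ hfree ho ht hk
          (hR.gateOne_rename hob hoI hoO hsb _ (fun h => by cases h) (hcut h₂) (not_mem_inputs e)
            (mem_outputs e) _)
      · refine hI.reached_of_retype hS hv hin h₁ (not_exists.1 h₂) hfree ho ht hk
          ((hR.meas hob hoI hoO c _).congr fun u hu => ?_)
        exact Function.update_of_ne (type_of_retype hsb _ hu).1 _ _
    · have h₁ := not_exists.1 h₁
      by_cases h₂ : ∃ e, D.From F.dir v e
      · obtain ⟨e, h₂⟩ := h₂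
        exact hI.reached_of_wire hS hv h₁ h₂ hfree ht hk
          (hR.wire (hcut h₂) (not_mem_inputs e) (mem_outputs e) _ c _)
      · have h₂ := not_exists.1 h₂
        -- Every edge at `v` would be incoming, outgoing or free, so here `v` has none.
        have hphase : D.phase v ≠ 2 := by
          refine hscalar v fun e s hes => ?_
          have := (edge_insert (F := F) (S := ∅) (v := v) e).1 ⟨s, .inl hes⟩
          simp [h₁, h₂, hfree] at this
        refine Reached.of_insert (hI.addNode hS hv h₁ ht hk) (hR.addNode c hphase _) hS hv
          (fun u => ?_) (fun e' => ?_) fun e' => ?_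
        · rw [mem_range_elim, hI.vert]
          simp
        · rw [mem_range_elim, hI.cut_iff]
          simp [h₁, h₂]
        · simp [hI.edge, h₁, h₂, hfree]
  · have hk : D.IsSpider v → (0 : ZMod 4) = D.phase v := fun ⟨c, hc⟩ => by rw [ht] at hc; cases hc
    obtain ⟨-, ⟨i, h₁⟩, e, h₂⟩ := F.hadamard v ht
    obtain ⟨-, -, o, ho, hob⟩ := hI.exists_cut hv hin h₁
    exact hI.reached_of_one hS hv hin h₁ h₂ hfree ho ht hk
      (hR.gateOne_rename hob (ho ▸ not_mem_inputs i) (ho ▸ mem_outputs i) NodeType.noConfusion 0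
        (fun _ => rfl) (hcut h₂) (not_mem_inputs e) (mem_outputs e) _)
  · have hk : ∀ k : ZMod 4, D.IsSpider v → k = D.phase v :=
      fun k ⟨c, hc⟩ => by rw [ht] at hc; cases hc
    rcases (F.boundary v ht).2 with ⟨⟨i, h₁⟩, h₂⟩ | ⟨h₁, e, h₂⟩
    · obtain ⟨-, -, o, ho, hob⟩ := hI.exists_cut hv hin h₁
      -- At an output the cut is only renamed, since its stand-in already is a boundary vertex.
      -- Keeping the old phase makes the retyping the identity.
      have hX : X.retype o .boundary (X.phase o) = X := by
        have := X.retype_self o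
        rwa [hob] at this
      refine hI.reached_of_retype hS hv hin h₁ h₂ hfree ho ht (hk (X.phase o)) ?_
      rw [hX]
      refine hR.rename hob (ho ▸ not_mem_inputs i) (ho ▸ mem_outputs i) (l := .inl v)
        (.inr (not_mem_bl hvf)) (fun ⟨_, e, he⟩ => h₂ e he) ⟨ht, i, h₁⟩ fun u _ => ?_
      by_cases hu : u = o
      · rw [if_pos hu, hu, Function.update_self]
      · rw [if_neg hu, Function.update_of_ne hu]
    · exact hI.reached_of_wire hS hv h₁ h₂ hfree ht (hk 0)
        (hR.input (hcut h₂) (not_mem_inputs e) (mem_outputs e) (not_mem_bl hvf) ⟨ht, e, h₂⟩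
          fun ⟨_, i, hi⟩ => h₁ i hi)

/-- By `F.free` each end of `u` either lies on a qubit passing through it or has no directed edge;
by `F.free_mate` not both ends are of the second kind. This leaves a gate on two qubits or a
one-legged spider on one. -/
theorem reached_insert_insert (hS : F.Closed S) (hR : F.Reached S) (hv : v ∉ S) (hw : w ∉ S)
    (hvw : v ≠ w) (hin : ∀ e s, F.dir e = some s → D.ends e s = v → D.ends e (!s) ∈ S)
    (hin' : ∀ e s, F.dir e = some s → D.ends e s = w → D.ends e (!s) ∈ S) {u : E}
    {s : Bool} (hu : F.dir u = none) (huv : D.ends u s = v) (huw : D.ends u (!s) = w) :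
    F.Reached (insert w (insert v S)) := by
  have spider : ∀ {x t}, D.ends u t = x → ∃ c, D.type x = .spider c := by
    intro x t hx
    rcases ht : D.type x with c | _ | _
    · exact ⟨c, rfl⟩
    · exact absurd ⟨hu, t, hx⟩ ((F.hadamard x ht).1 u)
    · exact absurd ⟨hu, t, hx⟩ ((F.boundary x ht).1 u)
  obtain ⟨c, hc⟩ := spider huv
  obtain ⟨c', hc'⟩ := spider huw
  obtain ⟨V', E', _, _, X, f, g, hI, hR⟩ := hR
  have hcut : ∀ {x e}, x ∉ S → D.From F.dir x e → Sum.inr e ∉ bl X f := fun hx h =>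
    not_mem_bl (by rw [hI.cut_iff]; exact (from_new hS hx h).2)
  have leaf : ∀ {v w : V} {s : Bool} {c c' : Color}, v ∉ S → w ∉ S → v ≠ w →
      (∀ e s, F.dir e = some s → D.ends e s = v → D.ends e (!s) ∈ S) → D.ends u s = v →
      D.ends u (!s) = w → D.type v = .spider c → D.type w = .spider c' →
      ((∃ e, D.Into F.dir v e) ∧ ∃ e, D.From F.dir v e) →
      ((∀ e, ¬ D.Into F.dir w e) ∧ ∀ e, ¬ D.From F.dir w e) → F.Reached (insert w (insert v S)) := by
    rintro v w s c c' hv hw hvw hin huv huw hc hc' ⟨⟨i, h₁⟩, e, h₂⟩ ⟨h₁w, h₂w⟩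
    obtain ⟨-, -, o, ho, hob⟩ := hI.exists_cut hv hin h₁
    exact hI.reached_of_leaf hS hv hw hvw hin hu huv huw h₁ h₂ h₁w h₂w ho hc hc'
      (hR.leaf_rename hob (ho ▸ not_mem_inputs i) (ho ▸ mem_outputs i) c _ c' _ (hcut hv h₂)
        (not_mem_inputs e) (mem_outputs e) _ _)
  have two : ∀ {v w : V} {s : Bool} {c c' : Color}, c = .Z ∨ c' = .X → v ∉ S → w ∉ S → v ≠ w →
      (∀ e s, F.dir e = some s → D.ends e s = v → D.ends e (!s) ∈ S) →
      (∀ e s, F.dir e = some s → D.ends e s = w → D.ends e (!s) ∈ S) → D.ends u s = v →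
      D.ends u (!s) = w → D.type v = .spider c → D.type w = .spider c' →
      ((∃ e, D.Into F.dir v e) ∧ ∃ e, D.From F.dir v e) →
      ((∃ e, D.Into F.dir w e) ∧ ∃ e, D.From F.dir w e) → F.Reached (insert w (insert v S)) := by
    rintro v w s c c' hcc hv hw hvw hin hin' huv huw hc hc' ⟨⟨i, h₁⟩, e, h₂⟩ ⟨⟨i', h₁w⟩, e', h₂w⟩
    obtain ⟨-, -, o, ho, hob⟩ := hI.exists_cut hv hin h₁
    obtain ⟨-, -, p, hp, hpb⟩ := hI.exists_cut hw hin' h₁w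
    refine hI.reached_of_two hS hv hw hvw hin hin' hu huv huw h₁ h₂ h₁w h₂w ho hp hc hc'
      (hR.two_rename hob hpb ?_ (ho ▸ not_mem_inputs i) (ho ▸ mem_outputs i)
        (hp ▸ not_mem_inputs i') (hp ▸ mem_outputs i') hcc _ _ (hcut hv h₂)
        (not_mem_inputs e) (mem_outputs e) (hcut hw h₂w) (not_mem_inputs e') (mem_outputs e') ?_ _ _)
    · rw [ho, hp]
      rintro h
      obtain rfl := Sum.inr.inj h
      obtain ⟨a, ha, hav⟩ := h₁
      obtain ⟨b, hb, hbw⟩ := h₁w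
      rw [ha, Option.some.injEq] at hb
      subst hb
      exact hvw (hav.symm.trans hbw)
    · intro h
      obtain rfl := Sum.inr.inj h
      obtain ⟨a, ha, hav⟩ := h₂
      obtain ⟨b, hb, hbw⟩ := h₂w
      rw [ha, Option.some.injEq] at hb
      subst hb
      exact hvw (hav.symm.trans hbw)
  -- A colour pair that is not admissible becomes so when the two spiders are exchanged.
  have color : ∀ c c' : Color, ¬ (c = .Z ∨ c' = .X) → c' = .Z ∨ c = .X := by
    rintro (_ | _) (_ | _) <;> simp
  have huv' : D.ends u (!!s) = v := by rwa [Bool.not_not]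
  rcases F.free v u ⟨hu, s, huv⟩ with h | h <;> rcases F.free w u ⟨hu, _, huw⟩ with h' | h'
  · by_cases hcc : c = .Z ∨ c' = .X
    · exact two hcc hv hw hvw hin hin' huv huw hc hc' h h'
    · rw [Set.insert_comm]
      exact two (color c c' hcc) hw hv hvw.symm hin' hin huw huv' hc' hc h' h
  · exact leaf hv hw hvw hin huv huw hc hc' h h'
  · rw [Set.insert_comm]
    exact leaf hw hv hvw.symm hin' huw huv' hc' hc h' h
  · rcases F.free_mate u s hu with ⟨e, he⟩ | ⟨e, he⟩
    · exact absurd (by rwa [huv] at he) (h.1 e)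
    · exact absurd (by rwa [huw] at he) (h'.1 e)

/-- Read a diagram along its orientation. -/
theorem reached_univ [Finite V] (F : D.QubitFlow) (hloop : ∀ e, D.ends e false ≠ D.ends e true)
    (hscalar : ∀ v, (∀ e s, D.ends e s ≠ v) → D.phase v ≠ 2) : F.Reached Set.univ := by
  have h0 : F.Closed ∅ ∧ F.Reached ∅ := by
    refine ⟨⟨fun _ _ _ h => h, fun _ _ _ h => h⟩, _, _, _, _, emptyDiagram, Empty.elim, Empty.elim,
      ⟨⟨fun v => v.elim, fun e => e.elim, fun e => e.elim, fun v => v.elim, fun v => v.elim,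
        fun v => v.elim⟩, fun v => ?_, fun e => ?_, fun e => ?_⟩, Realizable.empty _⟩
    · simp
    · simp [Cut]
    · simp
  -- A maximal closed and reached set exists by finiteness; if it missed a vertex, one of least rank
  -- could be added.
  obtain ⟨S, hmax⟩ := (Set.toFinite {S : Set V | F.Closed S ∧ F.Reached S}).exists_maximal ⟨∅, h0⟩
  obtain ⟨hS, hR⟩ := hmax.prop
  by_contra hne
  have hSne : Sᶜ.Nonempty := by
    rw [Set.nonempty_compl]
    rintro rfl
    exact hne hR
  obtain ⟨v, hv, hmin⟩ := Set.exists_min_image Sᶜ F.rank (Set.toFinite _) hSne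
  -- All vertices of the same rank as `v` are included, since the mate of `v` has to be added in the
  -- same step.
  have hin : ∀ x, F.rank x = F.rank v → ∀ e s, F.dir e = some s → D.ends e s = x →
      D.ends e (!s) ∈ S := by
    intro x hx e s hs hex
    by_contra hmem
    have h₁ := hmin _ hmem
    have h₂ := F.rank_lt e s hs
    rw [hex, hx] at h₂
    exact absurd h₂ (not_lt.2 h₁)
  by_cases hfree : ∃ u, D.Free F.dir v u
  · obtain ⟨u, hu, s, huv⟩ := hfree
    have hrank := F.rank_eq u s hu
    rw [huv] at hrank
    have hvw : v ≠ D.ends u (!s) := by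
      intro h
      rw [← huv] at h
      cases s
      · exact hloop u h
      · exact hloop u h.symm
    have hw : D.ends u (!s) ∉ S := by
      intro h
      have := hS.2 u _ hu h
      rw [Bool.not_not, huv] at this
      exact hv this
    exact hv (hmax.le_of_ge ⟨hS.insert_insert (hin v rfl) (hin _ hrank) hvw hu huv rfl,
      reached_insert_insert hS hR hv hw hvw (hin v rfl) (hin _ hrank) hu huv rfl⟩
      (fun x hx => .inr (.inr hx)) (.inr (.inl rfl)))
  · have hfree := not_exists.1 hfree
    exact hv (hmax.le_of_ge ⟨hS.insert (hin v rfl) hfree,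
      reached_insert hscalar hS hR hv (hin v rfl) hfree⟩ (fun x hx => .inr hx) (.inl rfl))

end reach

end QubitFlow


/-! # The orientation of a measurement-circuit flow -/

section lists

variable {α : Type} {l : List α} {x y z : α}

theorem exists_index_of_infix (h : [x, y] <:+: l) :
    ∃ i, l[i]? = some x ∧ l[i + 1]? = some y := by
  obtain ⟨s, t, rfl⟩ := h
  exact ⟨s.length, by simp, by simp⟩

theorem pred_unique_of_infix (hl : l.Nodup) (h : [x, y] <:+: l) (h' : [z, y] <:+: l) : x = z := by
  obtain ⟨i, hi, hi'⟩ := exists_index_of_infix h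
  obtain ⟨j, hj, hj'⟩ := exists_index_of_infix h'
  have hlt : i + 1 < l.length := by
    by_contra hc
    rw [List.getElem?_eq_none (not_lt.1 hc)] at hi'
    cases hi'
  have := (List.getElem?_inj hlt hl).1 (hi'.trans hj'.symm)
  obtain rfl : i = j := by omega
  exact Option.some.inj (hi.symm.trans hj)

theorem succ_unique_of_infix (hl : l.Nodup) (h : [y, x] <:+: l) (h' : [y, z] <:+: l) : x = z := by
  obtain ⟨i, hi, hi'⟩ := exists_index_of_infix h
  obtain ⟨j, hj, hj'⟩ := exists_index_of_infix h'
  have hlt : i < l.length := by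
    by_contra hc
    rw [List.getElem?_eq_none (not_lt.1 hc)] at hi
    cases hi
  have := (List.getElem?_inj hlt hl).1 (hi.trans hj.symm)
  subst this
  exact Option.some.inj (hi'.symm.trans hj')

theorem exists_succ_of_infix (h : [x, y] <:+: l) (hy : l.getLast? ≠ some y) :
    ∃ z, [y, z] <:+: l := by
  obtain ⟨s, t, rfl⟩ := h
  cases t with
  | nil => simp at hy
  | cons z t => exact ⟨z, s ++ [x], t, by simp⟩

theorem exists_pred_of_infix (h : [x, y] <:+: l) (hx : l.head? ≠ some x) :
    ∃ z, [z, x] <:+: l := by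
  obtain ⟨s, t, rfl⟩ := h
  rcases List.eq_nil_or_concat s with rfl | ⟨s, z, rfl⟩
  · simp at hx
  · exact ⟨z, s, y :: t, by simp⟩

end lists

/-! ### Neighbours and degrees in simple graphs -/

section simple

variable {V E : Type} {D : ZXDiagram V E}

theorem Adj.symm {v w : V} (h : D.Adj v w) : D.Adj w v := by
  obtain ⟨e, h⟩ := h
  exact ⟨e, h.symm⟩

theorem adj_ends (e : E) (s : Bool) : D.Adj (D.ends e s) (D.ends e !s) := by
  cases s
  · exact ⟨e, .inl ⟨rfl, rfl⟩⟩
  · exact ⟨e, .inr ⟨rfl, rfl⟩⟩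

theorem card_le_degree [Fintype E] {v : V} (T : Finset V) (hT : ∀ z ∈ T, D.Adj v z) :
    T.card ≤ D.degree v := by
  refine (Finset.card_le_card (t := (D.legs v).image fun h => D.ends h.1 !h.2) fun z hz => ?_).trans
    Finset.card_image_le
  rw [Finset.mem_image]
  obtain ⟨e, ⟨h₁, h₂⟩ | ⟨h₁, h₂⟩⟩ := hT z hz
  · exact ⟨(e, false), by simp [legs, h₁], h₂⟩
  · exact ⟨(e, true), by simp [legs, h₂], h₁⟩

theorem IsSimple.ends_inj (hD : D.IsSimple) {e e' : E} {s s' : Bool} (h : D.ends e s = D.ends e' s')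
    (h' : D.ends e (!s) = D.ends e' (!s')) : e = e' := by
  apply hD.2
  cases s <;> cases s' <;> simp_all [Sym2.eq_swap]

theorem IsSimple.ne (hD : D.IsSimple) {v w : V} (h : D.Adj v w) : v ≠ w := by
  rintro rfl
  obtain ⟨e, ⟨h, h'⟩ | ⟨h, h'⟩⟩ := h <;> exact hD.1 e (h.trans h'.symm)

theorem eq_of_degree_le_one [Fintype E] {v : V} (h : D.degree v ≤ 1) {e e' : E} {s s' : Bool}
    (he : D.ends e s = v) (he' : D.ends e' s' = v) : e = e' := by
  have := Finset.card_le_one.1 h (e, s) (by simp [legs, he]) (e', s') (by simp [legs, he'])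
  exact congrArg Prod.fst this

end simple

/-! ### Paths at a vertex and the orientation they induce -/

namespace MCFlow

variable {V E : Type} {D : ZXDiagram V E} (φ : D.MCFlow)

/-- The directed edge from `x` to `y` lies on a path. -/
def Cov (x y : V) : Prop := ∃ i, [x, y] <:+: φ.path i

/-- The edge between `x` and `y` lies on the path `i`. -/
def On (i : Fin φ.k) (x y : V) : Prop := [x, y] <:+: φ.path i ∨ [y, x] <:+: φ.path i

variable {φ}

theorem On.adj {i : Fin φ.k} {x y : V} (h : φ.On i x y) : D.Adj x y :=
  h.elim (φ.path_adj i x y) fun h => (φ.path_adj i y x h).symm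

theorem Cov.adj {x y : V} (h : φ.Cov x y) : D.Adj x y := by
  obtain ⟨i, h⟩ := h
  exact φ.path_adj i x y h

theorem Cov.le {x y : V} (h : φ.Cov x y) : φ.order.le x y := by
  obtain ⟨i, h⟩ := h
  exact φ.o1 i x y h

theorem Cov.asymm (hD : D.IsSimple) {x y : V} (h : φ.Cov x y) (h' : φ.Cov y x) : False :=
  hD.ne h.adj (φ.order.le_antisymm _ _ h.le h'.le)

variable [Fintype E]

/-- At a spider with several edges, the paths pass. -/
theorem exists_pass (hφ : φ.WellCovered) {v : V} (hv : D.IsSpider v) (hd : 1 < D.degree v)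
    {i : Fin φ.k} {z : V} (h : φ.On i v z) :
    ∃ x y, [x, v] <:+: φ.path i ∧ [v, y] <:+: φ.path i := by
  have hlast : (φ.path i).getLast? ≠ some v := fun h => absurd (hφ i v hv (.inr h)) (not_le.2 hd)
  have hhead : (φ.path i).head? ≠ some v := fun h => absurd (hφ i v hv (.inl h)) (not_le.2 hd)
  rcases h with h | h
  · obtain ⟨x, hx⟩ := exists_pred_of_infix h hhead
    exact ⟨x, z, hx, h⟩
  · obtain ⟨y, hy⟩ := exists_succ_of_infix h hlast
    exact ⟨z, y, h, hy⟩

/-- At a boundary or Hadamard vertex the path of (P1) covers every edge. At a spider, two different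
paths would both pass and, by (P3), share no edge; this takes four distinct neighbours, against
degree at most three. -/
theorem on_unique (hD : D.IsSimple) (hφ : φ.WellCovered) (hdeg : ∀ v, D.degree v ≤ 3) {v z z' : V}
    {i j : Fin φ.k} (h : φ.On i v z) (h' : φ.On j v z') : i = j := by
  have main : D.type v = .boundary ∨ D.type v = .hadamard → i = j := by
    intro hv
    obtain ⟨k, -, hk⟩ := φ.p1 v hv
    exact (φ.p3 i k v z h (hk z h.adj)).trans (φ.p3 j k v z' h' (hk z' h'.adj)).symm
  rcases hv : D.type v with c | _ | _
  · by_contra hij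
    have dist : ∀ {x y}, φ.On i v x → φ.On j v y → x ≠ y := by
      rintro x _ hx hy rfl
      exact hij (φ.p3 i j v x hx hy)
    have hd : 1 < D.degree v := by
      have := card_le_degree (D := D) (v := v) {z, z'} (by
        intro x hx
        rw [Finset.mem_insert, Finset.mem_singleton] at hx
        rcases hx with rfl | rfl
        exacts [h.adj, h'.adj])
      rw [Finset.card_pair (dist h h')] at this
      omega
    obtain ⟨x, y, hx, hy⟩ := exists_pass hφ ⟨c, hv⟩ hd h
    obtain ⟨x', y', hx', hy'⟩ := exists_pass hφ ⟨c, hv⟩ hd h'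
    have hxy : x ≠ y := by
      rintro rfl
      exact Cov.asymm (φ := φ) hD ⟨i, hx⟩ ⟨i, hy⟩
    have hxy' : x' ≠ y' := by
      rintro rfl
      exact Cov.asymm (φ := φ) hD ⟨j, hx'⟩ ⟨j, hy'⟩
    have := card_le_degree (D := D) (v := v) {x, y, x', y'} (by
      intro u hu
      simp only [Finset.mem_insert, Finset.mem_singleton] at hu
      rcases hu with rfl | rfl | rfl | rfl
      exacts [(φ.path_adj i _ _ hx).symm, φ.path_adj i _ _ hy, (φ.path_adj j _ _ hx').symm,
        φ.path_adj j _ _ hy'])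
    rw [Finset.card_insert_of_notMem, Finset.card_insert_of_notMem, Finset.card_pair hxy'] at this
    · exact absurd (this.trans (hdeg v)) (by norm_num)
    · simp only [Finset.mem_insert, Finset.mem_singleton, not_or]
      exact ⟨dist (.inl hy) (.inr hx'), dist (.inl hy) (.inl hy')⟩
    · simp only [Finset.mem_insert, Finset.mem_singleton, not_or]
      exact ⟨hxy, dist (.inr hx) (.inr hx'), dist (.inr hx) (.inl hy')⟩
  · exact main (.inr hv)
  · exact main (.inl hv)

theorem cov_pred_unique (hD : D.IsSimple) (hφ : φ.WellCovered) (hdeg : ∀ v, D.degree v ≤ 3)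
    {x x' y : V} (h : φ.Cov x y) (h' : φ.Cov x' y) : x = x' := by
  obtain ⟨i, h⟩ := h
  obtain ⟨j, h'⟩ := h'
  obtain rfl := on_unique hD hφ hdeg (.inr h : φ.On i y x) (.inr h' : φ.On j y x')
  exact pred_unique_of_infix (φ.path_nodup i) h h'

theorem cov_succ_unique (hD : D.IsSimple) (hφ : φ.WellCovered) (hdeg : ∀ v, D.degree v ≤ 3)
    {x x' y : V} (h : φ.Cov y x) (h' : φ.Cov y x') : x = x' := by
  obtain ⟨i, h⟩ := h
  obtain ⟨j, h'⟩ := h'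
  obtain rfl := on_unique hD hφ hdeg (.inl h : φ.On i y x) (.inl h' : φ.On j y x')
  exact succ_unique_of_infix (φ.path_nodup i) h h'

variable (φ)

/-- The edge `e` lies on no path. -/
def Uncovered (e : E) : Prop := ∀ s, ¬ φ.Cov (D.ends e !s) (D.ends e s)

/-- The edge `e` lies on no path, and joins two leaves. -/
def Isolated (e : E) : Prop := φ.Uncovered e ∧ ∀ s, D.degree (D.ends e s) = 1

/-- Edges on paths are directed along them, and isolated edges arbitrarily. -/
noncomputable def dir (e : E) : Option Bool :=
  if φ.Cov (D.ends e false) (D.ends e true) then some true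
  else if φ.Cov (D.ends e true) (D.ends e false) then some false
  else if φ.Isolated e then some true else none

variable {φ}

theorem dir_of_cov (hD : D.IsSimple) {e : E} {s : Bool} (h : φ.Cov (D.ends e !s) (D.ends e s)) :
    φ.dir e = some s := by
  cases s
  · have h' : ¬ φ.Cov (D.ends e false) (D.ends e true) := fun h' => Cov.asymm hD h h'
    rw [dir, if_neg h', if_pos]
    exact h
  · exact if_pos h

theorem dir_eq_some {e : E} {s : Bool} (h : φ.dir e = some s) :
    φ.Cov (D.ends e !s) (D.ends e s) ∨ (φ.Isolated e ∧ s = true) := by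
  rw [dir] at h
  split_ifs at h with h₁ h₂ h₃ <;> cases h
  exacts [.inl h₁, .inl h₂, .inr ⟨h₃, rfl⟩]

theorem dir_eq_none {e : E} (h : φ.dir e = none) : φ.Uncovered e ∧ ¬ φ.Isolated e := by
  rw [dir] at h
  split_ifs at h with h₁ h₂ h₃
  refine ⟨?_, h₃⟩
  rintro (_ | _)
  exacts [h₂, h₁]

theorem Cov.exists_edge {x y : V} (h : φ.Cov x y) : ∃ e s, D.ends e (!s) = x ∧ D.ends e s = y := by
  obtain ⟨e, ⟨h₁, h₂⟩ | ⟨h₁, h₂⟩⟩ := h.adj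
  exacts [⟨e, true, h₁, h₂⟩, ⟨e, false, h₂, h₁⟩]

theorem Cov.into (hD : D.IsSimple) {x y : V} (h : φ.Cov x y) : ∃ e, D.Into φ.dir y e := by
  obtain ⟨e, s, rfl, rfl⟩ := h.exists_edge
  exact ⟨e, s, dir_of_cov hD h, rfl⟩

theorem Cov.from (hD : D.IsSimple) {x y : V} (h : φ.Cov x y) : ∃ e, D.From φ.dir x e := by
  obtain ⟨e, s, rfl, rfl⟩ := h.exists_edge
  exact ⟨e, s, dir_of_cov hD h, rfl⟩

theorem Uncovered.not_on {e : E} (h : φ.Uncovered e) (s : Bool) (i : Fin φ.k) :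
    ¬ φ.On i (D.ends e s) (D.ends e !s) := by
  rintro (h' | h')
  · refine h (!s) ⟨i, ?_⟩
    rwa [Bool.not_not]
  · exact h s ⟨i, h'⟩

/-- An uncovered edge ends at a spider. -/
theorem Uncovered.isSpider {e : E} (h : φ.Uncovered e) (s : Bool) : D.IsSpider (D.ends e s) := by
  have main : ¬ (D.type (D.ends e s) = .boundary ∨ D.type (D.ends e s) = .hadamard) := by
    intro hv
    obtain ⟨i, -, hi⟩ := φ.p1 _ hv
    exact h.not_on s i (hi _ (adj_ends e s))
  rcases hv : D.type (D.ends e s) with c | _ | _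
  · exact ⟨c, hv⟩
  · exact absurd (.inr hv) main
  · exact absurd (.inl hv) main

/-- (P2) determines the neighbour across an uncovered edge, and in a simple graph the neighbour
determines the edge. -/
theorem Uncovered.unique (hD : D.IsSimple) {e e' : E} (h : φ.Uncovered e) (h' : φ.Uncovered e')
    {s s' : Bool} (hs : D.ends e s = D.ends e' s') : e = e' := by
  refine hD.ends_inj hs (φ.p2 (D.ends e s) (h.isSpider s) _ _ (adj_ends e s) ?_ (h.not_on s) ?_)
  · rw [hs]
    exact adj_ends e' s'
  · rw [hs]
    exact h'.not_on s'

/-- A path passes at the end of an uncovered edge that is not a leaf. -/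
theorem Uncovered.exists_pass (hD : D.IsSimple) (hφ : φ.WellCovered) {e : E} (h : φ.Uncovered e)
    {s : Bool} (hs : D.degree (D.ends e s) ≠ 1) :
    ∃ x y, φ.Cov x (D.ends e s) ∧ φ.Cov (D.ends e s) y := by
  have mem : (e, s) ∈ D.legs (D.ends e s) := by simp [legs]
  have hd : 1 < D.degree (D.ends e s) := by
    have : 0 < D.degree (D.ends e s) := Finset.card_pos.2 ⟨_, mem⟩
    omega
  obtain ⟨⟨e', s'⟩, he', hne⟩ := Finset.exists_mem_ne hd (e, s)
  have hes : D.ends e' s' = D.ends e s := by simpa [legs] using he'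
  have hcov : ¬ φ.Uncovered e' := by
    intro h'
    obtain rfl := h.unique hD h' hes.symm
    have : s ≠ s' := fun h => hne (by rw [h])
    cases s <;> cases s'
    exacts [this rfl, hD.1 _ hes.symm, hD.1 _ hes, this rfl]
  have hon : ∃ i z, φ.On i (D.ends e s) z := by
    simp only [Uncovered, not_forall, not_not] at hcov
    obtain ⟨t, i, ht⟩ := hcov
    by_cases hts : t = s'
    · subst hts
      exact ⟨i, _, .inr (hes ▸ ht)⟩
    · have : s' = !t := by cases t <;> cases s' <;> simp_all
      subst this
      exact ⟨i, _, .inl (hes ▸ ht)⟩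
  obtain ⟨i, z, hon⟩ := hon
  obtain ⟨x, y, hx, hy⟩ := MCFlow.exists_pass hφ (h.isSpider s) hd hon
  exact ⟨x, y, ⟨i, hx⟩, i, hy⟩

end MCFlow


/-! ### A rank function compatible with the orientation -/

namespace MCFlow

section rank

variable {V E : Type} [Fintype V] [Fintype E] {D : ZXDiagram V E} (φ : D.MCFlow)

/-- The number of vertices below `v`. -/
noncomputable def height (v : V) : ℕ := (Finset.univ.filter fun u => φ.order.lt u v).card

/-- A path leads from `u` to `v` or across an undirected edge from `v`. -/
def Pred (v u : V) : Prop :=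
  φ.Cov u v ∨ ∃ e s, φ.dir e = none ∧ D.ends e s = v ∧ φ.Cov u (D.ends e !s)

/-- A height that only depends on the predecessors. -/
noncomputable def level (v : V) : ℕ := (Finset.univ.filter (φ.Pred v)).sup fun u => φ.height u + 1

/-- A height that increases along directed edges. -/
noncomputable def rank (v : V) : ℕ :=
  2 * φ.level v + if ∃ e, φ.Isolated e ∧ D.ends e true = v then 1 else 0

variable {φ}

theorem height_lt {u v : V} (h : φ.order.le u v) (hne : u ≠ v) : φ.height u < φ.height v := by
  let _ := φ.order
  have huv : u < v := lt_of_le_of_ne h hne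
  refine Finset.card_lt_card ⟨fun x hx => ?_, fun hsub => ?_⟩
  · rw [Finset.mem_filter] at hx ⊢
    exact ⟨hx.1, lt_trans hx.2 huv⟩
  · have := hsub (Finset.mem_filter.2 ⟨Finset.mem_univ u, huv⟩)
    exact lt_irrefl u (Finset.mem_filter.1 this).2

/-- This is where (O2) enters: a predecessor of one end of an uncovered edge also lies below the
other end. -/
theorem Pred.height_lt (hD : D.IsSimple) {u v : V} (h : φ.Pred v u) : φ.height u < φ.height v := by
  rcases h with h | ⟨e, s, he, rfl, i, h⟩
  · exact MCFlow.height_lt h.le (hD.ne h.adj)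
  · have hu := (dir_eq_none he).1
    have hcov : ¬ φ.Cov (D.ends e s) (D.ends e !s) := by
      have := hu (!s)
      rwa [Bool.not_not] at this
    refine MCFlow.height_lt ((φ.o2 i u _ (D.ends e s) h (adj_ends e s).symm).resolve_left hcov) ?_
    rintro rfl
    exact hcov ⟨i, h⟩

/-- All predecessors of `x` have smaller height, whence `level x ≤ height x`; and `x` is itself a
predecessor of `y`, whence `height x < level y`. -/
theorem Cov.level_lt (hD : D.IsSimple) {x y : V} (h : φ.Cov x y) : φ.level x < φ.level y := by
  have h₁ : φ.level x ≤ φ.height x :=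
    Finset.sup_le fun u hu => (Finset.mem_filter.1 hu).2.height_lt hD
  have h₂ : φ.height x + 1 ≤ φ.level y :=
    Finset.le_sup (f := fun u => φ.height u + 1) (Finset.mem_filter.2 ⟨Finset.mem_univ x, .inl h⟩)
  omega

/-- The two ends are each other's only mates and so have the same `Pred`. Their heights may differ,
which is why the rank is built from `level`. -/
theorem level_mate (hD : D.IsSimple) {e : E} (he : φ.dir e = none) (s : Bool) :
    φ.level (D.ends e !s) = φ.level (D.ends e s) := by
  have key : ∀ s u, φ.Pred (D.ends e s) u → φ.Pred (D.ends e !s) u := by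
    rintro s u (h | ⟨e', s', he', hs', h⟩)
    · exact .inr ⟨e, !s, he, rfl, by rwa [Bool.not_not]⟩
    · obtain rfl := (dir_eq_none he').1.unique hD (dir_eq_none he).1 hs'
      have : s' = s := by
        cases s <;> cases s'
        exacts [rfl, absurd hs'.symm (hD.1 _), absurd hs' (hD.1 _), rfl]
      exact .inl (this ▸ h)
  have : φ.Pred (D.ends e !s) = φ.Pred (D.ends e s) := by
    funext u
    refine propext ⟨fun h => ?_, key s u⟩
    have := key _ u h
    rwa [Bool.not_not] at this
  simp only [level, this]

theorem level_eq_zero {v : V} (h : ∀ u, ¬ φ.Pred v u) : φ.level v = 0 := by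
  rw [level, Finset.filter_false_of_mem fun u _ => h u]
  rfl

theorem Isolated.edge_eq {e e' : E} (h : φ.Isolated e) {s s' : Bool}
    (he : D.ends e' s' = D.ends e s) : e' = e :=
  eq_of_degree_le_one (h.2 s).le he rfl

theorem Isolated.dir {e : E} (h : φ.Isolated e) : φ.dir e = some true := by
  have h₁ : ¬ φ.Cov (D.ends e false) (D.ends e true) := h.1 true
  have h₂ : ¬ φ.Cov (D.ends e true) (D.ends e false) := h.1 false
  rw [MCFlow.dir, if_neg h₁, if_neg h₂, if_pos h]

/-- The end of an isolated edge has no other edge, so no path leads to it or to a mate of it, and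
the supremum is empty. -/
theorem Isolated.level {e : E} (h : φ.Isolated e) (s : Bool) : φ.level (D.ends e s) = 0 := by
  refine level_eq_zero ?_
  rintro u (h' | ⟨e', s', he', hs', -⟩)
  · obtain ⟨e', s', rfl, hs'⟩ := h'.exists_edge
    obtain rfl := h.edge_eq hs'
    exact h.1 s' (by rwa [← hs'] at h')
  · obtain rfl := h.edge_eq hs'
    rw [h.dir] at he'
    cases he'

/-- Doubling the level leaves room for the extra unit at the head of an isolated edge, without which
its two ends would both have rank zero. -/
theorem rank_lt (hD : D.IsSimple) {e : E} {s : Bool} (h : φ.dir e = some s) :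
    φ.rank (D.ends e !s) < φ.rank (D.ends e s) := by
  rcases dir_eq_some h with h | ⟨h', rfl⟩
  · have := h.level_lt hD
    unfold rank
    split_ifs <;> omega
  · rw [rank, rank, h'.level, h'.level, if_neg, if_pos ⟨e, h', rfl⟩]
    · norm_num
    · rintro ⟨e', -, he'⟩
      obtain rfl := h'.edge_eq he'
      exact hD.1 _ he'.symm

theorem rank_eq (hD : D.IsSimple) {e : E} (s : Bool) (h : φ.dir e = none) :
    φ.rank (D.ends e !s) = φ.rank (D.ends e s) := by
  have key : ∀ s, ¬ ∃ e', φ.Isolated e' ∧ D.ends e' true = D.ends e s := by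
    rintro s ⟨e', he', hs⟩
    obtain rfl := he'.edge_eq hs.symm
    rw [he'.dir] at h
    cases h
  rw [rank, rank, level_mate hD h, if_neg (key _), if_neg (key _)]

end rank

/-! ### The oriented diagram of a flow -/

section toQubitFlow

variable {V E : Type} [Fintype V] [Fintype E] {D : ZXDiagram V E}

theorem not_into_and_from (hD : D.IsSimple) {dir : E → Option Bool} {v : V} {e : E}
    (h : D.Into dir v e) (h' : D.From dir v e) : False := by
  obtain ⟨s, hs, rfl⟩ := h
  obtain ⟨t, ht, h⟩ := h'
  rw [hs, Option.some.injEq] at ht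
  subst ht
  cases s
  · exact hD.1 _ h.symm
  · exact hD.1 _ h

variable {φ : D.MCFlow}

theorem into_or_from (hD : D.IsSimple) {e : E} (h : ¬ φ.Uncovered e) (s : Bool) :
    D.Into φ.dir (D.ends e s) e ∨ D.From φ.dir (D.ends e s) e := by
  simp only [Uncovered, not_forall, not_not] at h
  obtain ⟨t, ht⟩ := h
  by_cases hts : t = s
  · subst hts
    exact .inl ⟨t, dir_of_cov hD ht, rfl⟩
  · have : s = !t := by cases s <;> cases t <;> simp_all
    subst this
    exact .inr ⟨t, dir_of_cov hD ht, rfl⟩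

theorem into_unique (hD : D.IsSimple) (hφ : φ.WellCovered) (hdeg : ∀ v, D.degree v ≤ 3) {v : V}
    {e e' : E} (h : D.Into φ.dir v e) (h' : D.Into φ.dir v e') : e = e' := by
  obtain ⟨s, hs, rfl⟩ := h
  obtain ⟨s', hs', hv⟩ := h'
  rcases dir_eq_some hs with h | ⟨h, -⟩
  · rcases dir_eq_some hs' with h' | ⟨h', -⟩
    · rw [hv] at h'
      exact hD.ends_inj hv.symm (cov_pred_unique hD hφ hdeg h h')
    · exact h'.edge_eq hv.symm
  · exact (h.edge_eq hv).symm

theorem from_unique (hD : D.IsSimple) (hφ : φ.WellCovered) (hdeg : ∀ v, D.degree v ≤ 3) {v : V}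
    {e e' : E} (h : D.From φ.dir v e) (h' : D.From φ.dir v e') : e = e' := by
  obtain ⟨s, hs, rfl⟩ := h
  obtain ⟨s', hs', hv⟩ := h'
  rcases dir_eq_some hs with h | ⟨h, -⟩
  · rcases dir_eq_some hs' with h' | ⟨h', -⟩
    · rw [hv] at h'
      refine hD.ends_inj hv.symm ?_
      rw [Bool.not_not, Bool.not_not]
      exact cov_succ_unique hD hφ hdeg h h'
    · exact h'.edge_eq hv.symm
  · exact (h.edge_eq hv).symm

/-- The orientation of a flow. -/
noncomputable def toQubitFlow (φ : D.MCFlow) (hW : D.WellFormed) (hD : D.IsSimple)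
    (hφ : φ.WellCovered) (hdeg : ∀ v, D.degree v ≤ 3) : D.QubitFlow where
  dir := φ.dir
  rank := φ.rank
  rank_lt _ _ := rank_lt hD
  rank_eq _ := rank_eq hD
  into_unique _ _ _ := into_unique hD hφ hdeg
  from_unique _ _ _ := from_unique hD hφ hdeg
  free_unique := by
    rintro v e e' ⟨he, s, rfl⟩ ⟨he', s', h⟩
    exact (dir_eq_none he).1.unique hD (dir_eq_none he').1 h.symm
  boundary := by
    intro v hv
    have hspider : ∀ e s, D.ends e s = v → ¬ φ.Uncovered e := by
      rintro e s rfl h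
      obtain ⟨c, hc⟩ := h.isSpider s
      rw [hv] at hc
      cases hc
    refine ⟨?_, ?_⟩
    · rintro e ⟨he, s, hs⟩
      exact hspider e s hs (dir_eq_none he).1
    · have hd := hW.2 v hv
      obtain ⟨⟨e, s⟩, hes⟩ := Finset.card_pos.1 (hd.ge : 0 < (D.legs v).card)
      have hes : D.ends e s = v := by simpa [legs] using hes
      have huniq : ∀ e' s', D.ends e' s' = v → e' = e :=
        fun e' s' h => eq_of_degree_le_one hd.le h hes
      rcases into_or_from hD (hspider e s hes) s with h | h <;> rw [hes] at h
      · refine .inl ⟨⟨e, h⟩, fun e' h' => ?_⟩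
        have := h'
        obtain ⟨t, -, ht⟩ := this
        obtain rfl := huniq e' _ ht
        exact not_into_and_from hD h h'
      · refine .inr ⟨fun e' h' => ?_, e, h⟩
        have := h'
        obtain ⟨t, -, ht⟩ := this
        obtain rfl := huniq e' _ ht
        exact not_into_and_from hD h' h
  hadamard := by
    intro v hv
    have hspider : ∀ e s, D.ends e s = v → ¬ φ.Uncovered e := by
      rintro e s rfl h
      obtain ⟨c, hc⟩ := h.isSpider s
      rw [hv] at hc
      cases hc
    refine ⟨?_, ?_⟩
    · rintro e ⟨he, s, hs⟩
      exact hspider e s hs (dir_eq_none he).1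
    · obtain ⟨⟨e, s⟩, ⟨e', s'⟩, hne, hl⟩ := Finset.card_eq_two.1 (hW.1 v hv)
      have hes : D.ends e s = v := by
        have : (e, s) ∈ D.legs v := by rw [hl]; simp
        simpa [legs] using this
      have hes' : D.ends e' s' = v := by
        have : (e', s') ∈ D.legs v := by rw [hl]; simp
        simpa [legs] using this
      have hee : e ≠ e' := by
        rintro rfl
        have : s ≠ s' := fun h => hne (by rw [h])
        cases s <;> cases s'
        exacts [this rfl, hD.1 _ (hes.trans hes'.symm), hD.1 _ (hes'.trans hes.symm), this rfl]
      rcases into_or_from hD (hspider e s hes) s with h | h <;>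
        rcases into_or_from hD (hspider e' s' hes') s' with h' | h' <;> rw [hes] at h <;>
        rw [hes'] at h'
      · exact absurd (into_unique hD hφ hdeg h h') hee
      · exact ⟨⟨e, h⟩, e', h'⟩
      · exact ⟨⟨e', h'⟩, e, h⟩
      · exact absurd (from_unique hD hφ hdeg h h') hee
  free := by
    rintro v e ⟨he, s, rfl⟩
    -- A leaf has no edge besides the free one; at any other end of a free edge a path passes.
    by_cases hd : D.degree (D.ends e s) = 1
    · right
      constructor
      · rintro e' ⟨t, ht, h⟩
        obtain rfl := eq_of_degree_le_one hd.le h rfl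
        rw [he] at ht
        cases ht
      · rintro e' ⟨t, ht, h⟩
        obtain rfl := eq_of_degree_le_one hd.le h rfl
        rw [he] at ht
        cases ht
    · obtain ⟨x, y, hx, hy⟩ := (dir_eq_none he).1.exists_pass hD hφ hd
      exact .inl ⟨hx.into hD, hy.from hD⟩
  free_mate := by
    intro e s he
    obtain ⟨hu, hi⟩ := dir_eq_none he
    -- Otherwise `e` would be isolated, and isolated edges are directed.
    have : ∃ t, D.degree (D.ends e t) ≠ 1 := by
      by_contra hc
      push Not at hc
      exact hi ⟨hu, hc⟩
    obtain ⟨t, ht⟩ := this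
    obtain ⟨x, y, hx, -⟩ := hu.exists_pass hD hφ ht
    by_cases hts : t = s
    · subst hts
      exact .inl (hx.into hD)
    · have : t = !s := by cases s <;> cases t <;> simp_all
      subst this
      exact .inr (hx.into hD)

/-- The directed edges outside the paths are the isolated ones, and these end at spiders; at
boundary vertices the orientation shows exactly the flow. -/
theorem isInput_iff (hD : D.IsSimple) (b : D.Boundary) :
    φ.IsInput b ↔ ∃ e, D.From φ.dir b.1 e := by
  constructor
  · rintro ⟨i, y, h⟩
    exact Cov.from hD (⟨i, h⟩ : φ.Cov b.1 y)
  · rintro ⟨e, s, hs, hb⟩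
    rcases dir_eq_some hs with h | ⟨h, -⟩
    · rw [hb] at h
      obtain ⟨i, h⟩ := h
      exact ⟨i, _, h⟩
    · obtain ⟨c, hc⟩ := h.1.isSpider (!s)
      rw [hb, b.2] at hc
      cases hc

theorem isOutput_iff (hD : D.IsSimple) (b : D.Boundary) :
    φ.IsOutput b ↔ ∃ e, D.Into φ.dir b.1 e := by
  constructor
  · rintro ⟨i, y, h⟩
    exact Cov.into hD (⟨i, h⟩ : φ.Cov y b.1)
  · rintro ⟨e, s, hs, hb⟩
    rcases dir_eq_some hs with h | ⟨h, -⟩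
    · rw [hb] at h
      obtain ⟨i, h⟩ := h
      exact ⟨i, _, h⟩
    · obtain ⟨c, hc⟩ := h.1.isSpider s
      rw [hb, b.2] at hc
      cases hc

end toQubitFlow

end MCFlow


/-! # Renaming vertices and edges -/

section reindex

variable {V E V' E' : Type} [Fintype V] [Fintype E] [Fintype V'] [Fintype E']

/-- Renaming vertices and edges, and turning edges around. -/
theorem exists_net_reindex {ends : E → Bool → V} {ends' : E' → Bool → V'} (vert : V' ≃ V)
    (edge : E' ≃ E) (h : ∀ e, ∃ r, ∀ s, vert (ends' e (xor r s)) = ends (edge e) s)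
    (ε : E → Pauli) : ∃ s : ℂ, s ≠ 0 ∧ ∀ T : V → Multiset Bool → ℂ,
      net ends' (fun v => T (vert v)) (fun e => ε (edge e)) = s * net ends T ε := by
  choose r hr using h
  refine ⟨∏ e, if r e then sgn ((ε (edge e)).1 && (ε (edge e)).2) else 1,
    Finset.prod_ne_zero_iff.2 fun e _ => ?_, fun T => ?_⟩
  · split_ifs
    exacts [sgn_ne_zero _, one_ne_zero]
  -- Labellings are transported along the renaming, with the two labels exchanged on every edge that
  -- is turned around.
  let i : (E → Bool → Bool) ≃ (E' → Bool → Bool) :=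
    { toFun := fun x e s => x (edge e) (xor (r e) s)
      invFun := fun x e s => x (edge.symm e) (xor (r (edge.symm e)) s)
      left_inv := fun x => by
        funext e s
        simp
      right_inv := fun x => by
        funext e s
        simp }
  have hlabels : ∀ x v, labels ends' (i x) v = labels ends x (vert v) := by
    intro x v
    unfold labels
    rw [← edge.sum_comp]
    refine Finset.sum_congr rfl fun e _ => ?_
    have h₁ : ∀ s, ends' e (xor (r e) s) = v ↔ ends (edge e) s = vert v := fun s => by
      rw [← hr, vert.apply_eq_iff_eq]
    show ∑ s, (if ends' e s = v then {x (edge e) (xor (r e) s)} else 0) = _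
    simp only [← h₁]
    cases r e <;> simp [add_comm]
  unfold net
  rw [← i.sum_comp, Finset.mul_sum]
  refine Finset.sum_congr rfl fun x _ => ?_
  have hedge : ∀ e, edgeMat (ε (edge e)) (i x e false) (i x e true) =
      (if r e then sgn ((ε (edge e)).1 && (ε (edge e)).2) else 1) *
        edgeMat (ε (edge e)) (x (edge e) false) (x (edge e) true) := by
    intro e
    show edgeMat _ (x (edge e) (xor (r e) false)) (x (edge e) (xor (r e) true)) = _
    cases r e
    · simp
    · simpa using edgeMat_comm _ _ _
  simp only [hlabels, hedge, Finset.prod_mul_distrib]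
  rw [vert.prod_comp fun v => T v (labels ends x v),
    edge.prod_comp fun e => edgeMat (ε e) (x e false) (x e true)]
  ring

theorem wt_comp_equiv (edge : E' ≃ E) (ε : E → Pauli) : wt (fun e => ε (edge e)) = wt ε := by
  rw [wt_eq_sum, wt_eq_sum, edge.sum_comp fun e => (ε e).wt]

theorem FaultEquiv.of_equiv {L : Type} {D : ZXDiagram V E} {X : ZXDiagram V' E'} {ℓ : V → L}
    {ℓ' : V' → L} (vert : V' ≃ V) (edge : E' ≃ E)
    (h : ∀ e, ∃ r, ∀ s, vert (X.ends e (xor r s)) = D.ends (edge e) s)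
    (htype : ∀ v, X.type v = D.type (vert v))
    (hphase : ∀ v, D.IsSpider (vert v) → X.phase v = D.phase (vert v))
    (hℓ : ∀ v, ℓ' v = ℓ (vert v)) : FaultEquiv D ℓ X ℓ' := by
  have key : ∀ ε : E → Pauli, ∃ s : ℂ, s ≠ 0 ∧ ∀ β,
      interpL X ℓ' (fun e => ε (edge e)) β = s * interpL D ℓ ε β := by
    intro ε
    obtain ⟨s, hs, hn⟩ := exists_net_reindex vert edge h ε
    refine ⟨s, hs, fun β => ?_⟩
    unfold interpL
    rw [← hn]
    refine net_congr fun v x => ?_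
    rw [htype, hℓ]
    rcases hv : D.type (vert v) with c | _ | _
    · rw [hphase v ⟨c, hv⟩]
    · rfl
    · rfl
  constructor
  · intro ε
    obtain ⟨s, hs, hn⟩ := key ε
    refine ⟨_, (wt_comp_equiv edge ε).le, s⁻¹, inv_ne_zero hs, fun β => ?_⟩
    rw [hn, inv_mul_cancel_left₀ hs]
  · intro ε
    obtain ⟨s, hs, hn⟩ := key fun e => ε (edge.symm e)
    simp only [Equiv.symm_apply_apply] at hn
    exact ⟨_, (wt_comp_equiv edge.symm ε).le, s, hs, hn⟩

/-- The part induced by all vertices is the whole diagram. -/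
theorem QubitFlow.Induced.faultEquiv {D : ZXDiagram V E} {F : D.QubitFlow} {X : ZXDiagram V' E'}
    {f : V' → V ⊕ E} {g : E' → E} (h : F.Induced Set.univ X f g) :
    (∀ v, ∃ u, f v = .inl u) ∧ FaultEquiv D Sum.inl X f := by
  have hf : ∀ v, ∃ u, f v = .inl u := by
    intro v
    rcases hv : f v with u | e
    · exact ⟨u, rfl⟩
    · obtain ⟨s, -, -, hs⟩ := (h.cut_iff e).1 ⟨v, hv⟩
      exact absurd trivial hs
  refine ⟨hf, ?_⟩
  choose u hu using hf
  have hvert : Function.Bijective u := by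
    refine ⟨fun v w hvw => h.vert_inj (by rw [hu, hu, hvw]), fun v => ?_⟩
    obtain ⟨w, hw⟩ := (h.vert v).2 trivial
    exact ⟨w, Sum.inl.inj ((hu w).symm.trans hw)⟩
  have hedge : Function.Bijective g :=
    ⟨h.edge_inj, fun e => (h.edge e).2 ⟨false, trivial⟩⟩
  refine FaultEquiv.of_equiv (Equiv.ofBijective u hvert) (Equiv.ofBijective g hedge) (fun e => ?_)
    (fun v => h.type_eq v _ (hu v)) (fun v => h.phase_eq v _ (hu v)) hu
  obtain ⟨r, hr⟩ := h.ends e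
  refine ⟨r, fun s => Sum.inl.inj (β := E) ?_⟩
  refine (hu _).symm.trans ((hr s).trans ?_)
  rw [place, if_pos ((h.vert _).2 trivial)]
  rfl

end reindex


/-! # Diagrams in a context -/

section plug

variable {V E V' E' W F : Type} [Fintype V] [Fintype E] [Fintype V'] [Fintype E'] [Fintype W]
  [Fintype F]

theorem ite_iff_congr {α : Type} {p q : Prop} {_ : Decidable p} {_ : Decidable q} (h : p ↔ q)
    (a b : α) : (if p then a else b) = if q then a else b := by
  simp only [h]

theorem prod_congr_inst {ι : Type} {i₁ i₂ : Fintype ι} {f g : ι → ℂ} (h : ∀ a, f a = g a) :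
    @Finset.prod ι ℂ _ (@Finset.univ ι i₁) f = @Finset.prod ι ℂ _ (@Finset.univ ι i₂) g := by
  obtain rfl := Subsingleton.elim i₁ i₂
  exact Finset.prod_congr rfl fun a _ => h a

theorem sum_sum_arrow {inst : Fintype (E ⊕ F → Bool → Bool)} (f : (E ⊕ F → Bool → Bool) → ℂ) :
    ∑ x, f x = ∑ y : E → Bool → Bool, ∑ z : F → Bool → Bool, f (Sum.elim y z) := by
  refine (Fintype.sum_equiv (Equiv.sumArrowEquivProdArrow E F (Bool → Bool)) f
    (fun p => f (Sum.elim p.1 p.2)) fun x => congrArg f ?_).trans (Fintype.sum_prod_type _)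
  exact (Sum.elim_comp_inl_inr x).symm

/-- The interpretation of `D` with flips `ε`. -/
noncomputable def interpB (D : ZXDiagram V E) (ε : E → Pauli) (β : D.Boundary → Bool) : ℂ :=
  net D.ends (fun v => if h : D.type v = .boundary then nodeVal .boundary 0 (β ⟨v, h⟩)
    else nodeVal (D.type v) (D.phase v) false) ε

theorem interpErr_eq_interpB (D : ZXDiagram V E) (err : D.Error) (β : D.Boundary → Bool) :
    D.interpErr err β = interpB D err.flips β := by
  rw [interpErr_eq D err β (fun v => if h : D.type v = .boundary then β ⟨v, h⟩ else false)
    fun v => by rw [dif_pos v.2]]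
  refine net_congr fun v x => ?_
  by_cases h : D.type v = .boundary
  · rw [dif_pos h, dif_pos h, h]
    rfl
  · rw [dif_neg h, dif_neg h]

theorem interpL_eq_interpB {L : Type} {D : ZXDiagram V E} {ℓ : V → L} {ε : E → Pauli} {β : L → Bool}
    {b : D.Boundary → Bool} (h : ∀ v : D.Boundary, β (ℓ v) = b v) :
    interpL D ℓ ε β = interpB D ε b := by
  refine net_congr fun v x => ?_
  by_cases hv : D.type v = .boundary
  · rw [dif_pos hv, ← h ⟨v, hv⟩, hv]
    rfl
  · rw [dif_neg hv, nodeVal_congr fun h => absurd h hv]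

/-- The contraction of the context, with labels `β` at the legs and `b` at the boundary. -/
noncomputable def ctx {B : Type} [Fintype B] (K : ZXContext B W F) (ε : F → Pauli) (b : W → Bool)
    (β : B → Bool) : ℂ :=
  ∑ z : F → Bool → Bool, (∏ w, nodeVal (K.type w) (K.phase w) (b w)
    ((∑ l, if K.attach l = w then {β l} else 0) + labels K.ends z w)) *
      ∏ e, edgeMat (ε e) (z e false) (z e true)

theorem ctx_transport {B B' : Type} [Fintype B] [Fintype B'] (K : ZXContext B W F) (σ : B ≃ B')
    (ε : F → Pauli) (b : W → Bool) (β : B' → Bool) :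
    ctx (K.transport σ) ε b β = ctx K ε b fun l => β (σ l) := by
  have : ∀ w, (∑ l, if (K.transport σ).attach l = w then ({β l} : Multiset Bool) else 0) =
      ∑ l, if K.attach l = w then {β (σ l)} else 0 := by
    intro w
    rw [← σ.sum_comp]
    simp [ZXContext.transport]
  simp only [ctx, this]
  rfl

/-- The interpretation of `D` in the context `K`, with labels `b` at the boundary of `K`. -/
noncomputable def interpP (D : ZXDiagram V E) [Fintype D.Interior] (K : ZXContext D.Boundary W F)
    (ε : E ⊕ F → Pauli) (b : W → Bool) : ℂ :=
  net (K.plug D).ends (Sum.elim (fun v => nodeVal (D.type v) (D.phase v) false)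
    fun w => nodeVal (K.type w) (K.phase w) (b w)) ε

theorem labels_plug_inl {V W : Type} (D : ZXDiagram V E) (K : ZXContext D.Boundary W F)
    (x : E ⊕ F → Bool → Bool) (v : D.Interior) :
    labels (K.plug D).ends x (.inl v) = labels D.ends (fun e => x (.inl e)) v.1 := by
  unfold labels
  refine (Fintype.sum_sum_type _).trans ((congrArg₂ (· + ·) ?_ ?_).trans (add_zero _))
  · refine Finset.sum_congr rfl fun e _ => Finset.sum_congr rfl fun s _ => ite_iff_congr ?_ _ _
    by_cases h : D.type (D.ends e s) = .boundary
    · simp only [ZXContext.plug, Sum.elim_inl, dif_pos h, reduceCtorEq, false_iff]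
      intro h'
      exact v.2 (h' ▸ h)
    · simp only [ZXContext.plug, Sum.elim_inl, dif_neg h, Sum.inl.injEq]
      exact Subtype.ext_iff
  · refine Finset.sum_eq_zero fun f _ => ?_
    exact Finset.sum_eq_zero fun s _ => if_neg (by simp [ZXContext.plug])

/-- An end at a boundary vertex of `D` is redirected to the vertex where that leg is attached, and
its label joins the labels there. -/
theorem labels_plug_inr {W : Type} (D : ZXDiagram V E) (K : ZXContext D.Boundary W F)
    (x : E ⊕ F → Bool → Bool) (w : W) :
    labels (K.plug D).ends x (.inr w) =
      (∑ l, if K.attach l = w then labels D.ends (fun e => x (.inl e)) l.1 else 0) +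
        labels K.ends (fun e => x (.inr e)) w := by
  unfold labels
  refine (Fintype.sum_sum_type _).trans (congrArg₂ (· + ·) ?_ ?_)
  · have h₁ : ∀ l : D.Boundary, (if K.attach l = w then
        ∑ e, ∑ s, if D.ends e s = l.1 then ({x (.inl e) s} : Multiset Bool) else 0 else 0) =
        ∑ e, ∑ s, if D.ends e s = l.1 ∧ K.attach l = w then {x (.inl e) s} else 0 := by
      intro l
      by_cases h : K.attach l = w <;> simp [h]
    refine Eq.trans ?_ ((Finset.sum_congr rfl fun l _ => h₁ l).trans Finset.sum_comm).symm
    refine Finset.sum_congr rfl fun e _ => ?_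
    refine Eq.trans ?_ Finset.sum_comm
    refine Finset.sum_congr rfl fun s _ => ?_
    by_cases h : D.type (D.ends e s) = .boundary
    · rw [Finset.sum_eq_single ⟨D.ends e s, h⟩]
      · simp [ZXContext.plug, h]
      · intro l _ hl
        exact if_neg fun h' => hl (Subtype.ext h'.1.symm)
      · simp
    · rw [Finset.sum_eq_zero, if_neg]
      · simp [ZXContext.plug, h]
      · intro l _
        exact if_neg fun h' : D.ends e s = l.1 ∧ K.attach l = w => h (h'.1 ▸ l.2)
  · refine Finset.sum_congr rfl fun e _ => Finset.sum_congr rfl fun s _ => ite_iff_congr ?_ _ _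
    simp [ZXContext.plug]

/-- Each boundary vertex of `D` has one label, and its delta tensor selects exactly one outer
labelling `β` for a given labelling of the edges; under this `β` the context sees the labels it sees
in the whole diagram. Thus the inside can be contracted first. -/
theorem interpP_eq (D : ZXDiagram V E) [Fintype D.Interior]
    (hD : ∀ v, D.type v = .boundary → D.degree v = 1) (K : ZXContext D.Boundary W F)
    (ε : E ⊕ F → Pauli) (b : W → Bool) :
    interpP D K ε b = ∑ β, interpB D (fun e => ε (.inl e)) β * ctx K (fun e => ε (.inr e)) b β := by
  have split : ∀ (y : E → Bool → Bool) (β : D.Boundary → Bool),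
      (∏ v, (if h : D.type v = .boundary then nodeVal .boundary 0 (β ⟨v, h⟩)
        else nodeVal (D.type v) (D.phase v) false) (labels D.ends y v)) =
      (∏ l : D.Boundary, nodeVal .boundary 0 (β l) (labels D.ends y l.1)) *
        ∏ v : D.Interior, nodeVal (D.type v.1) (D.phase v.1) false (labels D.ends y v.1) := by
    intro y β
    rw [← Fintype.prod_subtype_mul_prod_subtype (fun v => D.type v = .boundary)]
    congr 1
    · exact Finset.prod_congr rfl fun l _ => by rw [dif_pos l.2]
    · exact prod_congr_inst fun v => by rw [dif_neg v.2]
  unfold interpP net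
  rw [sum_sum_arrow]
  have hγ : ∀ y : E → Bool → Bool, ∃ γ : D.Boundary → Bool, ∀ l, labels D.ends y l.1 = {γ l} := by
    intro y
    have : ∀ l : D.Boundary, ∃ γ, labels D.ends y l.1 = {γ} := fun l =>
      Multiset.card_eq_one.1 ((card_labels D y l.1).trans (hD l.1 l.2))
    choose γ hγ using this
    exact ⟨γ, hγ⟩
  simp only [interpB, net, Finset.sum_mul]
  refine Eq.trans ?_ Finset.sum_comm
  refine Finset.sum_congr rfl fun y _ => ?_
  obtain ⟨γ, hγ⟩ := hγ y
  rw [Finset.sum_eq_single γ]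
  · rw [split, Finset.prod_eq_one, one_mul]
    · simp only [ctx, Finset.mul_sum]
      refine Finset.sum_congr rfl fun z _ => ?_
      rw [Fintype.prod_sum_type, Fintype.prod_sum_type]
      simp only [Sum.elim_inl, Sum.elim_inr, labels_plug_inl, labels_plug_inr,
        hγ]
      ring
    · intro l _
      rw [hγ, nodeVal_boundary, if_pos rfl]
  · intro β _ hβ
    obtain ⟨l, hl⟩ := Function.ne_iff.1 hβ
    rw [split, Finset.prod_eq_zero (Finset.mem_univ l)]
    · ring
    · rw [hγ, nodeVal_boundary, if_neg hl.symm]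
  · simp

end plug


/-! # Distance-preserving rewrites from simulation of errors -/

section distance

variable {V E V' E' W F : Type} [Fintype V] [Fintype E] [Fintype V'] [Fintype E'] [Fintype W]
  [Fintype F]

theorem wt_sum (ε : E ⊕ F → Pauli) : wt ε = wt (fun e => ε (.inl e)) + wt fun e => ε (.inr e) := by
  simp only [wt_eq_sum, Fintype.sum_sum_type]

theorem flips_empty (D : ZXDiagram V E) : (∅ : D.Error).flips = fun _ => (false, false) := by
  funext e
  simp [Error.flips]

theorem eq_zero_of_wt_le {ε : E → Pauli} (h : wt ε ≤ wt fun _ : E => (false, false)) :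
    ε = fun _ => (false, false) := by
  funext e
  have h₀ : wt (fun _ : E => (false, false)) = 0 := by simp [wt]
  rw [h₀, Nat.le_zero, wt, Finset.card_eq_zero, Finset.filter_eq_empty_iff] at h
  exact not_not.1 (h (Finset.mem_univ e))

theorem interpErr_plug (D : ZXDiagram V E) [Fintype D.Interior] (K : ZXContext D.Boundary W F)
    (err : (K.plug D).Error) (b : W → Bool) :
    (K.plug D).interpErr err (fun v => Sum.elim (fun _ => false) b v.1) =
      interpP D K err.flips b := by
  rw [interpErr_eq (K.plug D) err _ (Sum.elim (fun _ => false) b) fun _ => rfl]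
  refine net_congr fun v x => ?_
  cases v <;> rfl

theorem exists_eq_elim {D : ZXDiagram V E} {K : ZXContext D.Boundary W F}
    (β : (K.plug D).Boundary → Bool) :
    ∃ b : W → Bool, β = fun v => Sum.elim (fun _ => false) b v.1 := by
  refine ⟨fun w => if h : (K.plug D).type (.inr w) = .boundary then β ⟨.inr w, h⟩ else false, ?_⟩
  funext ⟨v, hv⟩
  rcases v with v | w
  · exact absurd hv v.2
  · simp only [Sum.elim_inr, dif_pos (show (K.plug D).type (.inr w) = .boundary from hv)]

theorem eqUpToScalar_plug {D : ZXDiagram V E} [Fintype D.Interior] {K : ZXContext D.Boundary W F}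
    {err err' : (K.plug D).Error} :
    EqUpToScalar ((K.plug D).interpErr err) ((K.plug D).interpErr err') ↔
      ∃ c : ℂ, c ≠ 0 ∧ ∀ b, interpP D K err.flips b = c * interpP D K err'.flips b := by
  refine exists_congr fun c => and_congr_right fun _ => ?_
  constructor
  · intro h b
    rw [← interpErr_plug, ← interpErr_plug, h]
    rfl
  · intro h
    funext β
    obtain ⟨b, rfl⟩ := exists_eq_elim β
    rw [interpErr_plug, h, ← interpErr_plug]
    rfl

theorem detectable_plug {D : ZXDiagram V E} [Fintype D.Interior] {K : ZXContext D.Boundary W F}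
    {err : (K.plug D).Error} : err.Detectable ↔ ∀ b, interpP D K err.flips b = 0 := by
  constructor
  · intro h b
    rw [← interpErr_plug, h]
    rfl
  · intro h
    funext β
    obtain ⟨b, rfl⟩ := exists_eq_elim β
    rw [interpErr_plug, h]
    rfl

/-- Every error of `D₂` is an error of `D₁` of at most the same weight. -/
def SimB (D₁ : ZXDiagram V E) (D₂ : ZXDiagram V' E') (σ : D₁.Boundary ≃ D₂.Boundary) : Prop :=
  ∀ ε₂ : E' → Pauli, ∃ ε₁ : E → Pauli, wt ε₁ ≤ wt ε₂ ∧ ∃ s : ℂ, s ≠ 0 ∧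
    ∀ β, interpB D₂ ε₂ β = s * interpB D₁ ε₁ fun v => β (σ v)

variable {D₁ : ZXDiagram V E} {D₂ : ZXDiagram V' E'} {σ : D₁.Boundary ≃ D₂.Boundary}

/-- The whole tensor is linear in the tensor of the inner diagram, so flips on the edges of the
context are simply copied. -/
theorem SimB.plug (h : SimB D₁ D₂ σ) (h₁ : ∀ v, D₁.type v = .boundary → D₁.degree v = 1)
    (h₂ : ∀ v, D₂.type v = .boundary → D₂.degree v = 1) [Fintype D₁.Interior] [Fintype D₂.Interior]
    (K : ZXContext D₁.Boundary W F) (ε₂ : E' ⊕ F → Pauli) : ∃ ε₁ : E ⊕ F → Pauli, wt ε₁ ≤ wt ε₂ ∧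
      ∃ s : ℂ, s ≠ 0 ∧ ∀ b, interpP D₂ (K.transport σ) ε₂ b = s * interpP D₁ K ε₁ b := by
  obtain ⟨ε₁, hw, s, hs, hε⟩ := h fun e => ε₂ (.inl e)
  refine ⟨Sum.elim ε₁ fun e => ε₂ (.inr e), ?_, s, hs, fun b => ?_⟩
  · rw [wt_sum, wt_sum ε₂]
    exact Nat.add_le_add_right hw _
  · rw [interpP_eq D₂ h₂, interpP_eq D₁ h₁, Finset.mul_sum]
    refine Fintype.sum_equiv (σ.symm.arrowCongr (Equiv.refl Bool)) _ _ fun β => ?_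
    rw [hε, ctx_transport, mul_assoc]
    rfl

/-- The empty error is simulated by one of weight zero, which is empty: equality of the
interpretations is a special case of simulation. -/
theorem SimB.semEquiv (h : SimB D₁ D₂ σ) : SemEquiv D₁ D₂ σ := by
  obtain ⟨ε₁, hw, s, hs, hε⟩ := h fun _ => (false, false)
  have hw' : wt ε₁ ≤ wt fun _ : E => (false, false) := hw.trans (by simp [wt])
  obtain rfl := eq_zero_of_wt_le hw'
  refine ⟨s, hs, funext fun b => ?_⟩
  show D₂.interpErr ∅ _ = s * D₁.interpErr ∅ b
  rw [interpErr_eq_interpB, interpErr_eq_interpB, flips_empty, flips_empty, hε]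
  simp only [Equiv.symm_apply_apply]

/-- A non-trivial undetectable error of the second diagram yields one of the first that is no
heavier: simulation preserves vanishing, and comparison with the error-free interpretations, which
also agree up to a scalar, preserves non-triviality. -/
theorem SimB.distanceNonDecreasing (h : SimB D₁ D₂ σ)
    (h₁ : ∀ v, D₁.type v = .boundary → D₁.degree v = 1)
    (h₂ : ∀ v, D₂.type v = .boundary → D₂.degree v = 1) : DistanceNonDecreasing D₁ D₂ σ := by
  intro W F _ _ K _
  let _ := Fintype.ofFinite D₁.Interior
  let _ := Fintype.ofFinite D₂.Interior
  show (K.plug D₁).dist ≤ ((K.transport σ).plug D₂).dist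
  refine le_iInf₂ fun err₂ herr => ?_
  obtain ⟨ε₁, hw, s, hs, hε⟩ := h.plug h₁ h₂ K err₂.flips
  obtain ⟨err₁, rfl⟩ := exists_flips_eq (K.plug D₁) ε₁
  -- The empty error is simulated as well, necessarily by the empty error; this relates the
  -- error-free interpretations.
  obtain ⟨ε₀, hw₀, s₀, hs₀, hε₀⟩ := h.plug h₁ h₂ K (∅ : ((K.transport σ).plug D₂).Error).flips
  have hw₀' : wt ε₀ ≤ wt fun _ : E ⊕ F => (false, false) := by
    refine hw₀.trans ?_
    rw [flips_empty]
    simp [wt]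
  obtain rfl := eq_zero_of_wt_le hw₀'
  refine iInf₂_le_of_le err₁ ⟨fun ht => herr.1 ?_, fun hd => herr.2 ?_⟩ ?_
  · obtain ⟨c, hc, ht⟩ := eqUpToScalar_plug.1 ht
    refine eqUpToScalar_plug.2 ⟨s * c * s₀⁻¹, mul_ne_zero (mul_ne_zero hs hc) (inv_ne_zero hs₀),
      fun b => ?_⟩
    rw [hε, ht, hε₀, flips_empty]
    field_simp
  · rw [detectable_plug] at hd ⊢
    intro b
    rw [hε, hd, mul_zero]
  · rw [Error.weight_eq, Error.weight_eq]
    exact_mod_cast hw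

theorem Sim.simB {L : Type} {ℓ₁ : V → L} {ℓ₂ : V' → L} (h : Sim D₂ ℓ₂ D₁ ℓ₁) (hL : Lbl D₂ ℓ₂)
    (hσ : ∀ v, ℓ₂ (σ v) = ℓ₁ v) : SimB D₁ D₂ σ := by
  intro ε₂
  obtain ⟨ε₁, hw, s, hs, hε⟩ := h ε₂
  refine ⟨ε₁, hw, s, hs, fun β => ?_⟩
  have hinj : Function.Injective fun v : D₂.Boundary => ℓ₂ v :=
    fun v w hvw => Subtype.ext (hL.inj _ _ v.2 w.2 hvw)
  -- Labels of the boundary vertices extend to all names because the names are distinct; the value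
  -- `false` elsewhere is never read.
  have hβ : ∀ v : D₂.Boundary, Function.extend (fun v : D₂.Boundary => ℓ₂ v) β (fun _ => false) (ℓ₂ v) =
      β v := hinj.extend_apply β _
  rw [← interpL_eq_interpB hβ, hε, interpL_eq_interpB fun v => by rw [← hσ, hβ]]

theorem FaultEquiv.distancePreserving {L : Type} {ℓ₁ : V → L} {ℓ₂ : V' → L}
    (h : FaultEquiv D₁ ℓ₁ D₂ ℓ₂) (hL₁ : Lbl D₁ ℓ₁) (hL₂ : Lbl D₂ ℓ₂)
    (hσ : ∀ v, ℓ₂ (σ v) = ℓ₁ v) : DistancePreserving D₁ D₂ σ := by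
  have h₁ : SimB D₁ D₂ σ := h.2.simB hL₂ hσ
  have h₂ : SimB D₂ D₁ σ.symm := h.1.simB hL₁ fun v => by rw [← hσ, σ.apply_symm_apply]
  exact ⟨h₁.semEquiv, h₁.distanceNonDecreasing hL₁.degree hL₂.degree,
    h₂.distanceNonDecreasing hL₂.degree hL₁.degree⟩

/-- The bijection of boundary vertices with equal labels. -/
theorem exists_boundary_equiv {L : Type} {ℓ₁ : V → L} {ℓ₂ : V' → L} (hL₁ : Lbl D₁ ℓ₁)
    (hL₂ : Lbl D₂ ℓ₂) (h : bl D₁ ℓ₁ = bl D₂ ℓ₂) :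
    ∃ σ : D₁.Boundary ≃ D₂.Boundary, ∀ v, ℓ₂ (σ v) = ℓ₁ v := by
  have hex : ∀ v : D₁.Boundary, ∃ w : D₂.Boundary, ℓ₂ w = ℓ₁ v := fun v => by
    obtain ⟨w, hw, e⟩ := exists_of_bl_eq h v.2
    exact ⟨⟨w, hw⟩, e⟩
  choose τ hτ using hex
  have hbij : Function.Bijective τ := by
    constructor
    · intro v w hvw
      exact Subtype.ext (hL₁.inj _ _ v.2 w.2 (by rw [← hτ, hvw, hτ]))
    · intro w
      obtain ⟨v, hv, e⟩ := exists_of_bl_eq h.symm w.2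
      exact ⟨⟨v, hv⟩, Subtype.ext (hL₂.inj _ _ (τ _).2 w.2 ((hτ _).trans e))⟩
  exact ⟨Equiv.ofBijective τ hbij, hτ⟩

theorem degree_eq_zero {D : ZXDiagram V E} {v : V} (h : ∀ e s, D.ends e s ≠ v) : D.degree v = 0 :=
  Finset.card_eq_zero.2 (Finset.filter_eq_empty_iff.2 fun x _ => h x.1 x.2)

end distance

/-! ### Assembling the circuit -/

theorem exists_circuit {V E : Type} [Fintype V] [Fintype E] (D : ZXDiagram V E)
    (hD : D.WellFormed) (hsimple : D.IsSimple)
    (hscalar : ∀ v, D.degree v = 0 → D.phase v ≠ 2)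
    (φ : D.MCFlow) (hφ : φ.WellCovered) (hdeg : ∀ v, D.degree v ≤ 3) :
    ∃ (V' E' : Type) (_ : Fintype V') (_ : Fintype E') (C : ZXDiagram V' E') (I O : Set V')
      (σ : D.Boundary ≃ C.Boundary),
      IsCircuit C I O ∧
      (∀ b, (σ b : V') ∈ I ↔ φ.IsInput b) ∧
      (∀ b, (σ b : V') ∈ O ↔ φ.IsOutput b) ∧
      DistancePreserving D C σ := by
  have hsc : ∀ v, (∀ e s, D.ends e s ≠ v) → D.phase v ≠ 2 := fun v hv =>
    hscalar v (degree_eq_zero hv)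
  obtain ⟨_, _, _, _, X, f, g, hI, hR⟩ :=
    (φ.toQubitFlow hD hsimple hφ hdeg).reached_univ hsimple.1 hsc
  obtain ⟨hf, hDX⟩ := hI.faultEquiv
  obtain ⟨-, V', E', _, _, C, ℓ', hC, hb, hXC⟩ := hR
  -- No cut is left, so the names are the vertices of `D` themselves and match the boundaries of `D`
  -- with those of the circuit.
  have hL : Lbl D (Sum.inl : V → V ⊕ E) := ⟨hD.2, fun v w _ _ h => Sum.inl.inj h⟩
  have hbl : bl D (Sum.inl : V → V ⊕ E) = bl C ℓ' := by
    rw [← hb]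
    ext x
    constructor
    · rintro ⟨v, hv, rfl⟩
      obtain ⟨u, hu⟩ := (hI.vert v).2 trivial
      exact ⟨u, (hI.type_eq u v hu).trans hv, hu⟩
    · rintro ⟨u, hu, rfl⟩
      obtain ⟨v, hv⟩ := hf u
      exact ⟨v, (hI.type_eq u v hv).symm.trans hu, hv.symm⟩
  obtain ⟨σ, hσ⟩ := exists_boundary_equiv hL hC.toLbl hbl
  refine ⟨V', E', _, _, C, _, _, σ, hC.circuit, fun b => ?_, fun b => ?_,
    (hDX.trans hXC).distancePreserving hL hC.toLbl hσ⟩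
  · rw [MCFlow.isInput_iff hsimple]
    constructor
    · rintro ⟨-, h⟩
      rw [hσ] at h
      exact h.2
    · intro h
      refine ⟨(σ b).2, ?_⟩
      rw [hσ]
      exact ⟨b.2, h⟩
  · rw [MCFlow.isOutput_iff hsimple]
    constructor
    · rintro ⟨-, h⟩
      rw [hσ] at h
      exact h.2
    · intro h
      refine ⟨(σ b).2, ?_⟩
      rw [hσ]
      exact ⟨b.2, h⟩

end ZXDiagram

theorem mainTheorem6 {V E : Type} [Fintype V] [Fintype E] (D : ZXDiagram V E)
    (hD : D.WellFormed) (hsimple : D.IsSimple)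
    (hscalar : ∀ v, D.degree v = 0 → D.phase v ≠ 2)
    (φ : D.MCFlow) (hφ : φ.WellCovered) (hdeg : ∀ v, D.degree v ≤ 3) :
    ∃ (V' E' : Type) (_ : Fintype V') (_ : Fintype E') (C : ZXDiagram V' E') (I O : Set V')
      (σ : D.Boundary ≃ C.Boundary),
      IsCircuit C I O ∧
      (∀ b, (σ b : V') ∈ I ↔ φ.IsInput b) ∧
      (∀ b, (σ b : V') ∈ O ↔ φ.IsOutput b) ∧
      ZXDiagram.DistancePreserving D C σ :=
  ZXDiagram.exists_circuit D hD hsimple hscalar φ hφ hdeg
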